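/- **Setting.** Let $0<r_0<r_w$, $\gamma>1$, $A>0$, and let $p\in C^{2,1}([0,r_0])$ be admissible: $p\ge 0$ on $[0,r_0]$ with $p(r)=0$ if and only if $r=r_0$; $-\int_0^r s^2p'(s)\,ds\ge 0$ for all $r\in[0,r_0]$; $p'\le 0$ near $r_0$; and $p'\neq0$ for $r<r_0$ close to $r_0$, with $\lim_{r\to r_0^-}p(r)/p'(r)=0$. Put $\rho=(p/A)^{1/\gamma}$, $B_\theta(r)=\big(-\frac{2}{r^2}\int_0^r s^2p'(s)\,ds\big)^{1/2}$ on $(0,r_0]$, and $\widehat B_\theta(r)=B_\theta(r_0)\frac{r_0}{r}$ on $[r_0,r_w]$. Let $\varepsilon,\delta>0$ be the viscosities, $s>0$, $\tilde\varepsilon=s\varepsilon$, $\tilde\delta=s\delta$, and $m,k\in\mathbb Z$. For real profiles $(\xi,\eta,\zeta)$ on $(0,r_0)$ set $$a_1=-2\xi'+\tfrac{\xi}{r}+\tfrac{m}{r}\zeta-k\eta,\quad a_2=\xi'-\tfrac{2\xi}{r}-\tfrac{2m}{r}\zeta-k\eta,\quad a_3=\xi'+\tfrac{\xi}{r}+\tfrac{m}{r}\zeta+2k\eta,$$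 $$a_4=-\zeta'+\tfrac{\zeta}{r}+\tfrac{m}{r}\xi,\quad a_5=\eta'+k\xi,\quad a_6=\tfrac{m}{r}\eta-k\zeta,\quad d=\xi'+\tfrac{\xi}{r}+\tfrac{m}{r}\zeta-k\eta,$$ $$D_{m,k}=2\pi^2\int_0^{r_0}\Big\{\tilde\varepsilon\big[\tfrac29(a_1^2+a_2^2+a_3^2)+a_4^2+a_5^2+a_6^2\big]+\tilde\delta\,d^2\Big\}r\,dr,\qquad \mathcal J(\xi,\eta,\zeta)=2\pi^2\int_0^{r_0}\rho(\xi^2+\eta^2+\zeta^2)\,r\,dr,$$ $$\|(\xi,\eta,\zeta)\|_{m,k}^2=\int_0^{r_0}\Big[\sum_{i=1}^6a_i^2+d^2+\rho(\xi^2+\eta^2+\zeta^2)\Big]r\,dr .$$ Let $X_k$ be the completion of $\{(\xi,\eta,\zeta)\in C^\infty([0,r_0])^3:\xi(0)=\zeta(0)=0\}$ in $\|\cdot\|_{0,k}$ and, for $m\ne0$, let $Y_{m,k}$ be the completion of $\{(\xi,\eta,\zeta)\in C^\infty([0,r_0])^3:\xi(0)=\eta(0)=\zeta(0)=0\}$ in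 $\|\cdot\|_{m,k}$. The norms control $H^1(a,r_0)$ for every $a\in(0,r_0)$, so the elements are functions on $(0,r_0]$. For $m=0$ let $$E_{0,k}(\xi,\eta,\zeta;s)=2\pi^2\int_0^{r_0}\Big\{\frac{2p'\xi^2}{r}+B_\theta^2\Big[k\eta-\frac1r\big((r\xi)'-2\xi\big)\Big]^2+\gamma p\Big[\frac1r(r\xi)'-k\eta\Big]^2\Big\}r\,dr+D_{0,k},$$ and for $m\neq0$ let $$\begin{aligned}E_{m,k}(\xi,\eta,\zeta,\widehat Q_r;s)=\;&2\pi^2\int_0^{r_0}\Big\{(m^2+k^2r^2)\Big[\frac{B_\theta}{r}\eta+\frac{-kB_\theta(r\xi)'+2kB_\theta\xi}{m^2+k^2r^2}\Big]^2+\gamma p\Big[\frac1r(r\xi)'-k\eta+\frac{m\zeta}{r}\Big]^2\Big\}r\,dr+D_{m,k}\\&+2\pi^2\int_0^{r_0}\frac{m^2B_\theta^2}{r(m^2+k^2r^2)}(\xi-r\xi')^2dr+2\pi^2\int_0^{r_0}\Big[2p'+\frac{m^2B_\theta^2}{r}\Big]\xi^2dr\\&+2\pi^2\int_{r_0}^{r_w}\Big[|\widehat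 Q_r|^2+\frac{1}{m^2+k^2r^2}|(r\widehat Q_r)'|^2\Big]r\,dr .\end{aligned}$$ The constraint sets are $\mathcal A_1=\{(\xi,\eta,\zeta)\in X_k:\mathcal J=1\}$ and $$\mathcal A_2=\big\{((\xi,\eta,\zeta),\widehat Q_r)\in Y_{m,k}\times H^1(r_0,r_w):\ \mathcal J(\xi,\eta,\zeta)=1,\ m\widehat B_\theta\xi=r\widehat Q_r\text{ at }r=r_0,\ \widehat Q_r=0\text{ at }r=r_w\big\}.$$ **Proposition.** 1. ($m=0$) For all $k\in\mathbb Z$ and all $\varepsilon,\delta,s>0$, $E_{0,k}(\cdot\,;s)$ attains its infimum on $\mathcal A_1$. 2. ($m=0$) For every $k\in\mathbb Z\setminus\{0\}$ and all $\varepsilon,\delta>0$ there is $s_0>0$ such that $\inf_{\mathcal A_1}E_{0,k}(\cdot\,;s)<0$ for all $0<s\le s_0$. 3. ($m\ne0$) For all $m\in\mathbb Z\setminus\{0\}$, $k\in\mathbb Z$ and all $\varepsilon,\delta,s>0$, $E_{m,k}(\cdot\,;s)$ attains its infimum on $\mathcal A_2$. 4. ($m\neq0$) Let $m\in\mathbb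 Z\setminus\{0\}$ and suppose that $2p'(r^*)+\frac{m^2B_\theta(r^*)^2}{r^*}<0$ for some $r^*\in(0,r_0)$. Then there is $K$ (depending only on $m$ and the equilibrium) such that for every $k\in\mathbb Z$ with $|k|\ge K$ and all $\varepsilon,\delta>0$ there is $s_0>0$ such that $\inf_{\mathcal A_2}E_{m,k}(\cdot\,;s)<0$ for all $0<s\le s_0$. -/

import Mathlib

open MeasureTheory Set Filter Topology
open scoped ContDiff

noncomputable section

/-- A `z`-pinch equilibrium: plasma in `0 ≤ r < r₀`, vacuum in `r₀ < r < r_w`, the polytropic law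
`p = A ρ ^ γ` with `γ > 1`, and an admissible pressure profile `p` on `[0, r₀]`. Only the values of
`p` on `[0, r₀]` matter; `p'` is the derivative relative to `[0, r₀]` (one-sided at the
endpoints). -/
structure ZPinch where
  r₀ : ℝ
  r_w : ℝ
  γ : ℝ
  A : ℝ
  p : ℝ → ℝ
  r₀_pos : 0 < r₀
  r₀_lt_r_w : r₀ < r_w
  one_lt_γ : 1 < γ
  A_pos : 0 < A
  /-- `p ∈ C^{2,1}([0, r₀])`. -/
  p_contDiff : ContDiffOn ℝ 2 p (Icc 0 r₀)
  p_lipschitz : ∃ L, LipschitzOnWith L (iteratedDerivWithin 2 p (Icc 0 r₀)) (Icc 0 r₀)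
  p_nonneg : ∀ r ∈ Icc 0 r₀, 0 ≤ p r
  p_eq_zero_iff : ∀ r ∈ Icc 0 r₀, p r = 0 ↔ r = r₀
  /-- The condition under which the azimuthal magnetic field is well defined. -/
  integral_nonneg : ∀ r ∈ Icc 0 r₀, 0 ≤ -∫ s in (0 : ℝ)..r, s ^ 2 * derivWithin p (Icc 0 r₀) s
  /-- `p' ≤ 0` near `r₀`. -/
  p'_nonpos : ∃ e > 0, ∀ s ∈ Icc 0 r₀, r₀ - e < s → derivWithin p (Icc 0 r₀) s ≤ 0
  /-- `p / p' → 0` at `r₀`; the first part says that the quotient makes sense near `r₀`. -/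
  p'_ne_zero : ∀ᶠ r in 𝓝[<] r₀, derivWithin p (Icc 0 r₀) r ≠ 0
  p_div_p' : Tendsto (fun r => p r / derivWithin p (Icc 0 r₀) r) (𝓝[<] r₀) (𝓝 0)

namespace ZPinch

variable (P : ZPinch)

/-- The derivative `p'` of the pressure on `[0, r₀]`. -/
def p' (r : ℝ) : ℝ := derivWithin P.p (Icc 0 P.r₀) r

/-- The equilibrium density `ρ = (p / A) ^ (1 / γ)`. -/
def ρ (r : ℝ) : ℝ := (P.p r / P.A) ^ (1 / P.γ)

/-- The azimuthal magnetic field in the plasma, `B_θ(r) = (-(2 / r²) ∫₀ʳ s² p'(s) ds) ^ (1/2)`. -/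
def Bθ (r : ℝ) : ℝ := Real.sqrt (-(2 / r ^ 2) * ∫ s in (0 : ℝ)..r, s ^ 2 * P.p' s)

/-- The azimuthal magnetic field in the vacuum, `B_θ(r₀) r₀ / r`. -/
def BθVac (r : ℝ) : ℝ := P.Bθ P.r₀ * P.r₀ / r

end ZPinch

/-- The three real profiles `(ξ, η, ζ)` of a displacement with fixed angular modes. -/
structure Displacement where
  ξ : ℝ → ℝ
  η : ℝ → ℝ
  ζ : ℝ → ℝ

namespace Displacement

/-- Componentwise difference. -/
def sub (u v : Displacement) : Displacement where
  ξ := fun r => u.ξ r - v.ξ r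
  η := fun r => u.η r - v.η r
  ζ := fun r => u.ζ r - v.ζ r

/-- All three components belong to `C^∞([0, r₀])`. -/
def IsSmooth (r₀ : ℝ) (u : Displacement) : Prop :=
  ContDiffOn ℝ ∞ u.ξ (Icc 0 r₀) ∧ ContDiffOn ℝ ∞ u.η (Icc 0 r₀) ∧ ContDiffOn ℝ ∞ u.ζ (Icc 0 r₀)

/-- All three components are locally absolutely continuous on `(0, r₀]`. Such functions have
a derivative almost everywhere, which is their weak derivative. -/
def IsLocAC (r₀ : ℝ) (u : Displacement) : Prop :=
  ∀ a ∈ Ioo 0 r₀, AbsolutelyContinuousOnInterval u.ξ a r₀ ∧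
    AbsolutelyContinuousOnInterval u.η a r₀ ∧ AbsolutelyContinuousOnInterval u.ζ a r₀

/-- The divergence `ξ' + ξ / r + m ζ / r - k η`. -/
def divg (m k : ℤ) (u : Displacement) (r : ℝ) : ℝ :=
  deriv u.ξ r + u.ξ r / r + m / r * u.ζ r - k * u.η r

/-- The integrand (without the weight `r`) of the viscous dissipation with viscosities `ε`, `δ`. -/
def viscDensity (m k : ℤ) (ε δ : ℝ) (u : Displacement) (r : ℝ) : ℝ :=
  ε * (2 / 9 * (-2 * deriv u.ξ r + u.ξ r / r + m / r * u.ζ r - k * u.η r) ^ 2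
    + 2 / 9 * (deriv u.ξ r - 2 * u.ξ r / r - 2 * m / r * u.ζ r - k * u.η r) ^ 2
    + 2 / 9 * (deriv u.ξ r + u.ξ r / r + m / r * u.ζ r + 2 * k * u.η r) ^ 2
    + (-deriv u.ζ r + u.ζ r / r + m / r * u.ξ r) ^ 2
    + (deriv u.η r + k * u.ξ r) ^ 2
    + (m / r * u.η r - k * u.ζ r) ^ 2)
  + δ * (u.divg m k r) ^ 2

end Displacement

namespace ZPinch

variable (P : ZPinch)

/-- The square of the norm of `Y_{m,k}`; for `m = 0` it is the square of the norm of `X_k`. -/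
def normSq (m k : ℤ) (u : Displacement) : ENNReal :=
  ∫⁻ r in Ioo 0 P.r₀, ENNReal.ofReal
    (((-2 * deriv u.ξ r + u.ξ r / r + m / r * u.ζ r - k * u.η r) ^ 2
      + (deriv u.ξ r - 2 * u.ξ r / r - 2 * m / r * u.ζ r - k * u.η r) ^ 2
      + (deriv u.ξ r + u.ξ r / r + m / r * u.ζ r + 2 * k * u.η r) ^ 2
      + (-deriv u.ζ r + u.ζ r / r + m / r * u.ξ r) ^ 2
      + (deriv u.η r + k * u.ξ r) ^ 2
      + (m / r * u.η r - k * u.ζ r) ^ 2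
      + (u.divg m k r) ^ 2
      + P.ρ r * (u.ξ r ^ 2 + u.η r ^ 2 + u.ζ r ^ 2)) * r)

/-- The space `X_k`: the completion, in the norm above with `m = 0`, of the smooth triples on
`[0, r₀]` with `ξ(0) = ζ(0) = 0`. The norm controls the `H¹` norm on every `[a, r₀]`, `a > 0`, so
the completion is realized by (locally absolutely continuous representatives of) the limits in
norm of sequences of such triples. -/
def X (k : ℤ) : Set Displacement :=
  {u | u.IsLocAC P.r₀ ∧ ∃ v : ℕ → Displacement,
    (∀ n, (v n).IsSmooth P.r₀ ∧ (v n).ξ 0 = 0 ∧ (v n).ζ 0 = 0) ∧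
    Tendsto (fun n => P.normSq 0 k (u.sub (v n))) atTop (𝓝 0)}

/-- The space `Y_{m,k}`: the completion, realized in the same way, of the smooth triples on
`[0, r₀]` with `ξ(0) = η(0) = ζ(0) = 0`. -/
def Y (m k : ℤ) : Set Displacement :=
  {u | u.IsLocAC P.r₀ ∧ ∃ v : ℕ → Displacement,
    (∀ n, (v n).IsSmooth P.r₀ ∧ (v n).ξ 0 = 0 ∧ (v n).η 0 = 0 ∧ (v n).ζ 0 = 0) ∧
    Tendsto (fun n => P.normSq m k (u.sub (v n))) atTop (𝓝 0)}

/-- The space `H¹(r₀, r_w)`, by absolutely continuous representatives on `[r₀, r_w]`. -/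
def H1Vac : Set (ℝ → ℝ) :=
  {Q | AbsolutelyContinuousOnInterval Q P.r₀ P.r_w ∧
    MemLp (deriv Q) 2 (volume.restrict (Ioo P.r₀ P.r_w))}

/-- `J(ξ, η, ζ) = 2π² ∫₀^{r₀} ρ (ξ² + η² + ζ²) r dr`. -/
def J (u : Displacement) : ℝ :=
  2 * Real.pi ^ 2 * ∫ r in Ioo 0 P.r₀, P.ρ r * (u.ξ r ^ 2 + u.η r ^ 2 + u.ζ r ^ 2) * r

/-- The modified energy `E_{0,k}(ξ, η, ζ; s)`, with viscosities `s ε` and `s δ`. -/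
def E₀ (k : ℤ) (ε δ s : ℝ) (u : Displacement) : ℝ :=
  2 * Real.pi ^ 2 * (∫ r in Ioo 0 P.r₀,
      (2 * P.p' r * u.ξ r ^ 2 / r
        + P.Bθ r ^ 2 * (k * u.η r - (deriv (fun x => x * u.ξ x) r - 2 * u.ξ r) / r) ^ 2
        + P.γ * P.p r * (deriv (fun x => x * u.ξ x) r / r - k * u.η r) ^ 2) * r)
  + 2 * Real.pi ^ 2 * (∫ r in Ioo 0 P.r₀, u.viscDensity 0 k (s * ε) (s * δ) r * r)

/-- The modified energy `E_{m,k}(ξ, η, ζ, Q; s)` for `m ≠ 0`, with viscosities `s ε` and `s δ`;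
`Q` is the radial component of the magnetic perturbation in the vacuum. -/
def E (m k : ℤ) (ε δ s : ℝ) (w : Displacement × (ℝ → ℝ)) : ℝ :=
  2 * Real.pi ^ 2 * (∫ r in Ioo 0 P.r₀,
      ((m ^ 2 + k ^ 2 * r ^ 2) * (P.Bθ r / r * w.1.η r
          + (-k * P.Bθ r * deriv (fun x => x * w.1.ξ x) r + 2 * k * P.Bθ r * w.1.ξ r)
            / (m ^ 2 + k ^ 2 * r ^ 2)) ^ 2
        + P.γ * P.p r
          * (deriv (fun x => x * w.1.ξ x) r / r - k * w.1.η r + m * w.1.ζ r / r) ^ 2) * r)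
  + 2 * Real.pi ^ 2 * (∫ r in Ioo 0 P.r₀, w.1.viscDensity m k (s * ε) (s * δ) r * r)
  + 2 * Real.pi ^ 2 * (∫ r in Ioo 0 P.r₀,
      m ^ 2 * P.Bθ r ^ 2 / (r * (m ^ 2 + k ^ 2 * r ^ 2)) * (w.1.ξ r - r * deriv w.1.ξ r) ^ 2)
  + 2 * Real.pi ^ 2 * (∫ r in Ioo 0 P.r₀,
      (2 * P.p' r + m ^ 2 * P.Bθ r ^ 2 / r) * w.1.ξ r ^ 2)
  + 2 * Real.pi ^ 2 * (∫ r in Ioo P.r₀ P.r_w,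
      (w.2 r ^ 2 + 1 / (m ^ 2 + k ^ 2 * r ^ 2) * (deriv (fun x => x * w.2 x) r) ^ 2) * r)

/-- The constraint set `A₁` for `m = 0`. -/
def A₁ (k : ℤ) : Set Displacement := {u | u ∈ P.X k ∧ P.J u = 1}

/-- The constraint set `A₂` for `m ≠ 0`. -/
def A₂ (m k : ℤ) : Set (Displacement × (ℝ → ℝ)) :=
  {w | w.1 ∈ P.Y m k ∧ w.2 ∈ P.H1Vac ∧ P.J w.1 = 1 ∧
    m * P.BθVac P.r₀ * w.1.ξ P.r₀ = P.r₀ * w.2 P.r₀ ∧ w.2 P.r_w = 0}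

/-- The infimum of `E_{0,k}( · ; s)` over `A₁`. -/
def lam₀ (k : ℤ) (ε δ s : ℝ) : ℝ := sInf (P.E₀ k ε δ s '' P.A₁ k)

/-- The infimum of `E_{m,k}( · ; s)` over `A₂`, for `m ≠ 0`. -/
def lam (m k : ℤ) (ε δ s : ℝ) : ℝ := sInf (P.E m k ε δ s '' P.A₂ m k)

end ZPinch

end

/-! Existence (parts 1 and 3) is the direct method, run with strong rather than weak convergence. If
`l` is the infimum of `E` on `{J = 1}`, homogeneity makes `E - l * J` a nonnegative quadratic form,
so the parallelogram law bounds it at `u - v` by twice the sum of its values at `u` and `v`. Along a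
minimizing sequence these values tend to zero. If moreover a subsequence is Cauchy for `J`, the
Gårding inequality makes it Cauchy for the full norm, and completeness supplies the minimizer. This
is `exists_isMin_of_garding`.

Its three analytic inputs are compactness of `J` (`exists_subseq_J_cauchy`), completeness
(`exists_nrm_limit`, `exists_sob_limit`) and the Gårding inequality (`exists_garding`). All rest on
one pointwise estimate, `exists_abs_comp_le`: a displacement of norm at most `M` is bounded by a
multiple of `M * r ^ (-1/4)`. Square integrability of derivatives against `r dr` allows only
logarithmic growth at the axis, and `r ^ (-1/4)` is a convenient majorant with integrable square.
Near `r₀`, where `ρ` degenerates, the bound comes from integrating the derivative starting in the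
interior. The viscous dissipation controls every square in the norm except the kinetic one, and the
only indefinite terms of the energy are bounded by a multiple of the squared components, which
interpolation (`exists_integral_sq_le_add`) absorbs into a small part of the norm and a multiple of
`J`.

Negativity (parts 2 and 4) reduces to the inviscid energy, because the dissipation of a fixed test
displacement is linear in `s`. For `m = 0`, choose `η` so that the magnetic square vanishes; what
remains is `(2p' + 4γp/r) ξ²`, which is negative near `r₀` because `p / p' → 0` there. For `m ≠ 0`,
choose `η` and `ζ` so that the magnetic and compression squares both vanish. The destabilizing term
then depends only on `ξ` and not on `k`, while the bending term is `O(k⁻²)`. Since `ξ` vanishes at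
`r₀`, the vacuum field may be taken to be zero. -/

/-! ### Abstract minimization of quadratic functionals -/

/-- A quadratic functional `E` attains its infimum on the quadric `{J = 1}` of a space that is
complete for `N`, if `E` satisfies a Gårding inequality and `J` is compact relative to `N`. -/
theorem exists_isMin_of_garding {M : Type*} [AddCommGroup M] [Module ℝ M] (V : Submodule ℝ M)
    (N E J : M → ℝ) {c C C₁ C₂ : ℝ} (hc : 0 < c)
    (N_nonneg : ∀ u ∈ V, 0 ≤ N u) (J_nonneg : ∀ u ∈ V, 0 ≤ J u)
    (E_smul : ∀ u ∈ V, ∀ t : ℝ, E (t • u) = t ^ 2 * E u)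
    (J_smul : ∀ u ∈ V, ∀ t : ℝ, J (t • u) = t ^ 2 * J u)
    (E_par : ∀ u ∈ V, ∀ v ∈ V, E (u + v) + E (u - v) = 2 * E u + 2 * E v)
    (J_par : ∀ u ∈ V, ∀ v ∈ V, J (u + v) + J (u - v) = 2 * J u + 2 * J v)
    (J_add_le : ∀ u ∈ V, ∀ v ∈ V, ∀ t > 0, J (u + v) ≤ (1 + t) * J u + (1 + 1 / t) * J v)
    (E_le : ∀ u ∈ V, E u ≤ C₁ * N u) (J_le : ∀ u ∈ V, J u ≤ C₂ * N u)
    (garding : ∀ u ∈ V, c * N u ≤ E u + C * J u)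
    (compact : ∀ u : ℕ → M, (∀ n, u n ∈ V) → (∃ B, ∀ n, N (u n) ≤ B) →
      ∃ φ : ℕ → ℕ, StrictMono φ ∧
        Tendsto (fun q : ℕ × ℕ => J (u (φ q.1) - u (φ q.2))) atTop (𝓝 0))
    (complete : ∀ u : ℕ → M, (∀ n, u n ∈ V) →
      Tendsto (fun q : ℕ × ℕ => N (u q.1 - u q.2)) atTop (𝓝 0) →
      ∃ v ∈ V, ∃ φ : ℕ → ℕ, StrictMono φ ∧
        Tendsto (fun n => N (v - u (φ n))) atTop (𝓝 0))
    (nonempty : ∃ u ∈ V, 0 < J u) :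
    ∃ u ∈ V, J u = 1 ∧ ∀ v ∈ V, J v = 1 → E u ≤ E v := by
  have normalize : ∀ u ∈ V, 0 < J u → ∃ t : ℝ, t ^ 2 * J u = 1 := fun u _ h =>
    ⟨(Real.sqrt (J u))⁻¹, by rw [inv_pow, Real.sq_sqrt h.le, inv_mul_cancel₀ h.ne']⟩
  set S : Set ℝ := E '' {u | u ∈ V ∧ J u = 1} with hS
  have hSne : S.Nonempty := by
    obtain ⟨u, hu, hJ⟩ := nonempty
    obtain ⟨t, ht⟩ := normalize u hu hJ
    exact ⟨_, t • u, ⟨V.smul_mem t hu, by rw [J_smul u hu, ht]⟩, rfl⟩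
  have hSbdd : BddBelow S := by
    refine ⟨-C, ?_⟩
    rintro _ ⟨u, ⟨hu, hJ⟩, rfl⟩
    have h1 := garding u hu
    have h2 := mul_nonneg hc.le (N_nonneg u hu)
    rw [hJ] at h1
    linarith
  set l := sInf S with hl
  -- Where `J u > 0` this is homogeneity; where `J u = 0` no normalization exists and Gårding itself
  -- gives `E u ≥ 0`.
  have hq : ∀ u ∈ V, 0 ≤ E u - l * J u := by
    intro u hu
    rcases (J_nonneg u hu).eq_or_lt with h | h
    · have h1 := garding u hu
      have h2 := mul_nonneg hc.le (N_nonneg u hu)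
      rw [← h] at h1 ⊢
      linarith
    · obtain ⟨t, ht⟩ := normalize u hu h
      have h1 : l ≤ E (t • u) :=
        csInf_le hSbdd ⟨t • u, ⟨V.smul_mem t hu, by rw [J_smul u hu, ht]⟩, rfl⟩
      rw [E_smul u hu] at h1
      have h2 : 0 ≤ t ^ 2 * (E u - l * J u) := by linear_combination h1 + l * ht
      have h3 : 0 < t ^ 2 := by
        rcases (sq_nonneg t).eq_or_lt with h0 | h0
        · rw [← h0] at ht; norm_num at ht
        · exact h0
      exact nonneg_of_mul_nonneg_right h2 h3
  -- The nonnegative value at `u + v` is dropped from the parallelogram law.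
  have hq_sub : ∀ u ∈ V, ∀ v ∈ V,
      E (u - v) - l * J (u - v) ≤ 2 * (E u - l * J u) + 2 * (E v - l * J v) := by
    intro u hu v hv
    have h1 := hq _ (V.add_mem hu hv)
    linear_combination h1 + E_par u hu v hv - l * J_par u hu v hv
  obtain ⟨e, -, he, heS⟩ := exists_seq_tendsto_sInf hSne hSbdd
  choose u hu hue using heS
  have huV : ∀ n, u n ∈ V := fun n => (hu n).1
  have huJ : ∀ n, J (u n) = 1 := fun n => (hu n).2
  have hNb : ∃ B, ∀ n, N (u n) ≤ B := by
    obtain ⟨B, hB⟩ := he.bddAbove_range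
    refine ⟨(B + C) / c, fun n => ?_⟩
    rw [le_div_iff₀ hc]
    have h1 := garding _ (huV n)
    have h2 : E (u n) ≤ B := hue n ▸ hB (mem_range_self n)
    rw [huJ n] at h1
    linarith
  obtain ⟨φ, hφ, hJc⟩ := compact u huV hNb
  have hqt : Tendsto (fun n => E (u (φ n)) - l) atTop (𝓝 0) := by
    have h1 := (he.comp hφ.tendsto_atTop).sub_const l
    rw [sub_self] at h1
    exact h1.congr fun n => by simp [hue]
  -- Gårding for differences: `c * N ≤ (E - l * J) + (l + C) * J`, where the first term is small by
  -- `hq_sub` and the second by compactness.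
  have hNc : Tendsto (fun q : ℕ × ℕ => N (u (φ q.1) - u (φ q.2))) atTop (𝓝 0) := by
    have h1 : Tendsto (fun q : ℕ × ℕ =>
        (2 * (E (u (φ q.1)) - l) + 2 * (E (u (φ q.2)) - l)
          + (l + C) * J (u (φ q.1) - u (φ q.2))) / c) atTop (𝓝 0) := by
      have h2 := hqt.comp (tendsto_fst (f := (atTop : Filter ℕ)) (g := (atTop : Filter ℕ)))
      have h3 := hqt.comp (tendsto_snd (f := (atTop : Filter ℕ)) (g := (atTop : Filter ℕ)))
      rw [prod_atTop_atTop_eq] at h2 h3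
      have h4 := ((((h2.const_mul 2).add (h3.const_mul 2))).add (hJc.const_mul (l + C))).div_const c
      simpa using h4
    refine squeeze_zero (fun q => N_nonneg _ (V.sub_mem (huV _) (huV _))) (fun q => ?_) h1
    rw [le_div_iff₀ hc]
    have h2 := hq_sub _ (huV (φ q.1)) _ (huV (φ q.2))
    have h3 := garding _ (V.sub_mem (huV (φ q.1)) (huV (φ q.2)))
    rw [huJ, huJ] at h2
    linarith
  obtain ⟨v, hv, ψ, hψ, hvN⟩ := complete (fun n => u (φ n)) (fun n => huV _) hNc
  have hJt : Tendsto (fun n => J (v - u (φ (ψ n)))) atTop (𝓝 0) :=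
    squeeze_zero (fun n => J_nonneg _ (V.sub_mem hv (huV _)))
      (fun n => J_le _ (V.sub_mem hv (huV _))) (by simpa using hvN.const_mul C₂)
  have hEub : Tendsto (fun n => C₁ * N (v - u (φ (ψ n)))) atTop (𝓝 0) := by
    simpa using hvN.const_mul C₁
  -- The constraint passes to the limit through the weighted inequality `J_add_le` with `t → 0`; the
  -- parallelogram law alone would lose a factor 2.
  have hJle : ∀ t : ℝ, 0 < t → J v ≤ 1 + t := by
    intro t ht
    have h1 : Tendsto (fun n => (1 + t) * 1 + (1 + 1 / t) * J (v - u (φ (ψ n)))) atTop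
        (𝓝 (1 + t)) := by
      simpa using (hJt.const_mul (1 + 1 / t)).const_add ((1 + t) * 1)
    refine ge_of_tendsto' h1 fun n => ?_
    have h2 := J_add_le _ (huV (φ (ψ n))) _ (V.sub_mem hv (huV (φ (ψ n)))) t ht
    rwa [add_sub_cancel, huJ] at h2
  have hJge : ∀ t : ℝ, 0 < t → 1 ≤ (1 + t) * J v := by
    intro t ht
    have h1 : Tendsto (fun n => (1 + t) * J v + (1 + 1 / t) * J (v - u (φ (ψ n)))) atTop
        (𝓝 ((1 + t) * J v)) := by
      simpa using (hJt.const_mul (1 + 1 / t)).const_add ((1 + t) * J v)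
    refine ge_of_tendsto' h1 fun n => ?_
    have h2 := J_add_le _ hv _ (V.smul_mem (-1) (V.sub_mem hv (huV (φ (ψ n))))) t ht
    rw [J_smul _ (V.sub_mem hv (huV _))] at h2
    have h3 : v + (-1 : ℝ) • (v - u (φ (ψ n))) = u (φ (ψ n)) := by module
    rw [h3, huJ] at h2
    linarith
  have hJv : J v = 1 := by
    refine le_antisymm (le_of_forall_pos_le_add hJle) ?_
    have h1 : Tendsto (fun t : ℝ => (1 + t) * J v) (𝓝[>] 0) (𝓝 ((1 + 0) * J v)) :=
      ((tendsto_nhdsWithin_of_tendsto_nhds tendsto_id).const_add 1).mul_const _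
    have h2 := ge_of_tendsto h1 (eventually_nhdsWithin_of_forall fun t ht => hJge t ht)
    simpa using h2
  -- Here the factor 2 is harmless because the limit is zero: `v` is the difference of `v - u` and
  -- `-u`, and `E - l * J` tends to zero along both.
  have hEv : E v - l * J v ≤ 0 := by
    have h1 : Tendsto (fun n => 2 * (C₁ * N (v - u (φ (ψ n))) + |l| * J (v - u (φ (ψ n))))
        + 2 * (E (u (φ (ψ n))) - l)) atTop (𝓝 0) := by
      have := ((hEub.add (hJt.const_mul |l|)).const_mul 2).add
        ((hqt.comp hψ.tendsto_atTop).const_mul 2)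
      simpa using this
    refine ge_of_tendsto' h1 fun n => ?_
    have hw := V.sub_mem hv (huV (φ (ψ n)))
    have h2 := hq_sub _ hw _ (V.smul_mem (-1) (huV (φ (ψ n))))
    have h3 : v - u (φ (ψ n)) - (-1 : ℝ) • u (φ (ψ n)) = v := by module
    rw [h3, E_smul _ (huV _), J_smul _ (huV _), huJ] at h2
    have h4 := E_le _ hw
    have h5 := mul_le_mul_of_nonneg_right (neg_abs_le l) (J_nonneg _ hw)
    linarith
  refine ⟨v, hv, hJv, fun w hw hJw => ?_⟩
  have h1 : l ≤ E w := csInf_le hSbdd ⟨w, ⟨hw, hJw⟩, rfl⟩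
  rw [hJv] at hEv
  linarith

/-! ### Limits of sequences of functions on an interval -/

/-- A pointwise bounded, equicontinuous sequence of functions on a set of reals has a subsequence
that converges pointwise. -/
theorem exists_subseq_tendsto_of_equicontinuous (f : ℕ → ℝ → ℝ) (S : Set ℝ)
    (hb : ∀ x ∈ S, ∃ B, ∀ n, |f n x| ≤ B)
    (heq : ∀ x ∈ S, ∀ ε > 0, ∃ δ > 0, ∀ y ∈ S, |y - x| < δ → ∀ n, |f n x - f n y| ≤ ε) :
    ∃ φ : ℕ → ℕ, StrictMono φ ∧ ∀ x ∈ S, ∃ l, Tendsto (fun n => f (φ n) x) atTop (𝓝 l) := by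
  obtain ⟨D, hDc, hDd⟩ := TopologicalSpace.exists_countable_dense S
  choose! B hB using hb
  -- Compactness of a countable product of intervals replaces the diagonal argument.
  have hK : IsCompact (univ.pi fun d : D => Icc (-B d.1.1) (B d.1.1)) :=
    isCompact_univ_pi fun d => isCompact_Icc
  have : Countable D := hDc.to_subtype
  obtain ⟨L, -, φ, hφ, hL⟩ := hK.tendsto_subseq (x := fun n (d : D) => f n d.1.1)
    (fun n d _ => abs_le.mp (hB d.1.1 d.1.2 n))
  rw [tendsto_pi_nhds] at hL
  refine ⟨φ, hφ, fun x hx => cauchySeq_tendsto_of_complete ?_⟩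
  rw [Metric.cauchySeq_iff]
  intro ε hε
  obtain ⟨δ, hδ, h⟩ := heq x hx (ε / 4) (by positivity)
  obtain ⟨d, hd, hdx⟩ := hDd.exists_dist_lt ⟨x, hx⟩ hδ
  have hdx' : |d.1 - x| < δ := by
    rw [dist_comm] at hdx; simpa [Subtype.dist_eq, Real.dist_eq] using hdx
  obtain ⟨N, hN⟩ := Metric.cauchySeq_iff.mp (hL ⟨d, hd⟩).cauchySeq (ε / 4) (by positivity)
  refine ⟨N, fun m hm n hn => ?_⟩
  have h1 := h d.1 d.2 hdx' (φ m)
  have h2 := h d.1 d.2 hdx' (φ n)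
  have h3 := hN m hm n hn
  simp only [Function.comp_apply, Real.dist_eq] at h3 ⊢
  rw [abs_le] at h1 h2
  rw [abs_lt] at h3 ⊢
  constructor <;> linarith

/-- An almost everywhere bound on the derivative of an absolutely continuous function bounds its
increments. -/
theorem AbsolutelyContinuousOnInterval.abs_sub_le {f h : ℝ → ℝ} {a b x y : ℝ}
    (hf : AbsolutelyContinuousOnInterval f a b) (hh : IntegrableOn h (Ioo a b))
    (hb : ∀ᵐ r ∂volume.restrict (Ioo a b), |deriv f r| ≤ h r) (hax : a ≤ x) (hxy : x ≤ y)
    (hyb : y ≤ b) : |f y - f x| ≤ ∫ r in Ioo x y, h r := by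
  have hsub : Ioo x y ⊆ Ioo a b := Ioo_subset_Ioo hax hyb
  have hf' : AbsolutelyContinuousOnInterval f x y := hf.mono <| by
    rw [uIcc_of_le hxy, uIcc_of_le (hax.trans (hxy.trans hyb))]
    exact Icc_subset_Icc hax hyb
  rw [← hf'.integral_deriv_eq_sub, intervalIntegral.integral_of_le hxy,
    integral_Ioc_eq_integral_Ioo]
  rw [← Real.norm_eq_abs]
  refine norm_integral_le_of_norm_le (hh.mono_set hsub) ?_
  exact ae_mono (Measure.restrict_mono hsub le_rfl) hb

/-- The derivatives of a sequence that is summably Cauchy in `W^{1,1}` converge almost everywhere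
to the derivative of the limit, which is absolutely continuous. -/
theorem AbsolutelyContinuousOnInterval.of_tendsto {a b K : ℝ} (hab : a < b) {f : ℕ → ℝ → ℝ}
    {g : ℝ → ℝ} (hf : ∀ n, AbsolutelyContinuousOnInterval (f n) a b)
    (hlim : ∀ x ∈ Icc a b, Tendsto (fun n => f n x) atTop (𝓝 (g x)))
    (hc : ∀ N n m, N ≤ n → N ≤ m →
      ∫ r in Ioo a b, |deriv (f n) r - deriv (f m) r| ≤ K * (1 / 2) ^ N) :
    AbsolutelyContinuousOnInterval g a b ∧
      ∀ᵐ x ∂volume.restrict (Ioo a b),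
        Tendsto (fun n => deriv (f n) x) atTop (𝓝 (deriv g x)) := by
  have hint : ∀ n, IntegrableOn (deriv (f n)) (Ioo a b) := fun n => by
    have := (hf n).intervalIntegrable_deriv
    rw [intervalIntegrable_iff_integrableOn_Ioo_of_le hab.le] at this
    exact this
  -- `|K| + 1` makes the bound positive and the comparison with `K` strict, whatever the sign of
  -- `K`.
  set B : ℕ → ENNReal := fun N => ENNReal.ofReal ((|K| + 1) * (1 / 2) ^ N) with hBdef
  have hB : ∑' i, B i ≠ ⊤ :=
    ((summable_geometric_of_lt_one (by norm_num) (by norm_num)).mul_left _).tsum_ofReal_ne_top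
  have hcB : ∀ N n m, N ≤ n → N ≤ m →
      eLpNorm (deriv (f n) - deriv (f m)) 1 (volume.restrict (Ioo a b)) < B N := by
    intro N n m hn hm
    rw [eLpNorm_one_eq_lintegral_enorm,
      ← ofReal_integral_norm_eq_lintegral_enorm ((hint n).sub (hint m))]
    refine (ENNReal.ofReal_lt_ofReal_iff (by positivity)).mpr ?_
    refine lt_of_le_of_lt (hc N n m hn hm) ?_
    have : (0 : ℝ) < (1 / 2) ^ N := by positivity
    nlinarith [le_abs_self K]
  obtain ⟨G, hG, hGt⟩ := Lp.cauchy_complete_eLpNorm le_rfl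
    (fun n => memLp_one_iff_integrable.mpr (hint n)) hB hcB
  have hGi : IntegrableOn G (Ioo a b) := memLp_one_iff_integrable.mp hG
  have hGii : IntervalIntegrable G volume a b := by
    rwa [intervalIntegrable_iff_integrableOn_Ioo_of_le hab.le]
  -- With `G` the `L¹` limit of the derivatives, the fundamental theorem of calculus passes to the
  -- limit.
  have hgeq : ∀ x ∈ Icc a b, g x = g a + ∫ r in a..x, G r := by
    intro x hx
    have h1 : Tendsto (fun n => ∫ r in Ioo a x, deriv (f n) r) atTop
        (𝓝 (∫ r in Ioo a x, G r)) := by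
      have hsub : Ioo a x ⊆ Ioo a b := Ioo_subset_Ioo le_rfl hx.2
      refine tendsto_integral_of_L1' _ (hGi.mono_set hsub).aestronglyMeasurable
        (Eventually.of_forall fun n => (hint n).mono_set hsub) ?_
      exact tendsto_of_tendsto_of_tendsto_of_le_of_le tendsto_const_nhds hGt (fun _ => zero_le)
        fun n => eLpNorm_mono_measure _ (Measure.restrict_mono hsub le_rfl)
    have h2 : ∀ n, ∫ r in Ioo a x, deriv (f n) r = f n x - f n a := by
      intro n
      rw [← ((hf n).mono (c := a) (d := x) ?_).integral_deriv_eq_sub,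
        intervalIntegral.integral_of_le hx.1, integral_Ioc_eq_integral_Ioo]
      rw [uIcc_of_le hx.1, uIcc_of_le hab.le]
      exact Icc_subset_Icc le_rfl hx.2
    simp only [h2] at h1
    have h3 := tendsto_nhds_unique h1 ((hlim x hx).sub (hlim a ⟨le_rfl, hab.le⟩))
    rw [intervalIntegral.integral_of_le hx.1, integral_Ioc_eq_integral_Ioo, h3]
    ring
  have hAC : AbsolutelyContinuousOnInterval (fun x => g a + ∫ r in a..x, G r) a b := by
    have h1 := hGii.absolutelyContinuousOnInterval_intervalIntegral (c := a) left_mem_uIcc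
    have h2 : AbsolutelyContinuousOnInterval (fun _ : ℝ => g a) a b :=
      (LipschitzWith.const (g a)).lipschitzOnWith.absolutelyContinuousOnInterval
    exact h2.add h1
  have hgAC : AbsolutelyContinuousOnInterval g a b := by
    rw [absolutelyContinuousOnInterval_iff] at hAC ⊢
    intro ε hε
    obtain ⟨δ, hδ, h⟩ := hAC ε hε
    refine ⟨δ, hδ, fun E hE hEδ => lt_of_eq_of_lt ?_ (h E hE hEδ)⟩
    refine Finset.sum_congr rfl fun i hi => ?_
    have h1 := hE.1 i hi
    rw [uIcc_of_le hab.le] at h1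
    rw [hgeq _ h1.1, hgeq _ h1.2]
  refine ⟨hgAC, ?_⟩
  -- The summable rate gives almost everywhere convergence of the whole sequence; its limit is
  -- identified with `G` along a subsequence, and Lebesgue differentiation identifies `G` with
  -- `deriv g`.
  have hae := Lp.ae_tendsto_of_cauchy_eLpNorm (fun n => (hint n).aestronglyMeasurable) le_rfl hB hcB
  have hder := hGii.ae_hasDerivAt_integral
  obtain ⟨ns, hns, hsub⟩ := (tendstoInMeasure_of_tendsto_eLpNorm one_ne_zero
    (fun n => (hint n).aestronglyMeasurable) hG.aestronglyMeasurable hGt).exists_seq_tendsto_ae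
  filter_upwards [hae, hsub, ae_restrict_of_ae hder, ae_restrict_mem measurableSet_Ioo]
    with x ⟨l, hl⟩ hx hd hxm
  have h1 : l = G x := tendsto_nhds_unique (hl.comp hns.tendsto_atTop) hx
  have h2 : HasDerivAt g (G x) x := by
    have h3 := hd (by rw [uIcc_of_le hab.le]; exact Ioo_subset_Icc_self hxm) a left_mem_uIcc
    refine (h3.const_add (g a)).congr_of_eventuallyEq ?_
    filter_upwards [isOpen_Ioo.mem_nhds hxm] with y hy
    exact hgeq y (Ioo_subset_Icc_self hy)
  rw [h2.deriv, ← h1]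
  exact hl

/-! ### Local absolute continuity and jets of displacements -/

/-- Local absolute continuity on `(0, b]`. -/
def LocAC (b : ℝ) (f : ℝ → ℝ) : Prop :=
  ∀ a ∈ Ioo 0 b, AbsolutelyContinuousOnInterval f a b

theorem ae_restrict_Ioo_zero {b : ℝ} {q : ℝ → Prop}
    (h : ∀ a ∈ Ioo 0 b, ∀ᵐ r ∂volume.restrict (Ioo a b), q r) :
    ∀ᵐ r ∂volume.restrict (Ioo 0 b), q r := by
  rcases le_or_gt b 0 with hb | hb
  · simp [Ioo_eq_empty_of_le hb]
  -- A countable exhaustion; the shift by 2 keeps the left endpoint strictly below `b` already for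
  -- `n = 0`.
  have h1 : Ioo 0 b ⊆ ⋃ n : ℕ, Ioo (b / (n + 2)) b := by
    intro x hx
    obtain ⟨n, hn⟩ := exists_nat_gt (b / x)
    refine mem_iUnion.mpr ⟨n, ?_, hx.2⟩
    rw [div_lt_iff₀ hx.1] at hn
    rw [div_lt_iff₀ (by positivity)]
    nlinarith [hx.1]
  refine ae_mono (Measure.restrict_mono h1 le_rfl) ?_
  refine (ae_restrict_iUnion_iff _ _).mpr fun n => h _ ⟨by positivity, ?_⟩
  exact div_lt_self hb (by linarith [(Nat.cast_nonneg n : (0 : ℝ) ≤ n)])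

namespace LocAC

variable {b : ℝ} {f g : ℝ → ℝ}

theorem continuousOn (hf : LocAC b f) : ContinuousOn f (Ioc 0 b) := by
  intro x hx
  have ha : min (x / 2) (b / 2) ∈ Ioo 0 b :=
    ⟨lt_min (by linarith [hx.1]) (by linarith [hx.1, hx.2]),
      (min_le_right _ _).trans_lt (by linarith [hx.1, hx.2])⟩
  have h1 := (hf _ ha).continuousOn
  rw [uIcc_of_le ha.2.le] at h1
  have hx' : min (x / 2) (b / 2) < x := (min_le_left _ _).trans_lt (by linarith [hx.1])
  refine (h1 x ⟨hx'.le, hx.2⟩).mono_of_mem_nhdsWithin ?_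
  filter_upwards [self_mem_nhdsWithin, mem_nhdsWithin_of_mem_nhds (Ioi_mem_nhds hx')]
    with y hy hy'
  exact ⟨le_of_lt hy', hy.2⟩

theorem aestronglyMeasurable (hf : LocAC b f) :
    AEStronglyMeasurable f (volume.restrict (Ioo 0 b)) :=
  (hf.continuousOn.mono Ioo_subset_Ioc_self).aestronglyMeasurable measurableSet_Ioo

theorem ae_differentiableAt (hf : LocAC b f) :
    ∀ᵐ r ∂volume.restrict (Ioo 0 b), DifferentiableAt ℝ f r := by
  refine ae_restrict_Ioo_zero fun a ha => ?_
  filter_upwards [ae_restrict_of_ae (hf a ha).ae_differentiableAt,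
    ae_restrict_mem measurableSet_Ioo] with r hr hrm
  exact hr (by rw [uIcc_of_le ha.2.le]; exact Ioo_subset_Icc_self hrm)

theorem add (hf : LocAC b f) (hg : LocAC b g) : LocAC b (f + g) :=
  fun a ha => (hf a ha).add (hg a ha)

theorem smul (c : ℝ) (hf : LocAC b f) : LocAC b (c • f) :=
  fun a ha => (hf a ha).const_smul c

end LocAC

namespace Displacement

/-- A displacement as a triple of functions. -/
def equivProd : Displacement ≃ (ℝ → ℝ) × (ℝ → ℝ) × (ℝ → ℝ) where
  toFun u := (u.ξ, u.η, u.ζ)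
  invFun t := ⟨t.1, t.2.1, t.2.2⟩
  left_inv _ := rfl
  right_inv _ := rfl

/-- The transported subtraction is definitionally `Displacement.sub`, so the approximation
conditions in `X` and `Y` can be read in this group. -/
noncomputable instance : AddCommGroup Displacement := equivProd.addCommGroup

noncomputable instance : Module ℝ Displacement := equivProd.module ℝ

variable (u v : Displacement) (c : ℝ)

theorem add_ξ : (u + v).ξ = u.ξ + v.ξ := rfl
theorem add_η : (u + v).η = u.η + v.η := rfl
theorem add_ζ : (u + v).ζ = u.ζ + v.ζ := rfl
theorem sub_ξ : (u - v).ξ = u.ξ - v.ξ := rfl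
theorem sub_η : (u - v).η = u.η - v.η := rfl
theorem sub_ζ : (u - v).ζ = u.ζ - v.ζ := rfl
theorem smul_ξ : (c • u).ξ = c • u.ξ := rfl
theorem smul_η : (c • u).η = c • u.η := rfl
theorem smul_ζ : (c • u).ζ = c • u.ζ := rfl
theorem zero_ξ : (0 : Displacement).ξ = 0 := rfl
theorem zero_η : (0 : Displacement).η = 0 := rfl
theorem zero_ζ : (0 : Displacement).ζ = 0 := rfl

/-- The values and derivatives of the three components at a point. -/
noncomputable def jet (r : ℝ) : Fin 6 → ℝ :=
  ![u.ξ r, u.η r, u.ζ r, deriv u.ξ r, deriv u.η r, deriv u.ζ r]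

variable {u v} {b : ℝ}

theorem IsLocAC.ξ (h : u.IsLocAC b) : LocAC b u.ξ := fun a ha => (h a ha).1
theorem IsLocAC.η (h : u.IsLocAC b) : LocAC b u.η := fun a ha => (h a ha).2.1
theorem IsLocAC.ζ (h : u.IsLocAC b) : LocAC b u.ζ := fun a ha => (h a ha).2.2

theorem IsLocAC.add (hu : u.IsLocAC b) (hv : v.IsLocAC b) : (u + v).IsLocAC b :=
  fun a ha => ⟨(hu.ξ.add hv.ξ) a ha, (hu.η.add hv.η) a ha, (hu.ζ.add hv.ζ) a ha⟩

theorem IsLocAC.smul (hu : u.IsLocAC b) : (c • u).IsLocAC b :=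
  fun a ha => ⟨(hu.ξ.smul c) a ha, (hu.η.smul c) a ha, (hu.ζ.smul c) a ha⟩

theorem IsLocAC.sub (hu : u.IsLocAC b) (hv : v.IsLocAC b) : (u - v).IsLocAC b := by
  have : u - v = u + (-1 : ℝ) • v := by module
  exact this ▸ hu.add (hv.smul (-1))

theorem isLocAC_zero : (0 : Displacement).IsLocAC b := by
  have : AbsolutelyContinuousOnInterval (0 : ℝ → ℝ) = fun _ _ => True := by
    funext a b
    exact eq_true (LipschitzWith.const (0 : ℝ)).lipschitzOnWith.absolutelyContinuousOnInterval
  intro a _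
  simp [zero_ξ, zero_η, zero_ζ, this]

theorem IsLocAC.ae_differentiableAt (hu : u.IsLocAC b) :
    ∀ᵐ r ∂volume.restrict (Ioo 0 b), DifferentiableAt ℝ u.ξ r ∧ DifferentiableAt ℝ u.η r ∧
      DifferentiableAt ℝ u.ζ r := by
  filter_upwards [hu.ξ.ae_differentiableAt, hu.η.ae_differentiableAt, hu.ζ.ae_differentiableAt]
    with r h1 h2 h3
  exact ⟨h1, h2, h3⟩

theorem IsLocAC.jet_add (hu : u.IsLocAC b) (hv : v.IsLocAC b) :
    ∀ᵐ r ∂volume.restrict (Ioo 0 b), (u + v).jet r = u.jet r + v.jet r := by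
  filter_upwards [hu.ae_differentiableAt, hv.ae_differentiableAt]
    with r ⟨h1, h2, h3⟩ ⟨h4, h5, h6⟩
  funext i
  fin_cases i
  · rfl
  · rfl
  · rfl
  · exact deriv_add h1 h4
  · exact deriv_add h2 h5
  · exact deriv_add h3 h6

theorem IsLocAC.jet_sub (hu : u.IsLocAC b) (hv : v.IsLocAC b) :
    ∀ᵐ r ∂volume.restrict (Ioo 0 b), (u - v).jet r = u.jet r - v.jet r := by
  filter_upwards [hu.ae_differentiableAt, hv.ae_differentiableAt]
    with r ⟨h1, h2, h3⟩ ⟨h4, h5, h6⟩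
  funext i
  fin_cases i
  · rfl
  · rfl
  · rfl
  · exact deriv_sub h1 h4
  · exact deriv_sub h2 h5
  · exact deriv_sub h3 h6

theorem jet_smul (r : ℝ) : (c • u).jet r = c • u.jet r := by
  funext i
  fin_cases i
  · rfl
  · rfl
  · rfl
  · exact deriv_const_smul_field c u.ξ
  · exact deriv_const_smul_field c u.η
  · exact deriv_const_smul_field c u.ζ

theorem IsLocAC.aestronglyMeasurable_jet (hu : u.IsLocAC b) (i : Fin 6) :
    AEStronglyMeasurable (fun r => u.jet r i) (volume.restrict (Ioo 0 b)) := by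
  fin_cases i
  · exact hu.ξ.aestronglyMeasurable
  · exact hu.η.aestronglyMeasurable
  · exact hu.ζ.aestronglyMeasurable
  · exact (measurable_deriv u.ξ).aestronglyMeasurable
  · exact (measurable_deriv u.η).aestronglyMeasurable
  · exact (measurable_deriv u.ζ).aestronglyMeasurable

end Displacement

/-! ### Quantities controlled by the norm density -/

/-- The density of the norm of `Y_{m,k}` as a function of the jet of the displacement. -/
noncomputable def jetDensity (m k : ℤ) (ρ r : ℝ) (x : Fin 6 → ℝ) : ℝ :=
  ((-2 * x 3 + x 0 / r + m / r * x 2 - k * x 1) ^ 2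
      + (x 3 - 2 * x 0 / r - 2 * m / r * x 2 - k * x 1) ^ 2
      + (x 3 + x 0 / r + m / r * x 2 + 2 * k * x 1) ^ 2
      + (-x 5 + x 2 / r + m / r * x 0) ^ 2
      + (x 4 + k * x 0) ^ 2
      + (m / r * x 1 - k * x 2) ^ 2
      + (x 3 + x 0 / r + m / r * x 2 - k * x 1) ^ 2
      + ρ * (x 0 ^ 2 + x 1 ^ 2 + x 2 ^ 2)) * r

theorem jetDensity_parallelogram (m k : ℤ) (ρ r : ℝ) (x y : Fin 6 → ℝ) :
    jetDensity m k ρ r (x + y) + jetDensity m k ρ r (x - y)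
      = 2 * jetDensity m k ρ r x + 2 * jetDensity m k ρ r y := by
  simp only [jetDensity, Pi.add_apply, Pi.sub_apply]; ring

theorem jetDensity_smul (m k : ℤ) (ρ r c : ℝ) (x : Fin 6 → ℝ) :
    jetDensity m k ρ r (c • x) = c ^ 2 * jetDensity m k ρ r x := by
  simp only [jetDensity, Pi.smul_apply, smul_eq_mul]; ring

section Bounds

variable {m k : ℤ} {ρ r : ℝ} {x : Fin 6 → ℝ}

theorem jetDensity_nonneg (hρ : 0 ≤ ρ) (hr : 0 ≤ r) : 0 ≤ jetDensity m k ρ r x := by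
  unfold jetDensity; positivity

theorem le_jetDensity_of_le_sum {t : ℝ} (hr : 0 ≤ r)
    (h : t ≤ (-2 * x 3 + x 0 / r + m / r * x 2 - k * x 1) ^ 2
      + (x 3 - 2 * x 0 / r - 2 * m / r * x 2 - k * x 1) ^ 2
      + (x 3 + x 0 / r + m / r * x 2 + 2 * k * x 1) ^ 2
      + (-x 5 + x 2 / r + m / r * x 0) ^ 2
      + (x 4 + k * x 0) ^ 2
      + (m / r * x 1 - k * x 2) ^ 2
      + (x 3 + x 0 / r + m / r * x 2 - k * x 1) ^ 2
      + ρ * (x 0 ^ 2 + x 1 ^ 2 + x 2 ^ 2)) : t * r ≤ jetDensity m k ρ r x :=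
  mul_le_mul_of_nonneg_right h hr

/-- The terms `d` and `a₁` differ by exactly `3ξ'`, so their squares control `ξ'` alone. -/
theorem sq_dξ_le_jetDensity (hρ : 0 ≤ ρ) (hr : 0 ≤ r) :
    x 3 ^ 2 * r ≤ jetDensity m k ρ r x := by
  refine le_jetDensity_of_le_sum hr ?_
  have h0 : 0 ≤ ρ * (x 0 ^ 2 + x 1 ^ 2 + x 2 ^ 2) := by positivity
  have h1 : x 3 ^ 2 ≤ (-2 * x 3 + x 0 / r + m / r * x 2 - k * x 1) ^ 2
      + (x 3 + x 0 / r + m / r * x 2 - k * x 1) ^ 2 := by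
    have h2 := sq_nonneg (-2 * x 3 + x 0 / r + m / r * x 2 - k * x 1
      + (x 3 + x 0 / r + m / r * x 2 - k * x 1))
    have h3 := sq_nonneg (x 3)
    linarith only [h2, h3]
  have h2 := sq_nonneg (x 3 - 2 * x 0 / r - 2 * m / r * x 2 - k * x 1)
  have h3 := sq_nonneg (x 3 + x 0 / r + m / r * x 2 + 2 * k * x 1)
  have h4 := sq_nonneg (-x 5 + x 2 / r + m / r * x 0)
  have h5 := sq_nonneg (x 4 + k * x 0)
  have h6 := sq_nonneg (m / r * x 1 - k * x 2)
  linarith only [h0, h1, h2, h3, h4, h5, h6]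

theorem sq_shear_le_jetDensity (hρ : 0 ≤ ρ) (hr : 0 ≤ r) :
    (x 4 + k * x 0) ^ 2 * r ≤ jetDensity m k ρ r x := by
  refine le_jetDensity_of_le_sum hr ?_
  refine le_trans ?_ (le_add_of_nonneg_right (by positivity))
  refine le_trans ?_ (le_add_of_nonneg_right (by positivity))
  refine le_trans ?_ (le_add_of_nonneg_right (by positivity))
  exact le_add_of_nonneg_left (by positivity)

theorem sq_twist_le_jetDensity (hρ : 0 ≤ ρ) (hr : 0 ≤ r) :
    (-x 5 + x 2 / r + m / r * x 0) ^ 2 * r ≤ jetDensity m k ρ r x := by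
  refine le_jetDensity_of_le_sum hr ?_
  refine le_trans ?_ (le_add_of_nonneg_right (by positivity))
  refine le_trans ?_ (le_add_of_nonneg_right (by positivity))
  refine le_trans ?_ (le_add_of_nonneg_right (by positivity))
  refine le_trans ?_ (le_add_of_nonneg_right (by positivity))
  exact le_add_of_nonneg_left (by positivity)

theorem sq_divg_le_jetDensity (hρ : 0 ≤ ρ) (hr : 0 ≤ r) :
    (x 3 + x 0 / r + m / r * x 2 - k * x 1) ^ 2 * r ≤ jetDensity m k ρ r x := by
  refine le_jetDensity_of_le_sum hr ?_
  refine le_trans ?_ (le_add_of_nonneg_right (by positivity))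
  exact le_add_of_nonneg_left (by positivity)

theorem kinetic_le_jetDensity (hr : 0 ≤ r) :
    ρ * (x 0 ^ 2 + x 1 ^ 2 + x 2 ^ 2) * r ≤ jetDensity m k ρ r x :=
  le_jetDensity_of_le_sum hr (le_add_of_nonneg_left (by positivity))

/-- Here `a₃ - d = 3kη`. -/
theorem sq_kη_le_jetDensity (hρ : 0 ≤ ρ) (hr : 0 ≤ r) :
    (k * x 1) ^ 2 * r ≤ jetDensity m k ρ r x := by
  refine le_jetDensity_of_le_sum hr ?_
  have h0 : 0 ≤ ρ * (x 0 ^ 2 + x 1 ^ 2 + x 2 ^ 2) := by positivity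
  have h1 : (k * x 1) ^ 2 ≤ (x 3 + x 0 / r + m / r * x 2 + 2 * k * x 1) ^ 2
      + (x 3 + x 0 / r + m / r * x 2 - k * x 1) ^ 2 := by
    have h2 := sq_nonneg (x 3 + x 0 / r + m / r * x 2 + 2 * k * x 1
      + (x 3 + x 0 / r + m / r * x 2 - k * x 1))
    have h3 := sq_nonneg (k * x 1)
    linarith only [h2, h3]
  have h2 := sq_nonneg (x 3 - 2 * x 0 / r - 2 * m / r * x 2 - k * x 1)
  have h3 := sq_nonneg (-2 * x 3 + x 0 / r + m / r * x 2 - k * x 1)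
  have h4 := sq_nonneg (-x 5 + x 2 / r + m / r * x 0)
  have h5 := sq_nonneg (x 4 + k * x 0)
  have h6 := sq_nonneg (m / r * x 1 - k * x 2)
  linarith only [h0, h1, h2, h3, h4, h5, h6]

/-- Here `d - a₂ = 3(ξ/r + mζ/r)`. For `m = 0` this is control of `ξ/r`, which the magnetic term of
`E₀` needs. -/
theorem sq_hoop_le_jetDensity (hρ : 0 ≤ ρ) (hr : 0 ≤ r) :
    (x 0 / r + m / r * x 2) ^ 2 * r ≤ jetDensity m k ρ r x := by
  refine le_jetDensity_of_le_sum hr ?_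
  have h0 : 0 ≤ ρ * (x 0 ^ 2 + x 1 ^ 2 + x 2 ^ 2) := by positivity
  have h1 : (x 0 / r + m / r * x 2) ^ 2 ≤
      (x 3 - 2 * x 0 / r - 2 * m / r * x 2 - k * x 1) ^ 2
      + (x 3 + x 0 / r + m / r * x 2 - k * x 1) ^ 2 := by
    have h2 := sq_nonneg (x 3 - 2 * x 0 / r - 2 * m / r * x 2 - k * x 1
      + (x 3 + x 0 / r + m / r * x 2 - k * x 1))
    have h3 := sq_nonneg (x 0 / r + m / r * x 2)
    have e : x 3 - 2 * x 0 / r - 2 * m / r * x 2 - k * x 1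
      = x 3 - 2 * (x 0 / r + m / r * x 2) - k * x 1 := by ring
    have e' : x 3 + x 0 / r + m / r * x 2 - k * x 1
      = x 3 + (x 0 / r + m / r * x 2) - k * x 1 := by ring
    rw [e, e'] at h2 ⊢
    linarith only [h2, h3]
  have h2 := sq_nonneg (x 3 + x 0 / r + m / r * x 2 + 2 * k * x 1)
  have h3 := sq_nonneg (-2 * x 3 + x 0 / r + m / r * x 2 - k * x 1)
  have h4 := sq_nonneg (-x 5 + x 2 / r + m / r * x 0)
  have h5 := sq_nonneg (x 4 + k * x 0)
  have h6 := sq_nonneg (m / r * x 1 - k * x 2)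
  linarith only [h0, h1, h2, h3, h4, h5, h6]

end Bounds

/-! ### The equilibrium profiles and the displacements of finite norm -/

namespace ZPinch

variable (P : ZPinch)

theorem continuousOn_p : ContinuousOn P.p (Icc 0 P.r₀) := P.p_contDiff.continuousOn

theorem continuousOn_p' : ContinuousOn P.p' (Icc 0 P.r₀) :=
  P.p_contDiff.continuousOn_derivWithin (uniqueDiffOn_Icc P.r₀_pos) (by norm_num)

theorem continuousOn_ρ : ContinuousOn P.ρ (Icc 0 P.r₀) :=
  (P.continuousOn_p.div_const _).rpow_const fun _ _ =>
    Or.inr (one_div_nonneg.mpr (zero_le_one.trans P.one_lt_γ.le))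

theorem ρ_nonneg {r : ℝ} (hr : r ∈ Icc 0 P.r₀) : 0 ≤ P.ρ r :=
  Real.rpow_nonneg (div_nonneg (P.p_nonneg r hr) P.A_pos.le) _

theorem p_pos {r : ℝ} (hr : r ∈ Ico 0 P.r₀) : 0 < P.p r := by
  have h1 := P.p_eq_zero_iff r (Ico_subset_Icc_self hr)
  refine lt_of_le_of_ne (P.p_nonneg r (Ico_subset_Icc_self hr)) fun h => ?_
  exact hr.2.ne (h1.mp h.symm)

theorem ρ_pos {r : ℝ} (hr : r ∈ Ico 0 P.r₀) : 0 < P.ρ r :=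
  Real.rpow_pos_of_pos (div_pos (P.p_pos hr) P.A_pos) _

theorem exists_abs_le {f : ℝ → ℝ} (hf : ContinuousOn f (Icc 0 P.r₀)) :
    ∃ C, 0 < C ∧ ∀ r ∈ Icc 0 P.r₀, |f r| ≤ C := by
  obtain ⟨C, hC⟩ := isCompact_Icc.exists_bound_of_continuousOn hf
  exact ⟨|C| + 1, by positivity, fun r hr => (hC r hr).trans (by linarith [le_abs_self C])⟩

theorem continuousOn_sq_mul_p' : ContinuousOn (fun s => s ^ 2 * P.p' s) (Icc 0 P.r₀) :=
  (continuousOn_id.pow 2).mul P.continuousOn_p'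

theorem sq_Bθ {r : ℝ} (hr : r ∈ Icc 0 P.r₀) :
    P.Bθ r ^ 2 = -(2 / r ^ 2) * ∫ s in (0 : ℝ)..r, s ^ 2 * P.p' s := by
  refine Real.sq_sqrt ?_
  have h1 := P.integral_nonneg r hr
  have h2 : 0 ≤ 2 / r ^ 2 := by positivity
  have h3 := mul_nonneg h2 h1
  have h4 : (∫ s in (0 : ℝ)..r, s ^ 2 * P.p' s)
    = ∫ s in (0 : ℝ)..r, s ^ 2 * derivWithin P.p (Icc 0 P.r₀) s := rfl
  rw [h4]
  linarith

/-- The integral of `s² p'` is `O(r³)`, so `B_θ²` vanishes at least linearly at the axis. Thus `B_θ²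
/ r` is bounded, which tames the singular coefficients of the energy for `m ≠ 0`. -/
theorem exists_sq_Bθ_le : ∃ C, 0 < C ∧ ∀ r ∈ Ioc 0 P.r₀, P.Bθ r ^ 2 ≤ C * r := by
  obtain ⟨C, hC0, hC⟩ := P.exists_abs_le P.continuousOn_p'
  refine ⟨2 * C, by positivity, fun r hr => ?_⟩
  have h1 : ‖∫ s in (0 : ℝ)..r, s ^ 2 * P.p' s‖ ≤ r ^ 2 * C * |r - 0| := by
    refine intervalIntegral.norm_integral_le_of_norm_le_const fun s hs => ?_
    rw [uIoc_of_le hr.1.le] at hs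
    rw [norm_mul, Real.norm_eq_abs, Real.norm_eq_abs, abs_of_nonneg (sq_nonneg s)]
    exact mul_le_mul (pow_le_pow_left₀ hs.1.le hs.2 2) (hC s ⟨hs.1.le, hs.2.trans hr.2⟩)
      (abs_nonneg _) (sq_nonneg _)
  rw [sub_zero, abs_of_pos hr.1, Real.norm_eq_abs] at h1
  rw [P.sq_Bθ (Ioc_subset_Icc_self hr)]
  have h2 : 0 < 2 / r ^ 2 := by have := hr.1; positivity
  calc -(2 / r ^ 2) * ∫ s in (0 : ℝ)..r, s ^ 2 * P.p' s
      ≤ 2 / r ^ 2 * |∫ s in (0 : ℝ)..r, s ^ 2 * P.p' s| := by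
        rw [neg_mul, ← mul_neg]
        exact mul_le_mul_of_nonneg_left (neg_le_abs _) h2.le
    _ ≤ 2 / r ^ 2 * (r ^ 2 * C * r) := mul_le_mul_of_nonneg_left h1 h2.le
    _ = 2 * C * r := by have := hr.1.ne'; field_simp

theorem continuousOn_Bθ : ContinuousOn P.Bθ (Ioc 0 P.r₀) := by
  have h1 : ContinuousOn (fun r => ∫ s in (0 : ℝ)..r, s ^ 2 * P.p' s) (Icc 0 P.r₀) := by
    have := intervalIntegral.continuousOn_primitive_interval (μ := volume)
      (f := fun s => s ^ 2 * P.p' s) (a := 0) (b := P.r₀)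
      (by rw [uIcc_of_le P.r₀_pos.le]; exact P.continuousOn_sq_mul_p'.integrableOn_Icc)
    rwa [uIcc_of_le P.r₀_pos.le] at this
  refine Real.continuous_sqrt.comp_continuousOn (ContinuousOn.mul ?_ (h1.mono Ioc_subset_Icc_self))
  exact (continuousOn_const.div (continuousOn_id.pow 2) fun x hx =>
    pow_ne_zero 2 (ne_of_gt hx.1)).neg

/-- The density of the square of the norm of `Y_{m,k}`. -/
noncomputable def dens (m k : ℤ) (u : Displacement) (r : ℝ) : ℝ :=
  jetDensity m k (P.ρ r) r (u.jet r)

theorem normSq_eq (m k : ℤ) (u : Displacement) :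
    P.normSq m k u = ∫⁻ r in Ioo 0 P.r₀, ENNReal.ofReal (P.dens m k u r) := rfl

theorem dens_nonneg (m k : ℤ) (u : Displacement) {r : ℝ} (hr : r ∈ Ioo 0 P.r₀) :
    0 ≤ P.dens m k u r :=
  jetDensity_nonneg (P.ρ_nonneg (Ioo_subset_Icc_self hr)) hr.1.le

theorem ae_dens_nonneg (m k : ℤ) (u : Displacement) :
    ∀ᵐ r ∂volume.restrict (Ioo 0 P.r₀), 0 ≤ P.dens m k u r := by
  filter_upwards [ae_restrict_mem measurableSet_Ioo] with r hr
  exact P.dens_nonneg m k u hr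

theorem aestronglyMeasurable_of_continuousOn {f : ℝ → ℝ} (hf : ContinuousOn f (Ioc 0 P.r₀)) :
    AEStronglyMeasurable f (volume.restrict (Ioo 0 P.r₀)) :=
  (hf.mono Ioo_subset_Ioc_self).aestronglyMeasurable measurableSet_Ioo

theorem aestronglyMeasurable_dens {m k : ℤ} {u : Displacement} (hu : u.IsLocAC P.r₀) :
    AEStronglyMeasurable (P.dens m k u) (volume.restrict (Ioo 0 P.r₀)) := by
  have hx := fun i => (hu.aestronglyMeasurable_jet i).aemeasurable
  have hρ := (P.aestronglyMeasurable_of_continuousOn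
    (P.continuousOn_ρ.mono Ioc_subset_Icc_self)).aemeasurable
  have h0 := hx 0
  have h1 := hx 1
  have h2 := hx 2
  have h3 := hx 3
  have h4 := hx 4
  have h5 := hx 5
  have : AEMeasurable (P.dens m k u) (volume.restrict (Ioo 0 P.r₀)) := by
    unfold dens jetDensity
    fun_prop
  exact this.aestronglyMeasurable

theorem dens_add_ae {m k : ℤ} {u v : Displacement} (hu : u.IsLocAC P.r₀) (hv : v.IsLocAC P.r₀) :
    ∀ᵐ r ∂volume.restrict (Ioo 0 P.r₀),
      P.dens m k (u + v) r + P.dens m k (u - v) r = 2 * P.dens m k u r + 2 * P.dens m k v r := by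
  filter_upwards [hu.jet_add hv, hu.jet_sub hv] with r h1 h2
  rw [dens, dens, dens, dens, h1, h2, jetDensity_parallelogram]

theorem dens_smul (m k : ℤ) (c : ℝ) (u : Displacement) (r : ℝ) :
    P.dens m k (c • u) r = c ^ 2 * P.dens m k u r := by
  rw [dens, dens, Displacement.jet_smul, jetDensity_smul]

theorem dens_add_le_ae {m k : ℤ} {u v : Displacement} (hu : u.IsLocAC P.r₀)
    (hv : v.IsLocAC P.r₀) : ∀ᵐ r ∂volume.restrict (Ioo 0 P.r₀),
      P.dens m k (u + v) r ≤ 2 * P.dens m k u r + 2 * P.dens m k v r := by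
  filter_upwards [P.dens_add_ae hu hv, P.ae_dens_nonneg m k (u - v)] with r h1 h2
  linarith

/-- The displacements of finite norm. -/
noncomputable def finiteNorm (m k : ℤ) : Submodule ℝ Displacement where
  carrier := {u | u.IsLocAC P.r₀ ∧ IntegrableOn (P.dens m k u) (Ioo 0 P.r₀)}
  add_mem' := by
    rintro u v ⟨hu, hu'⟩ ⟨hv, hv'⟩
    refine ⟨hu.add hv, ((hu'.const_mul 2).add (hv'.const_mul 2)).mono'
      (P.aestronglyMeasurable_dens (hu.add hv)) ?_⟩
    filter_upwards [P.dens_add_le_ae hu hv, P.ae_dens_nonneg m k (u + v)] with r h1 h2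
    rw [Real.norm_eq_abs, abs_of_nonneg h2]
    exact h1
  zero_mem' := by
    refine ⟨Displacement.isLocAC_zero, ?_⟩
    have : P.dens m k 0 = fun _ => 0 := by
      funext r
      have := P.dens_smul m k 0 0 r
      rwa [zero_smul, zero_pow two_ne_zero, zero_mul] at this
    rw [this]
    exact integrableOn_zero
  smul_mem' := by
    rintro c u ⟨hu, hu'⟩
    refine ⟨hu.smul c, ?_⟩
    have : P.dens m k (c • u) = fun r => c ^ 2 * P.dens m k u r :=
      funext fun r => P.dens_smul m k c u r
    rw [this]
    exact hu'.const_mul _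

/-- The square of the norm, as a real number. -/
noncomputable def nrm (m k : ℤ) (u : Displacement) : ℝ := ∫ r in Ioo 0 P.r₀, P.dens m k u r

variable {P} {m k : ℤ} {u v : Displacement}

theorem nrm_nonneg : 0 ≤ P.nrm m k u := integral_nonneg_of_ae (P.ae_dens_nonneg m k u)

theorem nrm_smul (c : ℝ) : P.nrm m k (c • u) = c ^ 2 * P.nrm m k u := by
  simp only [nrm, dens_smul, integral_const_mul]

theorem normSq_eq_ofReal_nrm (hu : u ∈ P.finiteNorm m k) :
    P.normSq m k u = ENNReal.ofReal (P.nrm m k u) := by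
  rw [normSq_eq, nrm, ofReal_integral_eq_lintegral_ofReal hu.2 (P.ae_dens_nonneg m k u)]

theorem mem_finiteNorm_of_normSq_ne_top (hu : u.IsLocAC P.r₀) (h : P.normSq m k u ≠ ⊤) :
    u ∈ P.finiteNorm m k := by
  refine ⟨hu, P.aestronglyMeasurable_dens hu, ?_⟩
  rw [hasFiniteIntegral_iff_ofReal (P.ae_dens_nonneg m k u)]
  exact lt_top_iff_ne_top.mpr h

theorem normSq_add_le (hu : u.IsLocAC P.r₀) (hv : v.IsLocAC P.r₀) :
    P.normSq m k (u + v) ≤ 2 * P.normSq m k u + 2 * P.normSq m k v := by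
  have h2 : ∀ t : ℝ, ENNReal.ofReal (2 * t) = 2 * ENNReal.ofReal t := fun t => by
    rw [ENNReal.ofReal_mul zero_le_two, ENNReal.ofReal_ofNat]
  have hm := (P.aestronglyMeasurable_dens (m := m) (k := k) hu).aemeasurable.ennreal_ofReal
  rw [normSq_eq, normSq_eq, normSq_eq, ← lintegral_const_mul' _ _ (by norm_num),
    ← lintegral_const_mul' _ _ (by norm_num), ← lintegral_add_left' (hm.const_mul 2)]
  refine lintegral_mono_ae ?_
  filter_upwards [P.dens_add_le_ae hu hv, P.ae_dens_nonneg m k u, P.ae_dens_nonneg m k v]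
    with r h3 h4 h5
  rw [← h2, ← h2, ← ENNReal.ofReal_add (by linarith) (by linarith)]
  exact ENNReal.ofReal_le_ofReal h3

theorem nrm_add_le (hu : u ∈ P.finiteNorm m k) (hv : v ∈ P.finiteNorm m k) :
    P.nrm m k (u + v) ≤ 2 * P.nrm m k u + 2 * P.nrm m k v := by
  rw [nrm, nrm, nrm, ← integral_const_mul, ← integral_const_mul,
    ← integral_add (hu.2.const_mul 2) (hv.2.const_mul 2)]
  exact integral_mono_ae (Submodule.add_mem _ hu hv).2 ((hu.2.const_mul 2).add (hv.2.const_mul 2))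
    (P.dens_add_le_ae hu.1 hv.1)

end ZPinch

/-! ### Pointwise bounds with the weight `r^(-1/4)` -/

/-- The weight `r^(-1/4)`. -/
noncomputable def wt (r : ℝ) : ℝ := r ^ (-(1 / 4) : ℝ)

theorem wt_pos {r : ℝ} (hr : 0 < r) : 0 < wt r := Real.rpow_pos_of_pos hr _

theorem wt_anti {a r : ℝ} (ha : 0 < a) (h : a ≤ r) : wt r ≤ wt a :=
  Real.rpow_le_rpow_of_nonpos ha h (by norm_num)

theorem wt_le_two_mul {r : ℝ} (hr : 0 < r) : wt r ≤ 2 * wt (2 * r) := by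
  have h1 : wt (2 * r) = wt 2 * wt r := Real.mul_rpow zero_le_two hr.le
  have h2 : (1 : ℝ) / 2 ≤ wt 2 := by
    have h3 : (1 : ℝ) / 2 = 2 ^ (-1 : ℝ) := by rw [Real.rpow_neg_one]; norm_num
    rw [h3]
    exact Real.rpow_le_rpow_of_exponent_le one_le_two (by norm_num)
  rw [h1]
  nlinarith [wt_pos hr]

theorem wt_div {r : ℝ} (hr : 0 < r) : wt r / r = r ^ (-(5 / 4) : ℝ) := by
  rw [wt, ← Real.rpow_sub_one hr.ne']; norm_num

theorem sq_wt {r : ℝ} (hr : 0 < r) : wt r ^ 2 = r ^ (-(1 / 2) : ℝ) := by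
  rw [wt, ← Real.rpow_natCast, ← Real.rpow_mul hr.le]; norm_num

theorem continuousOn_wt : ContinuousOn wt (Ioi 0) :=
  continuousOn_id.rpow_const fun _ hx => Or.inl (ne_of_gt hx)

/-- This is what makes the pointwise bounds usable as dominating functions; it forces the exponent
of `wt` to lie above `-1/2`. -/
theorem integrableOn_sq_wt (b : ℝ) : IntegrableOn (fun r => wt r ^ 2) (Ioo 0 b) := by
  rcases le_or_gt b 0 with hb | hb
  · simp [Ioo_eq_empty_of_le hb]
  have h1 := intervalIntegral.intervalIntegrable_rpow' (a := 0) (b := b)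
    (r := (-(1 / 2) : ℝ)) (by norm_num)
  rw [intervalIntegrable_iff_integrableOn_Ioo_of_le hb.le] at h1
  exact h1.congr_fun (fun r hr => (sq_wt hr.1).symm) measurableSet_Ioo

theorem integrableOn_wt_div {a b : ℝ} (ha : 0 < a) :
    IntegrableOn (fun r => wt r / r) (Ioo a b) := by
  have h1 : ContinuousOn (fun r => wt r / r) (Icc a b) :=
    (continuousOn_wt.mono fun x hx => lt_of_lt_of_le ha hx.1).div continuousOn_id
      fun x hx => (lt_of_lt_of_le ha hx.1).ne'
  exact h1.integrableOn_Icc.mono_set Ioo_subset_Icc_self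

/-- Integration of `wt r / r` reproduces the weight. Hence a bound for `ξ` can be fed into the
equations for `η'` and `ζ'` and returns a bound of the same form. -/
theorem integral_wt_div_le {a b : ℝ} (ha : 0 < a) (hab : a ≤ b) :
    ∫ r in Ioo a b, wt r / r ≤ 4 * wt a := by
  have h1 : ∫ r in Ioo a b, wt r / r = ∫ r in a..b, r ^ (-(5 / 4) : ℝ) := by
    rw [intervalIntegral.integral_of_le hab, integral_Ioc_eq_integral_Ioo]
    exact setIntegral_congr_fun measurableSet_Ioo fun r hr => wt_div (ha.trans hr.1)
  rw [h1, integral_rpow (Or.inr ⟨by norm_num, by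
    rw [uIcc_of_le hab]; exact fun h => absurd h.1 (not_le.mpr ha)⟩)]
  have h2 : (-(5 / 4) + 1 : ℝ) = -(1 / 4) := by norm_num
  rw [h2]
  change (wt b - wt a) / _ ≤ _
  have := wt_pos (ha.trans_le hab)
  rw [div_le_iff_of_neg (by norm_num)]
  linarith

/-- A linearized Cauchy–Schwarz inequality. With `θ = 1 / M`, a bound `M²` on the integral of `x² r`
becomes a bound of order `M` on the integral of `|x|`, up to the weight; with `θ` small it yields
equicontinuity. -/
theorem two_mul_abs_le {x θ r : ℝ} (hθ : 0 < θ) (hr : 0 < r) :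
    |x| ≤ θ * (x ^ 2 * r) + 1 / (θ * r) := by
  have h0 : 0 < θ * r := mul_pos hθ hr
  have h1 : |x| * (θ * r) ≤ (θ * (x ^ 2 * r) + 1 / (θ * r)) * (θ * r) := by
    rw [add_mul, one_div_mul_cancel h0.ne', ← sq_abs x]
    nlinarith [sq_nonneg (|x| * (θ * r) - 1), abs_nonneg x, mul_nonneg (abs_nonneg x) h0.le]
  exact le_of_mul_le_mul_right h1 h0

namespace ZPinch

variable (P : ZPinch)

/-- The part of the plasma used to control boundary values. -/
def core : Set ℝ := Ioo (P.r₀ / 2) (3 * P.r₀ / 4)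

theorem core_subset : P.core ⊆ Ioo 0 P.r₀ :=
  Ioo_subset_Ioo (by linarith [P.r₀_pos]) (by linarith [P.r₀_pos])

theorem integrableOn_core : IntegrableOn (fun r => P.ρ r * r) P.core :=
  ((P.continuousOn_ρ.mul continuousOn_id).integrableOn_Icc).mono_set
    (P.core_subset.trans Ioo_subset_Icc_self)

theorem integral_core_pos : 0 < ∫ r in P.core, P.ρ r * r := by
  have h0 := P.r₀_pos
  have hlt : P.r₀ / 2 < 3 * P.r₀ / 4 := by linarith
  have h := intervalIntegral.intervalIntegral_pos_of_pos_on (f := fun r => P.ρ r * r) (a := P.r₀ / 2)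
    (b := 3 * P.r₀ / 4)
    ((intervalIntegrable_iff_integrableOn_Ioo_of_le hlt.le).mpr P.integrableOn_core)
    (fun x hx => mul_pos (P.ρ_pos ⟨by linarith [hx.1], by linarith [hx.2]⟩)
      (by linarith [hx.1])) hlt
  rwa [intervalIntegral.integral_of_le hlt.le, integral_Ioc_eq_integral_Ioo] at h

/-- The derivative bound limits the oscillation of `f` on `[a, r₀]`, and averaging over `core`
against the weight `ρ r`, whose integral there is positive, fixes its size. The assumption `a ≤ r₀ /
2` places `core` inside `[a, r₀]`. The bound reaches `r₀` although `ρ` vanishes there. -/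
theorem exists_abs_le_of_abs_deriv_le (C : ℝ) (hC : 0 ≤ C) : ∃ C' > 0,
    ∀ (D f : ℝ → ℝ) (M a : ℝ), 0 < M → 0 < a → a ≤ P.r₀ / 2 → IntegrableOn D (Ioo 0 P.r₀) →
      (∀ r ∈ Ioo 0 P.r₀, 0 ≤ D r) → ∫ r in Ioo 0 P.r₀, D r ≤ M ^ 2 →
      AbsolutelyContinuousOnInterval f a P.r₀ →
      (∀ᵐ r ∂volume.restrict (Ioo a P.r₀), |deriv f r| ≤ D r / M + C * M * (wt r / r)) →
      (∀ r ∈ P.core, P.ρ r * f r ^ 2 * r ≤ D r) →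
      ∀ r ∈ Icc a P.r₀, |f r| ≤ C' * M * wt a := by
  have hr0 := P.r₀_pos
  set w := ∫ r in P.core, P.ρ r * r with hw
  have hwpos : 0 < w := P.integral_core_pos
  have hκ0 : 0 < wt P.r₀ := wt_pos hr0
  -- The constant is one more than the one obtained for `f²`, so that `C' - 1 ≤ C'²` takes the place
  -- of a square root.
  refine ⟨2 / w / wt P.r₀ ^ 2 + 2 * (1 / wt P.r₀ + 4 * C) ^ 2 + 1, by positivity, ?_⟩
  intro D f M a hM ha ha2 hD hD0 hDM hf hf' hρ x hx
  have haI : Ioo a P.r₀ ⊆ Ioo 0 P.r₀ := Ioo_subset_Ioo ha.le le_rfl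
  have har : a ≤ P.r₀ := by linarith
  have hκ : 0 < wt a := wt_pos ha
  -- Terms without a weight are absorbed into `wt a`, which is at least `wt r₀`.
  have h1κ : 1 ≤ 1 / wt P.r₀ * wt a := by
    rw [one_div_mul_eq_div, le_div_iff₀ hκ0, one_mul]
    exact wt_anti ha har
  set B := M * ((1 / wt P.r₀ + 4 * C) * wt a) with hB
  have hint : IntegrableOn (fun r => D r / M + C * M * (wt r / r)) (Ioo a P.r₀) :=
    ((hD.mono_set haI).div_const M).add ((integrableOn_wt_div ha).const_mul _)
  have hinc : ∀ s ∈ Icc a P.r₀, ∀ t ∈ Icc a P.r₀, s ≤ t → |f t - f s| ≤ B := by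
    intro s hs t ht hst
    refine (hf.abs_sub_le hint hf' hs.1 hst ht.2).trans ?_
    have h1 : ∫ r in Ioo s t, (D r / M + C * M * (wt r / r))
        ≤ ∫ r in Ioo a P.r₀, (D r / M + C * M * (wt r / r)) := by
      refine setIntegral_mono_set hint ?_ (Ioo_subset_Ioo hs.1 ht.2).eventuallyLE
      filter_upwards [ae_restrict_mem measurableSet_Ioo] with r hr
      have h2 := hD0 r (haI hr)
      have h3 := wt_pos (ha.trans hr.1)
      have h4 := ha.trans hr.1
      change 0 ≤ D r / M + C * M * (wt r / r)
      positivity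
    refine h1.trans ?_
    rw [integral_add ((hD.mono_set haI).div_const M) ((integrableOn_wt_div ha).const_mul _),
      integral_div, integral_const_mul]
    have h2 : ∫ r in Ioo a P.r₀, D r ≤ M ^ 2 := by
      refine le_trans (setIntegral_mono_set hD ?_ haI.eventuallyLE) hDM
      filter_upwards [ae_restrict_mem measurableSet_Ioo] with r hr using hD0 r hr
    have h3 : (∫ r in Ioo a P.r₀, D r) / M ≤ M := by
      rw [div_le_iff₀ hM]; nlinarith
    have h4 := mul_le_mul_of_nonneg_left (integral_wt_div_le ha har) (mul_nonneg hC hM.le)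
    have h5 : M ≤ M * (1 / wt P.r₀ * wt a) := le_mul_of_one_le_right hM.le h1κ
    calc _ ≤ M * (1 / wt P.r₀ * wt a) + C * M * (4 * wt a) := by linarith
      _ = B := by rw [hB]; ring
  have hinc' : ∀ s ∈ Icc a P.r₀, |f x - f s| ≤ B := by
    intro s hs
    rcases le_total s x with h | h
    · exact hinc s hs x hx h
    · rw [abs_sub_comm]; exact hinc x hx s hs h
  have hpt : ∀ s ∈ P.core, f x ^ 2 * (P.ρ s * s) ≤ 2 * D s + 2 * B ^ 2 * (P.ρ s * s) := by
    intro s hs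
    have h1 : s ∈ Icc a P.r₀ := ⟨by linarith [hs.1], by linarith [hs.2]⟩
    have h2 := hinc' s h1
    have h3 := hρ s hs
    have h4 : f x ^ 2 ≤ 2 * f s ^ 2 + 2 * B ^ 2 := by
      have h5 : (f x - f s) ^ 2 ≤ B ^ 2 := sq_le_sq' (abs_le.mp h2).1 (abs_le.mp h2).2
      nlinarith [sq_nonneg (f x - 2 * f s)]
    have h5 : 0 ≤ P.ρ s * s := mul_nonneg (P.ρ_nonneg ⟨ha.le.trans h1.1, h1.2⟩) (ha.le.trans h1.1)
    nlinarith
  have hI : f x ^ 2 * w ≤ 2 * M ^ 2 + 2 * B ^ 2 * w := by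
    have h1 := setIntegral_mono_on (P.integrableOn_core.const_mul (f x ^ 2))
      (((hD.mono_set P.core_subset).const_mul 2).add (P.integrableOn_core.const_mul (2 * B ^ 2)))
      measurableSet_Ioo hpt
    have h2 : ∫ r in P.core, D r ≤ M ^ 2 := by
      refine le_trans (setIntegral_mono_set hD ?_ P.core_subset.eventuallyLE) hDM
      filter_upwards [ae_restrict_mem measurableSet_Ioo] with r hr using hD0 r hr
    rw [integral_const_mul, Pi.add_def, integral_add ((hD.mono_set P.core_subset).const_mul 2)
      (P.integrableOn_core.const_mul (2 * B ^ 2)), integral_const_mul, integral_const_mul,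
      ← hw] at h1
    linarith
  set C' := 2 / w / wt P.r₀ ^ 2 + 2 * (1 / wt P.r₀ + 4 * C) ^ 2 + 1 with hC'
  have h1C : 1 ≤ C' := by
    have : 0 ≤ 2 / w / wt P.r₀ ^ 2 + 2 * (1 / wt P.r₀ + 4 * C) ^ 2 := by positivity
    linarith
  have hsq : f x ^ 2 ≤ (C' * M * wt a) ^ 2 := by
    have h1 : f x ^ 2 ≤ 2 / w * M ^ 2 + 2 * B ^ 2 := by
      have : f x ^ 2 ≤ (2 * M ^ 2 + 2 * B ^ 2 * w) / w := by rwa [le_div_iff₀ hwpos]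
      refine this.trans (le_of_eq ?_)
      field_simp
    have h2 : 2 / w * M ^ 2 ≤ 2 / w * M ^ 2 * (1 / wt P.r₀ * wt a) ^ 2 :=
      le_mul_of_one_le_right (by positivity) (one_le_pow₀ h1κ)
    have h3 : 2 / w * M ^ 2 * (1 / wt P.r₀ * wt a) ^ 2 + 2 * B ^ 2
        = (C' - 1) * (M * wt a) ^ 2 := by
      rw [hB, hC']; ring
    have h4 : (C' - 1) * (M * wt a) ^ 2 ≤ C' ^ 2 * (M * wt a) ^ 2 :=
      mul_le_mul_of_nonneg_right (by nlinarith) (sq_nonneg _)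
    calc f x ^ 2 ≤ C' ^ 2 * (M * wt a) ^ 2 := by linarith
      _ = _ := by ring
  exact abs_le_of_sq_le_sq hsq (by positivity)

/-- The components are treated in turn: the density controls `ξ'`; then `η' + kξ`, which gives `η`
once `ξ` is bounded; then `a₄`, which together with `ξ` gives the derivative of `ζ / r`. No boundary
condition at the axis is used. -/
theorem exists_abs_comp_le (m k : ℤ) : ∃ C > 0, ∀ (u : Displacement) (M : ℝ), 0 < M →
    u ∈ P.finiteNorm m k → P.nrm m k u ≤ M ^ 2 → ∀ r ∈ Ioc 0 P.r₀,
      |u.ξ r| ≤ C * M * wt r ∧ |u.η r| ≤ C * M * wt r ∧ |u.ζ r| ≤ C * M * wt r := by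
  have hr0 := P.r₀_pos
  have hκ0 : 0 < wt P.r₀ := wt_pos hr0
  have hinv : ∀ r ∈ Ioo 0 P.r₀, 1 / r ≤ 1 / wt P.r₀ * (wt r / r) := by
    intro r hr
    rw [← mul_div_assoc]
    refine div_le_div_of_nonneg_right ?_ hr.1.le
    rw [one_div_mul_eq_div, le_div_iff₀ hκ0, one_mul]
    exact wt_anti hr.1 hr.2.le
  -- The base point `min r (r₀ / 2)` lies to the left of `core` and is comparable to `r`, so the
  -- weight changes at most by a factor 2.
  have hmin : ∀ r ∈ Ioc 0 P.r₀, 0 < min r (P.r₀ / 2) ∧ min r (P.r₀ / 2) ≤ P.r₀ / 2 ∧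
      min r (P.r₀ / 2) ≤ r ∧ r ≤ 2 * min r (P.r₀ / 2) ∧ wt (min r (P.r₀ / 2)) ≤ 2 * wt r := by
    intro r hr
    have h1 : r ≤ 2 * min r (P.r₀ / 2) := by
      rcases min_choice r (P.r₀ / 2) with h | h <;> rw [h] <;> linarith [hr.1, hr.2]
    have h2 : 0 < min r (P.r₀ / 2) := lt_min hr.1 (by linarith)
    exact ⟨h2, min_le_right _ _, min_le_left _ _, h1,
      (wt_le_two_mul h2).trans (by linarith [wt_anti hr.1 h1])⟩
  have hcore : ∀ (u : Displacement), ∀ r ∈ P.core,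
      P.ρ r * u.ξ r ^ 2 * r ≤ P.dens m k u r ∧ P.ρ r * u.η r ^ 2 * r ≤ P.dens m k u r ∧
      P.ρ r * u.ζ r ^ 2 * r ≤ P.dens m k u r := by
    intro u r hr
    have hr' := P.core_subset hr
    have h1 : P.ρ r * (u.ξ r ^ 2 + u.η r ^ 2 + u.ζ r ^ 2) * r ≤ P.dens m k u r :=
      kinetic_le_jetDensity (x := u.jet r) hr'.1.le
    have h2 : 0 ≤ P.ρ r * r := mul_nonneg (P.ρ_nonneg (Ioo_subset_Icc_self hr')) hr'.1.le
    have h3 := mul_nonneg h2 (sq_nonneg (u.ξ r))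
    have h4 := mul_nonneg h2 (sq_nonneg (u.η r))
    have h5 := mul_nonneg h2 (sq_nonneg (u.ζ r))
    refine ⟨?_, ?_, ?_⟩ <;> linarith
  obtain ⟨C1, hC1, H1⟩ := P.exists_abs_le_of_abs_deriv_le (1 / wt P.r₀) (by positivity)
  have hξ : ∀ (u : Displacement) (M : ℝ), 0 < M → u ∈ P.finiteNorm m k →
      P.nrm m k u ≤ M ^ 2 → ∀ r ∈ Ioc 0 P.r₀, |u.ξ r| ≤ 2 * C1 * M * wt r := by
    intro u M hM hu hN r hr
    obtain ⟨ha, ha2, har, hra, hwt⟩ := hmin r hr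
    have h1 := H1 (P.dens m k u) u.ξ M _ hM ha ha2 hu.2 (fun r hr => P.dens_nonneg m k u hr) hN
      (hu.1.ξ _ ⟨ha, by linarith⟩) ?_ (fun r hr => (hcore u r hr).1) r ⟨har, hr.2⟩
    · have h2 := mul_le_mul_of_nonneg_left hwt (mul_nonneg hC1.le hM.le)
      linarith
    · filter_upwards [ae_restrict_mem measurableSet_Ioo] with s hs
      have hs' : s ∈ Ioo 0 P.r₀ := ⟨ha.trans hs.1, hs.2⟩
      have h2 := two_mul_abs_le (x := deriv u.ξ s) (inv_pos.mpr hM) hs'.1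
      have h3 : deriv u.ξ s ^ 2 * s ≤ P.dens m k u s :=
        sq_dξ_le_jetDensity (x := u.jet s) (P.ρ_nonneg (Ioo_subset_Icc_self hs')) hs'.1.le
      have h4 := mul_le_mul_of_nonneg_left h3 (inv_pos.mpr hM).le
      have h5 := mul_le_mul_of_nonneg_left (hinv s hs') hM.le
      have h6 : 1 / (M⁻¹ * s) = M * (1 / s) := by field_simp
      rw [h6] at h2
      rw [div_eq_inv_mul]
      linarith
  obtain ⟨C2, hC2, H2⟩ := P.exists_abs_le_of_abs_deriv_le
    (1 / wt P.r₀ + |(k : ℝ)| * (2 * C1) * P.r₀) (by positivity)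
  have hη : ∀ (u : Displacement) (M : ℝ), 0 < M → u ∈ P.finiteNorm m k →
      P.nrm m k u ≤ M ^ 2 → ∀ r ∈ Ioc 0 P.r₀, |u.η r| ≤ 2 * C2 * M * wt r := by
    intro u M hM hu hN r hr
    obtain ⟨ha, ha2, har, hra, hwt⟩ := hmin r hr
    have h1 := H2 (P.dens m k u) u.η M _ hM ha ha2 hu.2 (fun r hr => P.dens_nonneg m k u hr) hN
      (hu.1.η _ ⟨ha, by linarith⟩) ?_ (fun r hr => (hcore u r hr).2.1) r ⟨har, hr.2⟩
    · have h2 := mul_le_mul_of_nonneg_left hwt (mul_nonneg hC2.le hM.le)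
      linarith
    · filter_upwards [ae_restrict_mem measurableSet_Ioo] with s hs
      have hs' : s ∈ Ioo 0 P.r₀ := ⟨ha.trans hs.1, hs.2⟩
      have h2 := two_mul_abs_le (x := deriv u.η s + k * u.ξ s) (inv_pos.mpr hM) hs'.1
      have h3 : (deriv u.η s + k * u.ξ s) ^ 2 * s ≤ P.dens m k u s :=
        sq_shear_le_jetDensity (x := u.jet s) (P.ρ_nonneg (Ioo_subset_Icc_self hs')) hs'.1.le
      have h4 := mul_le_mul_of_nonneg_left h3 (inv_pos.mpr hM).le
      have h5 := mul_le_mul_of_nonneg_left (hinv s hs') hM.le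
      have h6 : 1 / (M⁻¹ * s) = M * (1 / s) := by field_simp
      rw [h6] at h2
      rw [div_eq_inv_mul]
      have h7 : |deriv u.η s| ≤ |deriv u.η s + k * u.ξ s| + |(k : ℝ)| * |u.ξ s| := by
        rw [← abs_mul]
        have := abs_sub (deriv u.η s + k * u.ξ s) (k * u.ξ s)
        rwa [add_sub_cancel_right] at this
      have h8 := mul_le_mul_of_nonneg_left (hξ u M hM hu hN s (Ioo_subset_Ioc_self hs'))
        (abs_nonneg (k : ℝ))
      have h9 : wt s ≤ P.r₀ * (wt s / s) := by
        rw [← mul_div_assoc, le_div_iff₀ hs'.1, mul_comm]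
        exact mul_le_mul_of_nonneg_right hs'.2.le (wt_pos hs'.1).le
      have h10 := mul_le_mul_of_nonneg_left h9
        (by positivity : 0 ≤ |(k : ℝ)| * (2 * C1) * M)
      linarith
  obtain ⟨C3, hC3, H3⟩ := P.exists_abs_le_of_abs_deriv_le
    (1 / wt P.r₀ + |(m : ℝ)| * (2 * C1)) (by positivity)
  have hζ : ∀ (u : Displacement) (M : ℝ), 0 < M → u ∈ P.finiteNorm m k →
      P.nrm m k u ≤ M ^ 2 → ∀ r ∈ Ioc 0 P.r₀, |u.ζ r| ≤ 4 * C3 * M * wt r := by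
    intro u M hM hu hN r hr
    obtain ⟨ha, ha2, har, hra, hwt⟩ := hmin r hr
    set a := min r (P.r₀ / 2) with hadef
    have hainv : AbsolutelyContinuousOnInterval (fun s => a / s) a P.r₀ := by
      refine ContDiffOn.absolutelyContinuousOnInterval ?_
      rw [uIcc_of_le (by linarith)]
      exact contDiffOn_const.div contDiffOn_id fun x hx => (ha.trans_le hx.1).ne'
    -- Passing to `ζ / s` removes the singular term `ζ / s` from `a₄`; the factor `a` normalizes,
    -- since `a / s ≤ 1` on `[a, r₀]` and `a / r ≥ 1 / 2` at the target point.
    have h1 := H3 (P.dens m k u) (fun s => a / s * u.ζ s) M a hM ha ha2 hu.2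
      (fun r hr => P.dens_nonneg m k u hr) hN
      (hainv.fun_mul (hu.1.ζ _ ⟨ha, by linarith⟩)) ?_ ?_ r ⟨har, hr.2⟩
    · have h2 := mul_le_mul_of_nonneg_left hwt (mul_nonneg hC3.le hM.le)
      have h3 : |u.ζ r| ≤ 2 * |a / r * u.ζ r| := by
        rw [abs_mul, abs_of_pos (div_pos ha hr.1), ← mul_assoc]
        refine le_mul_of_one_le_left (abs_nonneg _) ?_
        rw [← mul_div_assoc, le_div_iff₀ hr.1]
        linarith
      linarith
    · have hdiff := ae_mono (Measure.restrict_mono (Ioo_subset_Ioo ha.le le_rfl) le_rfl)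
        hu.1.ζ.ae_differentiableAt
      filter_upwards [ae_restrict_mem measurableSet_Ioo, hdiff] with s hs hds
      have hs' : s ∈ Ioo 0 P.r₀ := ⟨ha.trans hs.1, hs.2⟩
      have hder : deriv (fun s => a / s * u.ζ s) s
          = a / s * (m * u.ξ s / s - (-deriv u.ζ s + u.ζ s / s + m / s * u.ξ s)) := by
        have h2 : HasDerivAt (fun s => a / s * u.ζ s)
            ((0 * s - a * 1) / s ^ 2 * u.ζ s + a / s * deriv u.ζ s) s :=
          ((hasDerivAt_const s a).div (hasDerivAt_id s) hs'.1.ne').mul hds.hasDerivAt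
        rw [h2.deriv]
        have := hs'.1.ne'
        field_simp
        ring
      rw [hder, abs_mul, abs_of_pos (div_pos ha hs'.1)]
      set z := -deriv u.ζ s + u.ζ s / s + m / s * u.ξ s with hz
      have h2 := two_mul_abs_le (x := z) (inv_pos.mpr hM) hs'.1
      have h3 : z ^ 2 * s ≤ P.dens m k u s :=
        sq_twist_le_jetDensity (x := u.jet s) (P.ρ_nonneg (Ioo_subset_Icc_self hs')) hs'.1.le
      have h4 := mul_le_mul_of_nonneg_left h3 (inv_pos.mpr hM).le
      have h5 := mul_le_mul_of_nonneg_left (hinv s hs') hM.le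
      have h6 : 1 / (M⁻¹ * s) = M * (1 / s) := by field_simp
      rw [h6] at h2
      rw [div_eq_inv_mul (P.dens m k u s)]
      have h7 : |m * u.ξ s / s - z| ≤ |(m : ℝ)| * |u.ξ s| / s + |z| := by
        have := abs_sub (m * u.ξ s / s) z
        rwa [abs_div, abs_mul, abs_of_pos hs'.1] at this
      have h8 := mul_le_mul_of_nonneg_left (hξ u M hM hu hN s (Ioo_subset_Ioc_self hs'))
        (abs_nonneg (m : ℝ))
      have h9 := div_le_div_of_nonneg_right h8 hs'.1.le
      have h10 : a / s * |m * u.ξ s / s - z| ≤ |m * u.ξ s / s - z| :=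
        mul_le_of_le_one_left (abs_nonneg _) (by rw [div_le_one hs'.1]; exact hs.1.le)
      have h11 : |(m : ℝ)| * (2 * C1 * M * wt s) / s
        = |(m : ℝ)| * (2 * C1) * M * (wt s / s) := by ring
      linarith
    · intro s hs
      refine le_trans ?_ (hcore u s hs).2.2
      have hs' := P.core_subset hs
      have h2 : 0 ≤ P.ρ s * s := mul_nonneg (P.ρ_nonneg (Ioo_subset_Icc_self hs')) hs'.1.le
      have h3 : (a / s * u.ζ s) ^ 2 ≤ u.ζ s ^ 2 := by
        rw [mul_pow]
        refine mul_le_of_le_one_left (sq_nonneg _) (pow_le_one₀ (div_pos ha hs'.1).le ?_)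
        rw [div_le_one hs'.1]
        linarith [hs.1]
      nlinarith
  refine ⟨2 * C1 + 2 * C2 + 4 * C3, by positivity, fun u M hM hu hN r hr => ?_⟩
  have h1 := hξ u M hM hu hN r hr
  have h2 := hη u M hM hu hN r hr
  have h3 := hζ u M hM hu hN r hr
  have h4 : 0 < M * wt r := mul_pos hM (wt_pos hr.1)
  have h5 := mul_pos hC1 h4
  have h6 := mul_pos hC2 h4
  have h7 := mul_pos hC3 h4
  refine ⟨?_, ?_, ?_⟩ <;> linarith

/-- Away from the axis all three derivatives are controlled. The free parameter `θ` serves twice: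
taken small it gives equicontinuity of bounded sequences, taken as `1 / M` it gives `L¹` convergence
of derivatives. -/
theorem exists_abs_deriv_comp_le (m k : ℤ) {a : ℝ} (ha : a ∈ Ioo 0 P.r₀) : ∃ C > 0,
    ∀ (u : Displacement) (M θ : ℝ), 0 < M → 0 < θ → u ∈ P.finiteNorm m k →
      P.nrm m k u ≤ M ^ 2 → ∀ r ∈ Ioo a P.r₀,
      |deriv u.ξ r| ≤ θ * P.dens m k u r + C * (1 / θ + M) ∧
      |deriv u.η r| ≤ θ * P.dens m k u r + C * (1 / θ + M) ∧
      |deriv u.ζ r| ≤ θ * P.dens m k u r + C * (1 / θ + M) := by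
  obtain ⟨C0, hC0, H⟩ := P.exists_abs_comp_le m k
  have ha0 := ha.1
  have hwt := wt_pos ha0
  set B := C0 * wt a with hB
  have hBpos : 0 < B := by positivity
  set C := 1 / a + |(k : ℝ)| * B + (1 + |(m : ℝ)|) * B / a with hC
  refine ⟨C, by positivity, fun u M θ hM hθ hu hN r hr => ?_⟩
  have hr' : r ∈ Ioo 0 P.r₀ := ⟨ha0.trans hr.1, hr.2⟩
  have hrpos := hr'.1
  have hρ := P.ρ_nonneg (Ioo_subset_Icc_self hr')
  obtain ⟨b1, b2, b3⟩ := H u M hM hu hN r (Ioo_subset_Ioc_self hr')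
  have hw : C0 * M * wt r ≤ B * M := by
    have := mul_le_mul_of_nonneg_left (wt_anti ha0 hr.1.le) (mul_pos hC0 hM).le
    rw [hB]; linarith
  have e1 : 1 / (θ * r) ≤ 1 / a * (1 / θ) := by
    rw [one_div_mul_one_div, mul_comm a]
    exact one_div_le_one_div_of_le (by positivity) (mul_le_mul_of_nonneg_left hr.1.le hθ.le)
  have hθ' : 0 < 1 / θ := by positivity
  have hCa : 1 / a * (1 / θ) + |(k : ℝ)| * (B * M) + (1 + |(m : ℝ)|) * (B * M) / a
      ≤ C * (1 / θ + M) := by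
    have q1 : 0 ≤ (|(k : ℝ)| * B + (1 + |(m : ℝ)|) * B / a) * (1 / θ) := by positivity
    have q2 : 0 ≤ 1 / a * M := by positivity
    have q3 : C * (1 / θ + M) = 1 / a * (1 / θ) + |(k : ℝ)| * (B * M)
      + (1 + |(m : ℝ)|) * (B * M) / a + (|(k : ℝ)| * B + (1 + |(m : ℝ)|) * B / a) * (1 / θ)
      + 1 / a * M := by rw [hC]; ring
    linarith
  have n1 : 0 ≤ |(k : ℝ)| * (B * M) := by positivity
  have n2 : 0 ≤ (1 + |(m : ℝ)|) * (B * M) / a := by positivity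
  have key : ∀ z : ℝ, z ^ 2 * r ≤ P.dens m k u r →
      |z| ≤ θ * P.dens m k u r + 1 / a * (1 / θ) := by
    intro z hz
    have h1 := two_mul_abs_le (x := z) hθ hrpos
    have h2 := mul_le_mul_of_nonneg_left hz hθ.le
    linarith
  refine ⟨?_, ?_, ?_⟩
  · have h1 := key (deriv u.ξ r) (sq_dξ_le_jetDensity (x := u.jet r) hρ hrpos.le)
    linarith
  · have h1 := key (deriv u.η r + k * u.ξ r) (sq_shear_le_jetDensity (x := u.jet r) hρ hrpos.le)
    have h7 : |deriv u.η r| ≤ |deriv u.η r + k * u.ξ r| + |(k : ℝ)| * |u.ξ r| := by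
      rw [← abs_mul]
      have := abs_sub (deriv u.η r + k * u.ξ r) (k * u.ξ r)
      rwa [add_sub_cancel_right] at this
    have h8 := mul_le_mul_of_nonneg_left (b1.trans hw) (abs_nonneg (k : ℝ))
    linarith
  · set z := -deriv u.ζ r + u.ζ r / r + m / r * u.ξ r with hz
    have h1 := key z (sq_twist_le_jetDensity (x := u.jet r) hρ hrpos.le)
    have h7 : |deriv u.ζ r| ≤ |z| + (|u.ζ r| + |(m : ℝ)| * |u.ξ r|) / r := by
      have e : deriv u.ζ r = (u.ζ r + m * u.ξ r) / r - z := by rw [hz]; ring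
      have h2 := abs_sub ((u.ζ r + m * u.ξ r) / r) z
      rw [← e, abs_div, abs_of_pos hrpos] at h2
      have h3 := abs_add_le (u.ζ r) (m * u.ξ r)
      rw [abs_mul] at h3
      have h4 := div_le_div_of_nonneg_right h3 hrpos.le
      linarith
    have h8 : |u.ζ r| + |(m : ℝ)| * |u.ξ r| ≤ (1 + |(m : ℝ)|) * (B * M) := by
      have := mul_le_mul_of_nonneg_left (b1.trans hw) (abs_nonneg (m : ℝ))
      linarith
    have h9 : (|u.ζ r| + |(m : ℝ)| * |u.ξ r|) / r ≤ (1 + |(m : ℝ)|) * (B * M) / a :=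
      div_le_div₀ (by positivity) h8 ha0 hr.1.le
    linarith

end ZPinch

/-! ### Compactness, completeness and interpolation for the norm -/

theorem continuous_jetDensity (m k : ℤ) (ρ r : ℝ) : Continuous (jetDensity m k ρ r) := by
  unfold jetDensity; fun_prop

namespace ZPinch

variable (P : ZPinch)

/-- The integrand of `J`. -/
noncomputable def kin (u : Displacement) (r : ℝ) : ℝ :=
  P.ρ r * (u.ξ r ^ 2 + u.η r ^ 2 + u.ζ r ^ 2) * r

theorem J_eq (u : Displacement) :
    P.J u = 2 * Real.pi ^ 2 * ∫ r in Ioo 0 P.r₀, P.kin u r := rfl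

theorem kin_nonneg (u : Displacement) {r : ℝ} (hr : r ∈ Ioo 0 P.r₀) : 0 ≤ P.kin u r := by
  have h1 := P.ρ_nonneg (Ioo_subset_Icc_self hr)
  have h2 := hr.1.le
  unfold kin; positivity

theorem kin_le_dens (m k : ℤ) (u : Displacement) {r : ℝ} (hr : r ∈ Ioo 0 P.r₀) :
    P.kin u r ≤ P.dens m k u r :=
  kinetic_le_jetDensity (x := u.jet r) hr.1.le

theorem aestronglyMeasurable_ρ :
    AEStronglyMeasurable P.ρ (volume.restrict (Ioo 0 P.r₀)) :=
  P.aestronglyMeasurable_of_continuousOn (P.continuousOn_ρ.mono Ioc_subset_Icc_self)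

theorem aestronglyMeasurable_kin {u : Displacement} (hu : u.IsLocAC P.r₀) :
    AEStronglyMeasurable (P.kin u) (volume.restrict (Ioo 0 P.r₀)) := by
  have h0 := hu.ξ.aestronglyMeasurable.aemeasurable
  have h1 := hu.η.aestronglyMeasurable.aemeasurable
  have h2 := hu.ζ.aestronglyMeasurable.aemeasurable
  have h3 := P.aestronglyMeasurable_ρ.aemeasurable
  have : AEMeasurable (P.kin u) (volume.restrict (Ioo 0 P.r₀)) := by unfold kin; fun_prop
  exact this.aestronglyMeasurable

variable {P} {m k : ℤ} {u v : Displacement}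

theorem integrableOn_kin (hu : u ∈ P.finiteNorm m k) : IntegrableOn (P.kin u) (Ioo 0 P.r₀) := by
  refine hu.2.mono' (P.aestronglyMeasurable_kin hu.1) ?_
  filter_upwards [ae_restrict_mem measurableSet_Ioo] with r hr
  rw [Real.norm_eq_abs, abs_of_nonneg (P.kin_nonneg u hr)]
  exact P.kin_le_dens m k u hr

theorem nrm_sub_le (hu : u ∈ P.finiteNorm m k) (hv : v ∈ P.finiteNorm m k) :
    P.nrm m k (u - v) ≤ 2 * P.nrm m k u + 2 * P.nrm m k v := by
  have h1 : u - v = u + (-1 : ℝ) • v := by module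
  have h2 := nrm_add_le hu (Submodule.smul_mem _ (-1) hv)
  rw [nrm_smul] at h2
  rw [h1]
  linarith

variable (P) in
theorem exists_sq_comp_le (m k : ℤ) : ∃ C > 0, ∀ u ∈ P.finiteNorm m k, ∀ r ∈ Ioc 0 P.r₀,
    u.ξ r ^ 2 + u.η r ^ 2 + u.ζ r ^ 2 ≤ C * P.nrm m k u * wt r ^ 2 := by
  obtain ⟨C, hC, H⟩ := P.exists_abs_comp_le m k
  refine ⟨3 * C ^ 2, by positivity, fun u hu r hr => le_of_forall_pos_le_add fun δ hδ => ?_⟩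
  have hw := wt_pos hr.1
  have hN : 0 ≤ P.nrm m k u := nrm_nonneg
  -- The estimate for components needs `M > 0`, while the norm may vanish; `e` is an excess that
  -- contributes exactly `δ`.
  set e := δ / (3 * C ^ 2 * wt r ^ 2) with he
  have hepos : 0 < e := by positivity
  have hM : 0 < Real.sqrt (P.nrm m k u + e) := Real.sqrt_pos.mpr (by positivity)
  have hM2 : Real.sqrt (P.nrm m k u + e) ^ 2 = P.nrm m k u + e := Real.sq_sqrt (by positivity)
  obtain ⟨h1, h2, h3⟩ := H u _ hM hu (by rw [hM2]; linarith) r hr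
  have key : ∀ z : ℝ, |z| ≤ C * Real.sqrt (P.nrm m k u + e) * wt r →
      z ^ 2 ≤ C ^ 2 * (P.nrm m k u + e) * wt r ^ 2 := by
    intro z hz
    rw [← hM2, ← sq_abs z]
    calc |z| ^ 2 ≤ (C * Real.sqrt (P.nrm m k u + e) * wt r) ^ 2 :=
          pow_le_pow_left₀ (abs_nonneg z) hz 2
      _ = _ := by ring
  have h4 := key _ h1
  have h5 := key _ h2
  have h6 := key _ h3
  have h7 : 3 * C ^ 2 * wt r ^ 2 * e = δ := by rw [he]; field_simp
  linarith

theorem abs_sub_le_of_abs_deriv_le {a θ κ M : ℝ} {f : ℝ → ℝ} (ha : a ∈ Ioo 0 P.r₀)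
    (hu : u ∈ P.finiteNorm m k) (hθ : 0 ≤ θ) (hN : P.nrm m k u ≤ M ^ 2)
    (hf : AbsolutelyContinuousOnInterval f a P.r₀)
    (hf' : ∀ r ∈ Ioo a P.r₀, |deriv f r| ≤ θ * P.dens m k u r + κ) {x y : ℝ}
    (hx : x ∈ Icc a P.r₀) (hy : y ∈ Icc a P.r₀) : |f x - f y| ≤ θ * M ^ 2 + κ * |x - y| := by
  wlog hxy : y ≤ x generalizing x y
  · rw [abs_sub_comm, abs_sub_comm x]
    exact this hy hx (le_of_not_ge hxy)
  have haI : Ioo a P.r₀ ⊆ Ioo 0 P.r₀ := Ioo_subset_Ioo ha.1.le le_rfl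
  have hsub : Ioo y x ⊆ Ioo a P.r₀ := Ioo_subset_Ioo hy.1 hx.2
  have hD := hu.2.mono_set haI
  have hc : ∀ s t : ℝ, IntegrableOn (fun _ => κ) (Ioo s t) := fun s t =>
    integrableOn_const measure_Ioo_lt_top.ne
  have h1 := hf.abs_sub_le (h := fun r => θ * P.dens m k u r + κ)
    ((hD.const_mul θ).add (hc _ _))
    (by filter_upwards [ae_restrict_mem measurableSet_Ioo] with r hr using hf' r hr) hy.1 hxy hx.2
  refine h1.trans ?_
  rw [integral_add ((hD.mono_set hsub).const_mul θ) (hc _ _), integral_const_mul,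
    setIntegral_const, abs_of_nonneg (sub_nonneg.mpr hxy), measureReal_def, Real.volume_Ioo,
    ENNReal.toReal_ofReal (sub_nonneg.mpr hxy), smul_eq_mul, mul_comm κ]
  have h2 : ∫ r in Ioo y x, P.dens m k u r ≤ M ^ 2 :=
    (setIntegral_mono_set hu.2 (P.ae_dens_nonneg m k u) (hsub.trans haI).eventuallyLE).trans hN
  have := mul_le_mul_of_nonneg_left h2 hθ
  linarith

/-- Bounded sequences are relatively compact for the quadratic form `J`. -/
theorem exists_subseq_J_cauchy (u : ℕ → Displacement) (hu : ∀ n, u n ∈ P.finiteNorm m k)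
    {B : ℝ} (hB : ∀ n, P.nrm m k (u n) ≤ B) : ∃ φ : ℕ → ℕ, StrictMono φ ∧
      Tendsto (fun q : ℕ × ℕ => P.J (u (φ q.1) - u (φ q.2))) atTop (𝓝 0) := by
  set M := |B| + 1 with hM
  have hMpos : 0 < M := by positivity
  have hNM : ∀ n, P.nrm m k (u n) ≤ M ^ 2 := fun n => (hB n).trans <| by
    nlinarith [le_abs_self B, abs_nonneg B]
  obtain ⟨C, hC, H⟩ := P.exists_abs_comp_le m k
  have heq : ∀ (f : Displacement → ℝ → ℝ),
      (∀ n, LocAC P.r₀ (f (u n))) →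
      (∀ n, ∀ r ∈ Ioc 0 P.r₀, |f (u n) r| ≤ C * M * wt r) →
      (∀ a ∈ Ioo 0 P.r₀, ∃ C > 0, ∀ n, ∀ θ > 0, ∀ r ∈ Ioo a P.r₀,
        |deriv (f (u n)) r| ≤ θ * P.dens m k (u n) r + C * (1 / θ + M)) →
      ∀ ψ : ℕ → ℕ, ∃ φ : ℕ → ℕ, StrictMono φ ∧ ∀ x ∈ Ioc 0 P.r₀,
        ∃ l, Tendsto (fun n => f (u (ψ (φ n))) x) atTop (𝓝 l) := by
    intro f hf hfb hfd ψ
    refine exists_subseq_tendsto_of_equicontinuous (fun n => f (u (ψ n))) _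
      (fun x hx => ⟨_, fun n => hfb (ψ n) x hx⟩) fun x hx ε hε => ?_
    have ha : x / 2 ∈ Ioo 0 P.r₀ := ⟨by linarith [hx.1], by linarith [hx.1, hx.2]⟩
    obtain ⟨A, hA, hAd⟩ := hfd _ ha
    -- The energy part of an increment, `θ * M ^ 2`, is then half of `ε`; the rest is proportional
    -- to the distance.
    set θ := ε / (2 * M ^ 2) with hθ
    have hθpos : 0 < θ := by positivity
    set κ := A * (1 / θ + M) with hκ
    have hκpos : 0 < κ := by positivity
    refine ⟨min (x / 2) (ε / (2 * κ)), lt_min ha.1 (by positivity), fun y hy hyx n => ?_⟩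
    have h1 := (lt_min_iff.mp hyx).1
    have h2 := (lt_min_iff.mp hyx).2
    have hy' : y ∈ Icc (x / 2) P.r₀ := ⟨by linarith [(abs_lt.mp h1).1], hy.2⟩
    have h3 := abs_sub_le_of_abs_deriv_le ha (hu (ψ n)) hθpos.le (hNM (ψ n)) (hf (ψ n) _ ha)
      (hAd (ψ n) θ hθpos) ⟨by linarith [hx.1], hx.2⟩ hy'
    refine h3.trans ?_
    rw [abs_sub_comm x y]
    have h4 : θ * M ^ 2 = ε / 2 := by rw [hθ]; field_simp
    have h5 : κ * |y - x| ≤ ε / 2 := by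
      have := mul_le_mul_of_nonneg_left h2.le hκpos.le
      refine this.trans (le_of_eq ?_)
      field_simp
    linarith
  have hder := fun a (ha : a ∈ Ioo 0 P.r₀) => P.exists_abs_deriv_comp_le m k ha
  obtain ⟨φ1, hφ1, h1⟩ := heq Displacement.ξ (fun n => (hu n).1.ξ)
    (fun n r hr => (H (u n) M hMpos (hu n) (hNM n) r hr).1) (fun a ha => by
      obtain ⟨A, hA, h⟩ := hder a ha
      exact ⟨A, hA, fun n θ hθ r hr => (h (u n) M θ hMpos hθ (hu n) (hNM n) r hr).1⟩) id
  obtain ⟨φ2, hφ2, h2⟩ := heq Displacement.η (fun n => (hu n).1.η)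
    (fun n r hr => (H (u n) M hMpos (hu n) (hNM n) r hr).2.1) (fun a ha => by
      obtain ⟨A, hA, h⟩ := hder a ha
      exact ⟨A, hA, fun n θ hθ r hr => (h (u n) M θ hMpos hθ (hu n) (hNM n) r hr).2.1⟩) φ1
  obtain ⟨φ3, hφ3, h3⟩ := heq Displacement.ζ (fun n => (hu n).1.ζ)
    (fun n r hr => (H (u n) M hMpos (hu n) (hNM n) r hr).2.2) (fun a ha => by
      obtain ⟨A, hA, h⟩ := hder a ha
      exact ⟨A, hA, fun n θ hθ r hr => (h (u n) M θ hMpos hθ (hu n) (hNM n) r hr).2.2⟩)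
    (φ1 ∘ φ2)
  refine ⟨φ1 ∘ φ2 ∘ φ3, hφ1.comp (hφ2.comp hφ3), ?_⟩
  set w := fun n => u ((φ1 ∘ φ2 ∘ φ3) n) with hw
  have hwm : ∀ n, w n ∈ P.finiteNorm m k := fun n => hu _
  have hsub0 : ∀ (f : Displacement → ℝ → ℝ) (x : ℝ),
      (∃ l, Tendsto (fun n => f (w n) x) atTop (𝓝 l)) →
      Tendsto (fun q : ℕ × ℕ => f (w q.1) x - f (w q.2) x) atTop (𝓝 0) := by
    rintro f x ⟨l, hl⟩
    have := (hl.comp (tendsto_fst (f := (atTop : Filter ℕ)) (g := (atTop : Filter ℕ)))).sub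
      (hl.comp (tendsto_snd (f := (atTop : Filter ℕ)) (g := (atTop : Filter ℕ))))
    rw [prod_atTop_atTop_eq, sub_self] at this
    exact this
  have hξ := fun x (hx : x ∈ Ioc 0 P.r₀) => hsub0 Displacement.ξ x <| by
    obtain ⟨l, hl⟩ := h1 x hx
    exact ⟨l, hl.comp (hφ2.comp hφ3).tendsto_atTop⟩
  have hη := fun x (hx : x ∈ Ioc 0 P.r₀) => hsub0 Displacement.η x <| by
    obtain ⟨l, hl⟩ := h2 x hx
    exact ⟨l, hl.comp hφ3.tendsto_atTop⟩
  have hζ := fun x (hx : x ∈ Ioc 0 P.r₀) => hsub0 Displacement.ζ x (h3 x hx)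
  obtain ⟨C2, hC2, H2⟩ := P.exists_sq_comp_le m k
  obtain ⟨R, hR, hRb⟩ := P.exists_abs_le (P.continuousOn_ρ.mul continuousOn_id)
  -- Pointwise convergence on the open interval suffices: `wt r ^ 2` dominates up to the axis, so no
  -- uniformity is needed there.
  have hlim : Tendsto (fun q : ℕ × ℕ => ∫ r in Ioo 0 P.r₀, P.kin (w q.1 - w q.2) r) atTop
      (𝓝 (∫ r in Ioo 0 P.r₀, (0 : ℝ))) := by
    refine tendsto_integral_filter_of_dominated_convergence
      (fun r => R * (C2 * (4 * M ^ 2)) * wt r ^ 2) ?_ ?_ ?_ ?_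
    · exact Eventually.of_forall fun q =>
        P.aestronglyMeasurable_kin ((hwm q.1).1.sub (hwm q.2).1)
    · refine Eventually.of_forall fun q => ?_
      filter_upwards [ae_restrict_mem measurableSet_Ioo] with r hr
      rw [Real.norm_eq_abs, abs_of_nonneg (P.kin_nonneg _ hr)]
      have e1 := H2 _ (Submodule.sub_mem _ (hwm q.1) (hwm q.2)) r (Ioo_subset_Ioc_self hr)
      have e2 := nrm_sub_le (hwm q.1) (hwm q.2)
      have e3 := hNM ((φ1 ∘ φ2 ∘ φ3) q.1)
      have e4 := hNM ((φ1 ∘ φ2 ∘ φ3) q.2)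
      have e5 : P.nrm m k (w q.1 - w q.2) ≤ 4 * M ^ 2 := by
        change _ ≤ 2 * P.nrm m k (u _) + 2 * P.nrm m k (u _) at e2
        linarith
      have e6 : C2 * P.nrm m k (w q.1 - w q.2) * wt r ^ 2 ≤ C2 * (4 * M ^ 2) * wt r ^ 2 :=
        mul_le_mul_of_nonneg_right (mul_le_mul_of_nonneg_left e5 hC2.le) (sq_nonneg _)
      have e7 : P.ρ r * r ≤ R := (le_abs_self _).trans (hRb r (Ioo_subset_Icc_self hr))
      have e8 : 0 ≤ C2 * (4 * M ^ 2) * wt r ^ 2 := by positivity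
      have e9 : 0 ≤ P.ρ r * r := mul_nonneg (P.ρ_nonneg (Ioo_subset_Icc_self hr)) hr.1.le
      calc P.kin (w q.1 - w q.2) r
          = P.ρ r * r * ((w q.1 - w q.2).ξ r ^ 2 + (w q.1 - w q.2).η r ^ 2
            + (w q.1 - w q.2).ζ r ^ 2) := by rw [kin]; ring
        _ ≤ P.ρ r * r * (C2 * (4 * M ^ 2) * wt r ^ 2) :=
          mul_le_mul_of_nonneg_left (e1.trans e6) e9
        _ ≤ R * (C2 * (4 * M ^ 2) * wt r ^ 2) := mul_le_mul_of_nonneg_right e7 e8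
        _ = _ := by ring
    · exact (integrableOn_sq_wt P.r₀).const_mul _
    · filter_upwards [ae_restrict_mem measurableSet_Ioo] with r hr
      have hr' := Ioo_subset_Ioc_self hr
      have := (((((hξ r hr').pow 2).add ((hη r hr').pow 2)).add ((hζ r hr').pow 2)).const_mul
        (P.ρ r)).mul_const r
      simpa [kin, Displacement.sub_ξ, Displacement.sub_η, Displacement.sub_ζ] using this
  have hlim' := hlim.const_mul (2 * Real.pi ^ 2)
  rw [integral_zero, mul_zero] at hlim'
  exact hlim'

/-- The displacements of finite norm form a complete space. -/
theorem exists_nrm_limit (u : ℕ → Displacement) (hu : ∀ n, u n ∈ P.finiteNorm m k)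
    (hc : Tendsto (fun q : ℕ × ℕ => P.nrm m k (u q.1 - u q.2)) atTop (𝓝 0)) :
    ∃ v ∈ P.finiteNorm m k, ∃ φ : ℕ → ℕ, StrictMono φ ∧
      Tendsto (fun n => P.nrm m k (v - u (φ n))) atTop (𝓝 0) ∧
      ∀ r ∈ Ioc 0 P.r₀, Tendsto (fun n => (u (φ n)).ξ r) atTop (𝓝 (v.ξ r)) := by
  -- The squared norms decay like `4⁻ⁿ`, so `M = 2⁻ⁿ` is admissible in the pointwise estimates and
  -- is summable.
  obtain ⟨φ, hφ, hφN⟩ := extraction_forall_of_eventually'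
    (P := fun n K => ∀ i j, K ≤ i → K ≤ j → P.nrm m k (u i - u j) ≤ (1 / 4) ^ n) fun n => by
      have h1 := hc.eventually (ge_mem_nhds (show (0 : ℝ) < (1 / 4) ^ n by positivity))
      obtain ⟨⟨a, b⟩, hab⟩ := eventually_atTop.mp h1
      refine ⟨max a b, fun K hK i j hi hj => ?_⟩
      exact hab (i, j) ⟨(le_max_left a b).trans (hK.trans hi), (le_max_right a b).trans (hK.trans hj)⟩
  set w := fun n => u (φ n) with hw
  have hwm : ∀ n, w n ∈ P.finiteNorm m k := fun n => hu _
  have hwd : ∀ i j, w i - w j ∈ P.finiteNorm m k := fun i j => Submodule.sub_mem _ (hwm i) (hwm j)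
  have hwN : ∀ N i j, N ≤ i → N ≤ j → P.nrm m k (w i - w j) ≤ ((1 / 2) ^ N) ^ 2 := by
    intro N i j hi hj
    refine (hφN N (φ i) (φ j) (hφ.monotone hi) (hφ.monotone hj)).trans (le_of_eq ?_)
    rw [← pow_mul, mul_comm N 2, pow_mul]; norm_num
  have hpos : ∀ N : ℕ, (0 : ℝ) < (1 / 2) ^ N := fun N => by positivity
  obtain ⟨C, hC, H⟩ := P.exists_abs_comp_le m k
  have hpt : ∀ (f : Displacement → ℝ → ℝ), (∀ i j r, f (w i - w j) r = f (w i) r - f (w j) r) →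
      (∀ (d : Displacement) (M : ℝ), 0 < M → d ∈ P.finiteNorm m k → P.nrm m k d ≤ M ^ 2 →
        ∀ r ∈ Ioc 0 P.r₀, |f d r| ≤ C * M * wt r) →
      ∀ r, ∃ l, r ∈ Ioc 0 P.r₀ → Tendsto (fun n => f (w n) r) atTop (𝓝 l) := by
    intro f hf hfb r
    by_cases hr : r ∈ Ioc 0 P.r₀
    swap
    · exact ⟨0, fun h => absurd h hr⟩
    have : CauchySeq fun n => f (w n) r := by
      refine cauchySeq_of_le_tendsto_0 (fun N => C * (1 / 2) ^ N * wt r) (fun i j N hi hj => ?_) ?_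
      · rw [Real.dist_eq, ← hf]
        exact hfb _ _ (hpos N) (hwd i j) (hwN N i j hi hj) r hr
      · have := ((tendsto_pow_atTop_nhds_zero_of_lt_one (r := (1 / 2 : ℝ)) (by norm_num)
          (by norm_num)).const_mul C).mul_const (wt r)
        simpa using this
    obtain ⟨l, hl⟩ := cauchySeq_tendsto_of_complete this
    exact ⟨l, fun _ => hl⟩
  choose ξ hξ using hpt Displacement.ξ (fun _ _ _ => rfl)
    (fun d M h1 h2 h3 r hr => (H d M h1 h2 h3 r hr).1)
  choose η hη using hpt Displacement.η (fun _ _ _ => rfl)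
    (fun d M h1 h2 h3 r hr => (H d M h1 h2 h3 r hr).2.1)
  choose ζ hζ using hpt Displacement.ζ (fun _ _ _ => rfl)
    (fun d M h1 h2 h3 r hr => (H d M h1 h2 h3 r hr).2.2)
  have hAC : ∀ (f : Displacement → ℝ → ℝ) (g : ℝ → ℝ),
      (∀ d : Displacement, d.IsLocAC P.r₀ → LocAC P.r₀ (f d)) →
      (∀ i j, f (w i - w j) = f (w i) - f (w j)) →
      (∀ r ∈ Ioc 0 P.r₀, Tendsto (fun n => f (w n) r) atTop (𝓝 (g r))) →
      (∀ a ∈ Ioo 0 P.r₀, ∃ C > 0, ∀ (d : Displacement) (M θ : ℝ), 0 < M → 0 < θ →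
        d ∈ P.finiteNorm m k → P.nrm m k d ≤ M ^ 2 → ∀ r ∈ Ioo a P.r₀,
        |deriv (f d) r| ≤ θ * P.dens m k d r + C * (1 / θ + M)) →
      ∀ a ∈ Ioo 0 P.r₀, AbsolutelyContinuousOnInterval g a P.r₀ ∧
        ∀ᵐ x ∂volume.restrict (Ioo a P.r₀),
          Tendsto (fun n => deriv (f (w n)) x) atTop (𝓝 (deriv g x)) := by
    intro f g hf hfs hfl hfd a ha
    obtain ⟨A, hA, hAd⟩ := hfd a ha
    have haI : Ioo a P.r₀ ⊆ Ioo 0 P.r₀ := Ioo_subset_Ioo ha.1.le le_rfl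
    -- With `θ = 1 / M`, the energy part contributes at most `M`, and the constant `A * (1 / θ + M)
    -- = 2 * A * M` is integrated over a length below `r₀`.
    refine AbsolutelyContinuousOnInterval.of_tendsto (K := 1 + 2 * A * P.r₀) ha.2
      (fun n => hf _ (hwm n).1 a ha) (fun x hx => hfl x ⟨ha.1.trans_le hx.1, hx.2⟩)
      fun N i j hi hj => ?_
    set M : ℝ := (1 / 2) ^ N with hM
    have hMpos : 0 < M := hpos N
    have hD := (hwd i j).2.mono_set haI
    have hcst : IntegrableOn (fun _ => A * (1 / (1 / M) + M)) (Ioo a P.r₀) :=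
      integrableOn_const measure_Ioo_lt_top.ne
    have hle : ∀ᵐ r ∂volume.restrict (Ioo a P.r₀), |deriv (f (w i)) r - deriv (f (w j)) r|
        ≤ 1 / M * P.dens m k (w i - w j) r + A * (1 / (1 / M) + M) := by
      have d1 := ae_mono (Measure.restrict_mono haI le_rfl) (hf _ (hwm i).1).ae_differentiableAt
      have d2 := ae_mono (Measure.restrict_mono haI le_rfl) (hf _ (hwm j).1).ae_differentiableAt
      filter_upwards [d1, d2, ae_restrict_mem measurableSet_Ioo] with r e1 e2 hr
      have e3 := hAd (w i - w j) M (1 / M) hMpos (by positivity) (hwd i j) (hwN N i j hi hj) r hr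
      rwa [hfs, deriv_sub e1 e2] at e3
    have h1 : ∫ r in Ioo a P.r₀, |deriv (f (w i)) r - deriv (f (w j)) r|
        ≤ ∫ r in Ioo a P.r₀, (1 / M * P.dens m k (w i - w j) r + A * (1 / (1 / M) + M)) :=
      integral_mono_of_nonneg (Eventually.of_forall fun _ => abs_nonneg _)
        ((hD.const_mul _).add hcst) hle
    refine h1.trans ?_
    rw [integral_add (hD.const_mul _) hcst, integral_const_mul, setIntegral_const, smul_eq_mul,
      measureReal_def, Real.volume_Ioo, ENNReal.toReal_ofReal (sub_nonneg.mpr ha.2.le)]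
    have h2 : ∫ r in Ioo a P.r₀, P.dens m k (w i - w j) r ≤ M ^ 2 :=
      (setIntegral_mono_set (hwd i j).2 (P.ae_dens_nonneg m k _) haI.eventuallyLE).trans
        (hwN N i j hi hj)
    have h3 : 1 / M * ∫ r in Ioo a P.r₀, P.dens m k (w i - w j) r ≤ M := by
      rw [one_div_mul_eq_div, div_le_iff₀ hMpos]; nlinarith
    have h4 : A * (1 / (1 / M) + M) = 2 * A * M := by rw [one_div_one_div]; ring
    rw [h4]
    have h5 : (P.r₀ - a) * (2 * A * M) ≤ P.r₀ * (2 * A * M) :=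
      mul_le_mul_of_nonneg_right (by linarith [ha.1]) (by positivity)
    linarith
  have hder := fun a (ha : a ∈ Ioo 0 P.r₀) => P.exists_abs_deriv_comp_le m k ha
  have hξAC := hAC Displacement.ξ ξ (fun d h => h.ξ) (fun _ _ => rfl) hξ (fun a ha => by
    obtain ⟨A, hA, h⟩ := hder a ha
    exact ⟨A, hA, fun d M θ h1 h2 h3 h4 r hr => (h d M θ h1 h2 h3 h4 r hr).1⟩)
  have hηAC := hAC Displacement.η η (fun d h => h.η) (fun _ _ => rfl) hη (fun a ha => by
    obtain ⟨A, hA, h⟩ := hder a ha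
    exact ⟨A, hA, fun d M θ h1 h2 h3 h4 r hr => (h d M θ h1 h2 h3 h4 r hr).2.1⟩)
  have hζAC := hAC Displacement.ζ ζ (fun d h => h.ζ) (fun _ _ => rfl) hζ (fun a ha => by
    obtain ⟨A, hA, h⟩ := hder a ha
    exact ⟨A, hA, fun d M θ h1 h2 h3 h4 r hr => (h d M θ h1 h2 h3 h4 r hr).2.2⟩)
  set v : Displacement := ⟨ξ, η, ζ⟩ with hv
  have hvAC : v.IsLocAC P.r₀ := fun a ha => ⟨(hξAC a ha).1, (hηAC a ha).1, (hζAC a ha).1⟩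
  have hjet : ∀ᵐ r ∂volume.restrict (Ioo 0 P.r₀),
      Tendsto (fun n => (w n).jet r) atTop (𝓝 (v.jet r)) := by
    filter_upwards [ae_restrict_Ioo_zero fun a ha => (hξAC a ha).2,
      ae_restrict_Ioo_zero fun a ha => (hηAC a ha).2,
      ae_restrict_Ioo_zero fun a ha => (hζAC a ha).2, ae_restrict_mem measurableSet_Ioo]
      with r h1 h2 h3 hr
    have hr' := Ioo_subset_Ioc_self hr
    rw [tendsto_pi_nhds]
    intro i
    fin_cases i
    · exact hξ r hr'
    · exact hη r hr'
    · exact hζ r hr'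
    · exact h1
    · exact h2
    · exact h3
  -- Fatou's lemma along the almost everywhere convergent jets; this also shows that `v` has finite
  -- norm.
  have hnorm : ∀ n, P.normSq m k (v - w n) ≤ ENNReal.ofReal (((1 / 2) ^ n) ^ 2) := by
    intro n
    have h1 : ∀ᵐ r ∂volume.restrict (Ioo 0 P.r₀), ∀ i,
        (w i - w n).jet r = (w i).jet r - (w n).jet r :=
      ae_all_iff.mpr fun i => (hwm i).1.jet_sub (hwm n).1
    have h2 : P.normSq m k (v - w n) ≤ ∫⁻ r in Ioo 0 P.r₀,
        liminf (fun i => ENNReal.ofReal (P.dens m k (w i - w n) r)) atTop := by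
      rw [normSq_eq]
      refine lintegral_mono_ae ?_
      filter_upwards [hjet, h1, hvAC.jet_sub (hwm n).1] with r e1 e2 e3
      refine le_of_eq (Tendsto.liminf_eq ?_).symm
      refine ENNReal.tendsto_ofReal ?_
      simp only [dens, e2, e3]
      exact ((continuous_jetDensity m k (P.ρ r) r).tendsto _).comp (e1.sub_const _)
    refine h2.trans ((lintegral_liminf_le' fun i =>
      (P.aestronglyMeasurable_dens (hwd i n).1).aemeasurable.ennreal_ofReal).trans ?_)
    refine liminf_le_of_frequently_le' (Eventually.frequently ?_)
    filter_upwards [eventually_ge_atTop n] with i hi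
    rw [← normSq_eq, normSq_eq_ofReal_nrm (hwd i n)]
    exact ENNReal.ofReal_le_ofReal (hwN n i n hi le_rfl)
  have hvw : ∀ n, v - w n ∈ P.finiteNorm m k := fun n =>
    mem_finiteNorm_of_normSq_ne_top (hvAC.sub (hwm n).1)
      (ne_top_of_le_ne_top ENNReal.ofReal_ne_top (hnorm n))
  have hvm : v ∈ P.finiteNorm m k := by
    have := Submodule.add_mem _ (hvw 0) (hwm 0)
    rwa [sub_add_cancel] at this
  refine ⟨v, hvm, φ, hφ, ?_, hξ⟩
  have hlim : Tendsto (fun n : ℕ => (((1 / 2 : ℝ)) ^ n) ^ 2) atTop (𝓝 0) := by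
    have := (tendsto_pow_atTop_nhds_zero_of_lt_one (r := (1 / 2 : ℝ)) (by norm_num)
      (by norm_num)).pow 2
    simpa using this
  refine squeeze_zero (fun _ => nrm_nonneg) (fun n => ?_) hlim
  have := hnorm n
  rw [normSq_eq_ofReal_nrm (hvw n)] at this
  exact (ENNReal.ofReal_le_ofReal_iff (by positivity)).mp this

theorem integrableOn_sq_comp (hu : u ∈ P.finiteNorm m k) :
    IntegrableOn (fun r => u.ξ r ^ 2 + u.η r ^ 2 + u.ζ r ^ 2) (Ioo 0 P.r₀) := by
  obtain ⟨C, hC, H⟩ := P.exists_sq_comp_le m k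
  refine ((integrableOn_sq_wt P.r₀).const_mul (C * P.nrm m k u)).mono' ?_ ?_
  · exact ((hu.1.ξ.aestronglyMeasurable.pow 2).add (hu.1.η.aestronglyMeasurable.pow 2)).add
      (hu.1.ζ.aestronglyMeasurable.pow 2)
  · filter_upwards [ae_restrict_mem measurableSet_Ioo] with r hr
    rw [Real.norm_eq_abs, abs_of_nonneg (by positivity)]
    exact H u hu r (Ioo_subset_Ioc_self hr)

variable (P) in
theorem exists_integral_sq_comp_le (m k : ℤ) : ∃ C > 0, ∀ u ∈ P.finiteNorm m k,
    ∫ r in Ioo 0 P.r₀, (u.ξ r ^ 2 + u.η r ^ 2 + u.ζ r ^ 2) ≤ C * P.nrm m k u := by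
  obtain ⟨C, hC, H⟩ := P.exists_sq_comp_le m k
  have hI : 0 ≤ ∫ r in Ioo 0 P.r₀, wt r ^ 2 :=
    MeasureTheory.integral_nonneg fun _ => sq_nonneg _
  refine ⟨C * (∫ r in Ioo 0 P.r₀, wt r ^ 2) + 1, by positivity, fun u hu => ?_⟩
  have h1 := setIntegral_mono_on (integrableOn_sq_comp hu)
    ((integrableOn_sq_wt P.r₀).const_mul (C * P.nrm m k u)) measurableSet_Ioo
    fun r hr => H u hu r (Ioo_subset_Ioc_self hr)
  rw [integral_const_mul] at h1
  have : 0 ≤ P.nrm m k u := nrm_nonneg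
  linarith

variable (P) in
/-- An interpolation inequality: the unweighted `L²` norm of a displacement is small compared to
its full norm, up to a multiple of `J`. -/
theorem exists_integral_sq_le_add (m k : ℤ) {ε : ℝ} (hε : 0 < ε) : ∃ C > 0,
    ∀ u ∈ P.finiteNorm m k, ∫ r in Ioo 0 P.r₀, (u.ξ r ^ 2 + u.η r ^ 2 + u.ζ r ^ 2)
      ≤ ε * P.nrm m k u + C * ∫ r in Ioo 0 P.r₀, P.kin u r := by
  obtain ⟨C, hC, H⟩ := P.exists_sq_comp_le m k
  -- The weight `t = ρ r` degenerates at both ends. A sum of squares `S` is split as `S / (1 + n t)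
  -- + n t S / (1 + n t)`: the second part is at most `n` times the kinetic density, and the first
  -- is dominated by a multiple of `F n`, whose integral tends to zero because `ρ r > 0` inside.
  set F : ℕ → ℝ → ℝ := fun n r => wt r ^ 2 / (1 + n * (P.ρ r * r)) with hF
  have hwt : AEMeasurable (fun r => wt r ^ 2) (volume.restrict (Ioo 0 P.r₀)) :=
    (integrableOn_sq_wt P.r₀).aestronglyMeasurable.aemeasurable
  have hρ := P.aestronglyMeasurable_ρ.aemeasurable
  have hFm : ∀ n, AEStronglyMeasurable (F n) (volume.restrict (Ioo 0 P.r₀)) := by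
    intro n
    have : AEMeasurable (F n) (volume.restrict (Ioo 0 P.r₀)) := by
      refine hwt.div ?_
      fun_prop
    exact this.aestronglyMeasurable
  have hFb : ∀ n, ∀ r ∈ Ioo 0 P.r₀, 0 ≤ F n r ∧ F n r ≤ wt r ^ 2 := by
    intro n r hr
    have h1 : 0 ≤ P.ρ r * r := mul_nonneg (P.ρ_nonneg (Ioo_subset_Icc_self hr)) hr.1.le
    refine ⟨by positivity, div_le_self (sq_nonneg _) ?_⟩
    have : 0 ≤ n * (P.ρ r * r) := by positivity
    linarith
  have hFi : ∀ n, IntegrableOn (F n) (Ioo 0 P.r₀) := by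
    intro n
    refine (integrableOn_sq_wt P.r₀).mono' (hFm n) ?_
    filter_upwards [ae_restrict_mem measurableSet_Ioo] with r hr
    rw [Real.norm_eq_abs, abs_of_nonneg (hFb n r hr).1]
    exact (hFb n r hr).2
  have hFt : Tendsto (fun n => ∫ r in Ioo 0 P.r₀, F n r) atTop
      (𝓝 (∫ r in Ioo 0 P.r₀, (0 : ℝ))) := by
    refine tendsto_integral_of_dominated_convergence (fun r => wt r ^ 2) hFm
      (integrableOn_sq_wt P.r₀) (fun n => ?_) ?_
    · filter_upwards [ae_restrict_mem measurableSet_Ioo] with r hr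
      rw [Real.norm_eq_abs, abs_of_nonneg (hFb n r hr).1]
      exact (hFb n r hr).2
    · filter_upwards [ae_restrict_mem measurableSet_Ioo] with r hr
      have h1 : 0 < P.ρ r * r := mul_pos (P.ρ_pos ⟨hr.1.le, hr.2⟩) hr.1
      refine Tendsto.div_atTop tendsto_const_nhds ?_
      exact tendsto_atTop_add_const_left _ _ (tendsto_natCast_atTop_atTop.atTop_mul_const h1)
  rw [integral_zero] at hFt
  obtain ⟨n, hn⟩ := (hFt.eventually (ge_mem_nhds (show 0 < ε / C by positivity))).exists
  refine ⟨n + 1, by positivity, fun u hu => ?_⟩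
  have hpt : ∀ r ∈ Ioo 0 P.r₀, u.ξ r ^ 2 + u.η r ^ 2 + u.ζ r ^ 2
      ≤ C * P.nrm m k u * F n r + n * P.kin u r := by
    intro r hr
    have h1 := H u hu r (Ioo_subset_Ioc_self hr)
    set S := u.ξ r ^ 2 + u.η r ^ 2 + u.ζ r ^ 2 with hS
    have hS0 : 0 ≤ S := by positivity
    set t := P.ρ r * r with ht
    have ht0 : 0 ≤ t := mul_nonneg (P.ρ_nonneg (Ioo_subset_Icc_self hr)) hr.1.le
    have hnt : 0 < 1 + n * t := by positivity
    have hkin : P.kin u r = t * S := by rw [kin, ht]; ring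
    have h2 : S = S / (1 + n * t) + n * (t * S) / (1 + n * t) := by field_simp
    have h3 : S / (1 + n * t) ≤ C * P.nrm m k u * F n r := by
      rw [hF, ← mul_div_assoc]
      exact div_le_div_of_nonneg_right h1 hnt.le
    have h4 : n * (t * S) / (1 + n * t) ≤ n * (t * S) :=
      div_le_self (by positivity) (by nlinarith [Nat.cast_nonneg (α := ℝ) n])
    rw [hkin]
    linarith
  have hk := integrableOn_kin hu
  have h1 := setIntegral_mono_on (integrableOn_sq_comp hu)
    (((hFi n).const_mul (C * P.nrm m k u)).add (hk.const_mul (n : ℝ))) measurableSet_Ioo hpt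
  rw [Pi.add_def, integral_add ((hFi n).const_mul _) (hk.const_mul _), integral_const_mul,
    integral_const_mul] at h1
  have h2 : 0 ≤ ∫ r in Ioo 0 P.r₀, P.kin u r := setIntegral_nonneg measurableSet_Ioo
    fun r hr => P.kin_nonneg u hr
  have h3 : C * P.nrm m k u * ∫ r in Ioo 0 P.r₀, F n r ≤ C * P.nrm m k u * (ε / C) :=
    mul_le_mul_of_nonneg_left hn (mul_nonneg hC.le nrm_nonneg)
  have h4 : C * P.nrm m k u * (ε / C) = ε * P.nrm m k u := by field_simp
  linarith

end ZPinch

/-! ### The energy densities as quadratic forms on jets -/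

/-- The viscous dissipation as a function of the jet of the displacement. -/
noncomputable def jetVisc (m k : ℤ) (ε δ r : ℝ) (x : Fin 6 → ℝ) : ℝ :=
  ε * (2 / 9 * (-2 * x 3 + x 0 / r + m / r * x 2 - k * x 1) ^ 2
    + 2 / 9 * (x 3 - 2 * x 0 / r - 2 * m / r * x 2 - k * x 1) ^ 2
    + 2 / 9 * (x 3 + x 0 / r + m / r * x 2 + 2 * k * x 1) ^ 2
    + (-x 5 + x 2 / r + m / r * x 0) ^ 2
    + (x 4 + k * x 0) ^ 2
    + (m / r * x 1 - k * x 2) ^ 2)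
  + δ * (x 3 + x 0 / r + m / r * x 2 - k * x 1) ^ 2

theorem jetVisc_mul_le {m k : ℤ} {ε δ ρ r : ℝ} {x : Fin 6 → ℝ} (hε : 0 ≤ ε) (hδ : 0 ≤ δ)
    (hρ : 0 ≤ ρ) (hr : 0 ≤ r) :
    0 ≤ jetVisc m k ε δ r x ∧ jetVisc m k ε δ r x * r ≤ (ε + δ) * jetDensity m k ρ r x := by
  unfold jetVisc jetDensity
  set a1 := (-2 * x 3 + x 0 / r + m / r * x 2 - k * x 1) ^ 2
  set a2 := (x 3 - 2 * x 0 / r - 2 * m / r * x 2 - k * x 1) ^ 2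
  set a3 := (x 3 + x 0 / r + m / r * x 2 + 2 * k * x 1) ^ 2
  set a4 := (-x 5 + x 2 / r + m / r * x 0) ^ 2
  set a5 := (x 4 + k * x 0) ^ 2
  set a6 := (m / r * x 1 - k * x 2) ^ 2
  set d := (x 3 + x 0 / r + m / r * x 2 - k * x 1) ^ 2
  have h1 : 0 ≤ a1 := sq_nonneg _
  have h2 : 0 ≤ a2 := sq_nonneg _
  have h3 : 0 ≤ a3 := sq_nonneg _
  have h4 : 0 ≤ a4 := sq_nonneg _
  have h5 : 0 ≤ a5 := sq_nonneg _
  have h6 : 0 ≤ a6 := sq_nonneg _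
  have h7 : 0 ≤ d := sq_nonneg _
  have h8 : 0 ≤ ρ * (x 0 ^ 2 + x 1 ^ 2 + x 2 ^ 2) := by positivity
  refine ⟨by positivity, ?_⟩
  rw [← mul_assoc]
  refine mul_le_mul_of_nonneg_right ?_ hr
  rw [add_mul]
  refine add_le_add ?_ ?_
  · exact mul_le_mul_of_nonneg_left (by linarith) hε
  · exact mul_le_mul_of_nonneg_left (by linarith) hδ

/-- Coercivity: dissipation and norm contain the same seven squares, and the smallest weight in the
dissipation is at least `min (2 / 9 * ε) δ`. Only the kinetic part of the norm is not reached. -/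
theorem le_jetVisc_mul {m k : ℤ} {ε δ ρ r : ℝ} {x : Fin 6 → ℝ} (hε : 0 ≤ ε)
    (hr : 0 ≤ r) : min (2 / 9 * ε) δ * (jetDensity m k ρ r x
      - ρ * (x 0 ^ 2 + x 1 ^ 2 + x 2 ^ 2) * r) ≤ jetVisc m k ε δ r x * r := by
  unfold jetVisc jetDensity
  set a1 := (-2 * x 3 + x 0 / r + m / r * x 2 - k * x 1) ^ 2
  set a2 := (x 3 - 2 * x 0 / r - 2 * m / r * x 2 - k * x 1) ^ 2
  set a3 := (x 3 + x 0 / r + m / r * x 2 + 2 * k * x 1) ^ 2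
  set a4 := (-x 5 + x 2 / r + m / r * x 0) ^ 2
  set a5 := (x 4 + k * x 0) ^ 2
  set a6 := (m / r * x 1 - k * x 2) ^ 2
  set d := (x 3 + x 0 / r + m / r * x 2 - k * x 1) ^ 2
  set e := ρ * (x 0 ^ 2 + x 1 ^ 2 + x 2 ^ 2)
  have h1 : 0 ≤ a1 := sq_nonneg _
  have h2 : 0 ≤ a2 := sq_nonneg _
  have h3 : 0 ≤ a3 := sq_nonneg _
  have h4 : 0 ≤ a4 := sq_nonneg _
  have h5 : 0 ≤ a5 := sq_nonneg _
  have h6 : 0 ≤ a6 := sq_nonneg _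
  have h7 : 0 ≤ d := sq_nonneg _
  have hA : min (2 / 9 * ε) δ * (a1 + a2 + a3 + a4 + a5 + a6)
      ≤ 2 / 9 * ε * (a1 + a2 + a3 + a4 + a5 + a6) :=
    mul_le_mul_of_nonneg_right (min_le_left _ _) (by positivity)
  have hB : min (2 / 9 * ε) δ * d ≤ δ * d := mul_le_mul_of_nonneg_right (min_le_right _ _) h7
  have hC : 2 / 9 * ε * (a4 + a5 + a6) ≤ ε * (a4 + a5 + a6) :=
    mul_le_mul_of_nonneg_right (by linarith) (by positivity)
  have : min (2 / 9 * ε) δ * (a1 + a2 + a3 + a4 + a5 + a6 + d) ≤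
      ε * (2 / 9 * a1 + 2 / 9 * a2 + 2 / 9 * a3 + a4 + a5 + a6) + δ * d := by linarith
  have h := mul_le_mul_of_nonneg_right this hr
  linarith

/-- A family of quadratic forms on jets, one for every radius. -/
structure IsJetForm (Φ : ℝ → (Fin 6 → ℝ) → ℝ) : Prop where
  parallelogram : ∀ r x y, Φ r (x + y) + Φ r (x - y) = 2 * Φ r x + 2 * Φ r y
  smul : ∀ r (c : ℝ) x, Φ r (c • x) = c ^ 2 * Φ r x

theorem IsJetForm.integral_parallelogram {Φ : ℝ → (Fin 6 → ℝ) → ℝ} (hΦ : IsJetForm Φ) {b : ℝ}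
    {u v : Displacement} (hu : u.IsLocAC b) (hv : v.IsLocAC b)
    (hΦu : IntegrableOn (fun r => Φ r (u.jet r)) (Ioo 0 b))
    (hΦv : IntegrableOn (fun r => Φ r (v.jet r)) (Ioo 0 b))
    (hΦa : IntegrableOn (fun r => Φ r ((u + v).jet r)) (Ioo 0 b))
    (hΦs : IntegrableOn (fun r => Φ r ((u - v).jet r)) (Ioo 0 b)) :
    (∫ r in Ioo 0 b, Φ r ((u + v).jet r)) + ∫ r in Ioo 0 b, Φ r ((u - v).jet r)
      = 2 * (∫ r in Ioo 0 b, Φ r (u.jet r)) + 2 * ∫ r in Ioo 0 b, Φ r (v.jet r) := by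
  rw [← integral_add hΦa hΦs, ← integral_const_mul, ← integral_const_mul,
    ← integral_add (hΦu.const_mul 2) (hΦv.const_mul 2)]
  refine integral_congr_ae ?_
  filter_upwards [hu.jet_add hv, hu.jet_sub hv] with r h1 h2
  rw [h1, h2]
  exact hΦ.parallelogram r _ _

theorem IsJetForm.integral_smul {Φ : ℝ → (Fin 6 → ℝ) → ℝ} (hΦ : IsJetForm Φ) {b c : ℝ}
    {u : Displacement} :
    (∫ r in Ioo 0 b, Φ r ((c • u).jet r)) = c ^ 2 * ∫ r in Ioo 0 b, Φ r (u.jet r) := by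
  simp only [Displacement.jet_smul, hΦ.smul, integral_const_mul]

theorem Displacement.deriv_mul_ξ {u : Displacement} {r : ℝ} (h : DifferentiableAt ℝ u.ξ r) :
    deriv (fun x => x * u.ξ x) r = u.ξ r + r * deriv u.ξ r := by
  have := (hasDerivAt_id r).mul h.hasDerivAt
  rw [one_mul] at this
  exact this.deriv

namespace ZPinch

variable (P : ZPinch)

/-- The kinetic energy density as a function of the jet of the displacement. -/
noncomputable def jetKin (r : ℝ) (x : Fin 6 → ℝ) : ℝ :=
  P.ρ r * (x 0 ^ 2 + x 1 ^ 2 + x 2 ^ 2) * r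

/-- The inviscid part of the integrand of `E₀`. -/
noncomputable def jetIdeal₀ (k : ℤ) (r : ℝ) (x : Fin 6 → ℝ) : ℝ :=
  (2 * P.p' r * x 0 ^ 2 / r
    + P.Bθ r ^ 2 * (k * x 1 - (x 0 + r * x 3 - 2 * x 0) / r) ^ 2
    + P.γ * P.p r * ((x 0 + r * x 3) / r - k * x 1) ^ 2) * r

/-- The inviscid magnetic and pressure part of the integrand of `E`. -/
noncomputable def jetIdeal (m k : ℤ) (r : ℝ) (x : Fin 6 → ℝ) : ℝ :=
  ((m ^ 2 + k ^ 2 * r ^ 2) * (P.Bθ r / r * x 1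
      + (-k * P.Bθ r * (x 0 + r * x 3) + 2 * k * P.Bθ r * x 0) / (m ^ 2 + k ^ 2 * r ^ 2)) ^ 2
    + P.γ * P.p r * ((x 0 + r * x 3) / r - k * x 1 + m * x 2 / r) ^ 2) * r

/-- The field line bending part of the integrand of `E`. -/
noncomputable def jetBend (m k : ℤ) (r : ℝ) (x : Fin 6 → ℝ) : ℝ :=
  m ^ 2 * P.Bθ r ^ 2 / (r * (m ^ 2 + k ^ 2 * r ^ 2)) * (x 0 - r * x 3) ^ 2

/-- The part of the integrand of `E` that can be negative. -/
noncomputable def jetDrive (m : ℤ) (r : ℝ) (x : Fin 6 → ℝ) : ℝ :=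
  (2 * P.p' r + m ^ 2 * P.Bθ r ^ 2 / r) * x 0 ^ 2

theorem isJetForm_jetKin : IsJetForm P.jetKin where
  parallelogram r x y := by simp only [jetKin, Pi.add_apply, Pi.sub_apply]; ring
  smul r c x := by simp only [jetKin, Pi.smul_apply, smul_eq_mul]; ring

theorem isJetForm_jetVisc (m k : ℤ) (ε δ : ℝ) :
    IsJetForm fun r x => jetVisc m k ε δ r x * r where
  parallelogram r x y := by simp only [jetVisc, Pi.add_apply, Pi.sub_apply]; ring
  smul r c x := by simp only [jetVisc, Pi.smul_apply, smul_eq_mul]; ring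

theorem isJetForm_jetIdeal₀ (k : ℤ) : IsJetForm (P.jetIdeal₀ k) where
  parallelogram r x y := by simp only [jetIdeal₀, Pi.add_apply, Pi.sub_apply]; ring
  smul r c x := by simp only [jetIdeal₀, Pi.smul_apply, smul_eq_mul]; ring

theorem isJetForm_jetIdeal (m k : ℤ) : IsJetForm (P.jetIdeal m k) where
  parallelogram r x y := by simp only [jetIdeal, Pi.add_apply, Pi.sub_apply]; ring
  smul r c x := by simp only [jetIdeal, Pi.smul_apply, smul_eq_mul]; ring

theorem isJetForm_jetBend (m k : ℤ) : IsJetForm (P.jetBend m k) where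
  parallelogram r x y := by simp only [jetBend, Pi.add_apply, Pi.sub_apply]; ring
  smul r c x := by simp only [jetBend, Pi.smul_apply, smul_eq_mul]; ring

theorem isJetForm_jetDrive (m : ℤ) : IsJetForm (P.jetDrive m) where
  parallelogram r x y := by simp only [jetDrive, Pi.add_apply, Pi.sub_apply]; ring
  smul r c x := by simp only [jetDrive, Pi.smul_apply, smul_eq_mul]; ring

theorem _root_.IsJetForm.add {Φ Ψ : ℝ → (Fin 6 → ℝ) → ℝ} (hΦ : IsJetForm Φ) (hΨ : IsJetForm Ψ) :
    IsJetForm fun r x => Φ r x + Ψ r x where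
  parallelogram r x y := by linear_combination hΦ.parallelogram r x y + hΨ.parallelogram r x y
  smul r c x := by linear_combination hΦ.smul r c x + hΨ.smul r c x

section Bounds

/-- The magnetic and pressure terms are squares, so only `2p'ξ²` can be negative, and it involves no
derivative. The magnetic square is `(kη - ξ' + ξ/r)²`, whose three terms are each controlled by the
norm density when `m = 0`. -/
theorem exists_abs_jetIdeal₀_le (k : ℤ) : ∃ C > 0, ∀ r ∈ Ioo 0 P.r₀, ∀ x : Fin 6 → ℝ,
    |P.jetIdeal₀ k r x| ≤
      C * (jetDensity 0 k (P.ρ r) r x + (x 0 ^ 2 + x 1 ^ 2 + x 2 ^ 2)) ∧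
    -(C * (x 0 ^ 2 + x 1 ^ 2 + x 2 ^ 2)) ≤ P.jetIdeal₀ k r x := by
  obtain ⟨Cp, hCp, Hp⟩ := P.exists_abs_le P.continuousOn_p
  obtain ⟨Cq, hCq, Hq⟩ := P.exists_abs_le P.continuousOn_p'
  obtain ⟨Cb, hCb, Hb⟩ := P.exists_sq_Bθ_le
  have hγ : 0 < P.γ := zero_lt_one.trans P.one_lt_γ
  have hr0 := P.r₀_pos
  refine ⟨2 * Cq + 9 * (Cb * P.r₀) + P.γ * Cp, by positivity, fun r hr x => ?_⟩
  have hr' := Ioo_subset_Icc_self hr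
  have hρ := P.ρ_nonneg hr'
  have hrp := hr.1
  set D := jetDensity 0 k (P.ρ r) r x with hD
  set S := x 0 ^ 2 + x 1 ^ 2 + x 2 ^ 2 with hS
  have hS0 : 0 ≤ S := by positivity
  have hD0 : 0 ≤ D := jetDensity_nonneg hρ hrp.le
  have e : P.jetIdeal₀ k r x = 2 * P.p' r * x 0 ^ 2
      + P.Bθ r ^ 2 * ((k * x 1 - x 3 + x 0 / r) ^ 2 * r)
      + P.γ * P.p r * ((x 3 + x 0 / r + (0 : ℤ) / r * x 2 - k * x 1) ^ 2 * r) := by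
    unfold jetIdeal₀
    push_cast
    field_simp
    ring
  have hb : P.Bθ r ^ 2 ≤ Cb * P.r₀ :=
    (Hb r ⟨hrp, hr.2.le⟩).trans (mul_le_mul_of_nonneg_left hr.2.le hCb.le)
  have t1 : |2 * P.p' r * x 0 ^ 2| ≤ 2 * Cq * S := by
    rw [abs_mul, abs_mul, abs_two, abs_of_nonneg (sq_nonneg (x 0))]
    refine mul_le_mul ?_ ?_ (sq_nonneg _) (by positivity)
    · linarith [Hq r hr']
    · rw [hS]; nlinarith [sq_nonneg (x 1), sq_nonneg (x 2)]
  have t2 : P.Bθ r ^ 2 * ((k * x 1 - x 3 + x 0 / r) ^ 2 * r) ≤ Cb * P.r₀ * (9 * D) := by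
    refine mul_le_mul hb ?_ (by positivity) (by positivity)
    have h1 : (k * x 1) ^ 2 * r ≤ D := sq_kη_le_jetDensity hρ hrp.le
    have h2 : x 3 ^ 2 * r ≤ D := sq_dξ_le_jetDensity hρ hrp.le
    have h3 : (x 0 / r + (0 : ℤ) / r * x 2) ^ 2 * r ≤ D := sq_hoop_le_jetDensity hρ hrp.le
    rw [Int.cast_zero, zero_div, zero_mul, add_zero] at h3
    have h4 : (k * x 1 - x 3 + x 0 / r) ^ 2 ≤
        3 * (k * x 1) ^ 2 + 3 * x 3 ^ 2 + 3 * (x 0 / r) ^ 2 := by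
      nlinarith only [sq_nonneg (k * x 1 + x 3), sq_nonneg (k * x 1 - x 0 / r),
        sq_nonneg (x 3 + x 0 / r)]
    have h5 := mul_le_mul_of_nonneg_right h4 hrp.le
    linarith
  have t2' : 0 ≤ P.Bθ r ^ 2 * ((k * x 1 - x 3 + x 0 / r) ^ 2 * r) := by positivity
  have hp0 := P.p_nonneg r hr'
  have t3 : P.γ * P.p r * ((x 3 + x 0 / r + (0 : ℤ) / r * x 2 - k * x 1) ^ 2 * r)
      ≤ P.γ * Cp * D := by
    refine mul_le_mul ?_ (sq_divg_le_jetDensity hρ hrp.le) (by positivity) (by positivity)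
    exact mul_le_mul_of_nonneg_left ((le_abs_self _).trans (Hp r hr')) hγ.le
  have t3' : 0 ≤ P.γ * P.p r * ((x 3 + x 0 / r + (0 : ℤ) / r * x 2 - k * x 1) ^ 2 * r) := by
    positivity
  rw [e]
  have h1 := abs_le.mp t1
  have h2 : 0 ≤ (9 * (Cb * P.r₀) + P.γ * Cp) * S := by positivity
  have h3 : 0 ≤ 2 * Cq * D := by positivity
  have h4 : 0 ≤ (9 * (Cb * P.r₀) + P.γ * Cp) * D := by positivity
  refine ⟨abs_le.mpr ⟨?_, ?_⟩, ?_⟩ <;> linarith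

/-- Since `m` is a nonzero integer, `m² + k²r² ≥ 1`, so the denominators are harmless, and `B_θ² /
r` is bounded. The signs show that only `jetDrive` can be negative; its bound is free of
derivatives, as the Gårding inequality requires. -/
theorem exists_abs_jetIdeal_le {m : ℤ} (hm : m ≠ 0) (k : ℤ) : ∃ C > 0, ∀ r ∈ Ioo 0 P.r₀,
    ∀ x : Fin 6 → ℝ,
    |P.jetIdeal m k r x| ≤ C * (jetDensity m k (P.ρ r) r x + (x 0 ^ 2 + x 1 ^ 2 + x 2 ^ 2)) ∧
    |P.jetBend m k r x| ≤ C * (jetDensity m k (P.ρ r) r x + (x 0 ^ 2 + x 1 ^ 2 + x 2 ^ 2)) ∧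
    |P.jetDrive m r x| ≤ C * (x 0 ^ 2 + x 1 ^ 2 + x 2 ^ 2) ∧
    0 ≤ P.jetIdeal m k r x ∧ 0 ≤ P.jetBend m k r x := by
  obtain ⟨Cp, hCp, Hp⟩ := P.exists_abs_le P.continuousOn_p
  obtain ⟨Cq, hCq, Hq⟩ := P.exists_abs_le P.continuousOn_p'
  obtain ⟨Cb, hCb, Hb⟩ := P.exists_sq_Bθ_le
  have hγ : 0 < P.γ := zero_lt_one.trans P.one_lt_γ
  have hr0 := P.r₀_pos
  have hm1 : (1 : ℝ) ≤ (m : ℝ) ^ 2 := by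
    have : (1 : ℤ) ≤ m ^ 2 := by
      have : 0 < m ^ 2 := by positivity
      omega
    exact_mod_cast this
  set A1 := 2 * (m ^ 2 + k ^ 2 * P.r₀ ^ 2) * Cb + 4 * k ^ 2 * Cb * P.r₀ ^ 2 * (1 + P.r₀) with hA1
  set A2 := P.γ * Cp with hA2
  set A3 := 2 * m ^ 2 * Cb * (1 + P.r₀) with hA3
  set A4 := 2 * Cq + m ^ 2 * Cb with hA4
  have n1 : 0 ≤ A1 := by positivity
  have n2 : 0 < A2 := by positivity
  have n3 : 0 ≤ A3 := by positivity
  have n4 : 0 ≤ A4 := by positivity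
  refine ⟨A1 + A2 + A3 + A4, by positivity, fun r hr x => ?_⟩
  have hr' := Ioo_subset_Icc_self hr
  have hρ := P.ρ_nonneg hr'
  have hrp := hr.1
  set D := jetDensity m k (P.ρ r) r x with hD
  set S := x 0 ^ 2 + x 1 ^ 2 + x 2 ^ 2 with hS
  have hS0 : 0 ≤ S := by positivity
  have hD0 : 0 ≤ D := jetDensity_nonneg hρ hrp.le
  have hx0 : x 0 ^ 2 ≤ S := by rw [hS]; nlinarith [sq_nonneg (x 1), sq_nonneg (x 2)]
  have hx1 : x 1 ^ 2 ≤ S := by rw [hS]; nlinarith [sq_nonneg (x 0), sq_nonneg (x 2)]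
  set q : ℝ := m ^ 2 + k ^ 2 * r ^ 2 with hq
  have hq1 : 1 ≤ q := by
    have : 0 ≤ (k : ℝ) ^ 2 * r ^ 2 := by positivity
    linarith
  have hqpos : 0 < q := by linarith
  have hrr : r ^ 2 ≤ P.r₀ ^ 2 := pow_le_pow_left₀ hrp.le hr.2.le 2
  have hq2 : q ≤ m ^ 2 + k ^ 2 * P.r₀ ^ 2 := by
    have := mul_le_mul_of_nonneg_left hrr (sq_nonneg (k : ℝ))
    linarith
  have hb := Hb r ⟨hrp, hr.2.le⟩
  have hbr : P.Bθ r ^ 2 / r ≤ Cb := by rwa [div_le_iff₀ hrp]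
  have hbr0 : 0 ≤ P.Bθ r ^ 2 / r := by positivity
  have hp0 := P.p_nonneg r hr'
  have hdx : x 3 ^ 2 * r ≤ D := sq_dξ_le_jetDensity hρ hrp.le
  have hy : (x 0 - r * x 3) ^ 2 ≤ 2 * (1 + P.r₀) * (D + S) := by
    have h1 : (x 0 - r * x 3) ^ 2 ≤ 2 * x 0 ^ 2 + 2 * (r * (x 3 ^ 2 * r)) := by
      nlinarith only [sq_nonneg (x 0 + r * x 3)]
    have h2 : r * (x 3 ^ 2 * r) ≤ P.r₀ * D := mul_le_mul hr.2.le hdx (by positivity) hr0.le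
    have h3 : 0 ≤ P.r₀ * S := by positivity
    linarith
  -- In this form the singular factor appears only as `B_θ² / r`, and the pressure square is the
  -- divergence `d`.
  have eI : P.jetIdeal m k r x =
      (P.Bθ r ^ 2 / r) * (q * (x 1 + k * r * (x 0 - r * x 3) / q) ^ 2)
      + P.γ * P.p r * ((x 3 + x 0 / r + m / r * x 2 - k * x 1) ^ 2 * r) := by
    unfold jetIdeal
    rw [← hq]
    field_simp
    ring
  have eB : P.jetBend m k r x = m ^ 2 * (P.Bθ r ^ 2 / r) * ((x 0 - r * x 3) ^ 2 / q) := by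
    unfold jetBend
    rw [← hq]
    field_simp
  have tB : (x 0 - r * x 3) ^ 2 / q ≤ 2 * (1 + P.r₀) * (D + S) :=
    (div_le_self (sq_nonneg _) hq1).trans hy
  have t1 : q * (x 1 + k * r * (x 0 - r * x 3) / q) ^ 2
      ≤ 2 * (m ^ 2 + k ^ 2 * P.r₀ ^ 2) * S
        + 2 * (k ^ 2 * P.r₀ ^ 2) * (2 * (1 + P.r₀) * (D + S)) := by
    have h1 : q * (x 1 + k * r * (x 0 - r * x 3) / q) ^ 2
        ≤ 2 * (q * x 1 ^ 2) + 2 * ((k ^ 2 * r ^ 2) * ((x 0 - r * x 3) ^ 2 / q)) := by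
      have h2 : (x 1 + k * r * (x 0 - r * x 3) / q) ^ 2
          ≤ 2 * x 1 ^ 2 + 2 * (k * r * (x 0 - r * x 3) / q) ^ 2 := by
        nlinarith only [sq_nonneg (x 1 - k * r * (x 0 - r * x 3) / q)]
      refine (mul_le_mul_of_nonneg_left h2 hqpos.le).trans (le_of_eq ?_)
      field_simp
    have h3 : q * x 1 ^ 2 ≤ (m ^ 2 + k ^ 2 * P.r₀ ^ 2) * S :=
      mul_le_mul hq2 hx1 (sq_nonneg _) (by positivity)
    have h4 : (k ^ 2 * r ^ 2) * ((x 0 - r * x 3) ^ 2 / q)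
        ≤ (k ^ 2 * P.r₀ ^ 2) * (2 * (1 + P.r₀) * (D + S)) :=
      mul_le_mul (mul_le_mul_of_nonneg_left hrr (sq_nonneg _)) tB (by positivity) (by positivity)
    linarith
  have tI0 : 0 ≤ P.jetIdeal m k r x := by rw [eI]; positivity
  have tB0 : 0 ≤ P.jetBend m k r x := by rw [eB]; positivity
  have tI : P.jetIdeal m k r x ≤ (A1 + A2) * (D + S) := by
    rw [eI]
    have h1 := mul_le_mul hbr t1 (by positivity) hCb.le
    have h2 : P.γ * P.p r * ((x 3 + x 0 / r + m / r * x 2 - k * x 1) ^ 2 * r) ≤ A2 * D := by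
      refine mul_le_mul ?_ (sq_divg_le_jetDensity hρ hrp.le) (by positivity) (by positivity)
      exact mul_le_mul_of_nonneg_left ((le_abs_self _).trans (Hp r hr')) hγ.le
    have h3 : 0 ≤ 2 * (m ^ 2 + k ^ 2 * P.r₀ ^ 2) * Cb * D := by positivity
    have h4 : 0 ≤ A2 * S := by positivity
    have h5 : A1 * (D + S) = 2 * (m ^ 2 + k ^ 2 * P.r₀ ^ 2) * Cb * D
      + Cb * (2 * (m ^ 2 + k ^ 2 * P.r₀ ^ 2) * S
        + 2 * (k ^ 2 * P.r₀ ^ 2) * (2 * (1 + P.r₀) * (D + S))) := by rw [hA1]; ring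
    linarith
  have tBB : P.jetBend m k r x ≤ A3 * (D + S) := by
    rw [eB]
    have h1 := mul_le_mul (mul_le_mul_of_nonneg_left hbr (sq_nonneg (m : ℝ))) tB
      (by positivity) (by positivity)
    refine h1.trans (le_of_eq ?_)
    rw [hA3]; ring
  have tD : |P.jetDrive m r x| ≤ A4 * S := by
    unfold jetDrive
    rw [abs_mul, abs_of_nonneg (sq_nonneg (x 0))]
    refine mul_le_mul ?_ hx0 (sq_nonneg _) n4
    have h1 := abs_add_le (2 * P.p' r) (m ^ 2 * P.Bθ r ^ 2 / r)
    rw [abs_mul, abs_two, mul_div_assoc, abs_of_nonneg (mul_nonneg (sq_nonneg (m : ℝ)) hbr0)] at h1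
    have h2 := mul_le_mul_of_nonneg_left hbr (sq_nonneg (m : ℝ))
    have h3 := Hq r hr'
    rw [mul_div_assoc]
    linarith
  have hDS : 0 ≤ D + S := by positivity
  have m1 := mul_nonneg n1 hDS
  have m2 := mul_nonneg n2.le hDS
  have m3 := mul_nonneg n3 hDS
  have m4 := mul_nonneg n4 hDS
  have m5 : 0 ≤ (A1 + A2 + A3) * S := by positivity
  refine ⟨?_, ?_, ?_, tI0, tB0⟩
  · rw [abs_of_nonneg tI0]; linarith
  · rw [abs_of_nonneg tB0]; linarith
  · linarith

end Bounds

section Integrals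

variable {P} {m k : ℤ} {u v : Displacement}

theorem integrableOn_jetForm {Φ : ℝ → (Fin 6 → ℝ) → ℝ} {C : ℝ}
    (hΦm : AEMeasurable (fun r => Φ r (u.jet r)) (volume.restrict (Ioo 0 P.r₀)))
    (hΦ : ∀ r ∈ Ioo 0 P.r₀, ∀ x : Fin 6 → ℝ,
      |Φ r x| ≤ C * (jetDensity m k (P.ρ r) r x + (x 0 ^ 2 + x 1 ^ 2 + x 2 ^ 2)))
    (hu : u ∈ P.finiteNorm m k) : IntegrableOn (fun r => Φ r (u.jet r)) (Ioo 0 P.r₀) := by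
  refine ((hu.2.add (integrableOn_sq_comp hu)).const_mul C).mono' hΦm.aestronglyMeasurable ?_
  filter_upwards [ae_restrict_mem measurableSet_Ioo] with r hr
  exact hΦ r hr (u.jet r)

theorem aemeasurable_equilibrium : AEMeasurable P.p (volume.restrict (Ioo 0 P.r₀)) ∧
    AEMeasurable P.p' (volume.restrict (Ioo 0 P.r₀)) ∧
    AEMeasurable P.Bθ (volume.restrict (Ioo 0 P.r₀)) :=
  ⟨(P.aestronglyMeasurable_of_continuousOn
      (P.continuousOn_p.mono Ioc_subset_Icc_self)).aemeasurable,
    (P.aestronglyMeasurable_of_continuousOn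
      (P.continuousOn_p'.mono Ioc_subset_Icc_self)).aemeasurable,
    (P.aestronglyMeasurable_of_continuousOn P.continuousOn_Bθ).aemeasurable⟩

theorem integrableOn_jetVisc {ε δ : ℝ} (hε : 0 ≤ ε) (hδ : 0 ≤ δ) (hu : u ∈ P.finiteNorm m k) :
    IntegrableOn (fun r => jetVisc m k ε δ r (u.jet r) * r) (Ioo 0 P.r₀) := by
  refine integrableOn_jetForm (Φ := fun r x => jetVisc m k ε δ r x * r) (C := ε + δ) ?_ ?_ hu
  · have hx := fun i => (hu.1.aestronglyMeasurable_jet i).aemeasurable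
    have h0 := hx 0
    have h1 := hx 1
    have h2 := hx 2
    have h3 := hx 3
    have h4 := hx 4
    have h5 := hx 5
    unfold jetVisc
    fun_prop
  · intro r hr x
    obtain ⟨h1, h2⟩ := jetVisc_mul_le (m := m) (k := k) (x := x) hε hδ
      (P.ρ_nonneg (Ioo_subset_Icc_self hr)) hr.1.le
    rw [abs_of_nonneg (mul_nonneg h1 hr.1.le)]
    have : 0 ≤ (ε + δ) * (x 0 ^ 2 + x 1 ^ 2 + x 2 ^ 2) := by positivity
    linarith

theorem integrableOn_jetIdeal₀ (hu : u ∈ P.finiteNorm 0 k) :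
    IntegrableOn (fun r => P.jetIdeal₀ k r (u.jet r)) (Ioo 0 P.r₀) := by
  obtain ⟨C, -, H⟩ := P.exists_abs_jetIdeal₀_le k
  refine integrableOn_jetForm (Φ := P.jetIdeal₀ k) (C := C) ?_ (fun r hr x => (H r hr x).1) hu
  have hx := fun i => (hu.1.aestronglyMeasurable_jet i).aemeasurable
  have h0 := hx 0
  have h1 := hx 1
  have h3 := hx 3
  obtain ⟨e1, e2, e3⟩ := aemeasurable_equilibrium (P := P)
  unfold jetIdeal₀
  fun_prop

theorem integrableOn_jetIdeal (hm : m ≠ 0) (hu : u ∈ P.finiteNorm m k) :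
    IntegrableOn (fun r => P.jetIdeal m k r (u.jet r)) (Ioo 0 P.r₀) := by
  obtain ⟨C, -, H⟩ := P.exists_abs_jetIdeal_le hm k
  refine integrableOn_jetForm (Φ := P.jetIdeal m k) (C := C) ?_ (fun r hr x => (H r hr x).1) hu
  have hx := fun i => (hu.1.aestronglyMeasurable_jet i).aemeasurable
  have h0 := hx 0
  have h1 := hx 1
  have h2 := hx 2
  have h3 := hx 3
  obtain ⟨e1, e2, e3⟩ := aemeasurable_equilibrium (P := P)
  unfold jetIdeal
  fun_prop

theorem integrableOn_jetBend (hm : m ≠ 0) (hu : u ∈ P.finiteNorm m k) :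
    IntegrableOn (fun r => P.jetBend m k r (u.jet r)) (Ioo 0 P.r₀) := by
  obtain ⟨C, -, H⟩ := P.exists_abs_jetIdeal_le hm k
  refine integrableOn_jetForm (Φ := P.jetBend m k) (C := C) ?_ (fun r hr x => (H r hr x).2.1) hu
  have hx := fun i => (hu.1.aestronglyMeasurable_jet i).aemeasurable
  have h0 := hx 0
  have h3 := hx 3
  obtain ⟨e1, e2, e3⟩ := aemeasurable_equilibrium (P := P)
  unfold jetBend
  fun_prop

theorem integrableOn_jetDrive (hm : m ≠ 0) (hu : u ∈ P.finiteNorm m k) :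
    IntegrableOn (fun r => P.jetDrive m r (u.jet r)) (Ioo 0 P.r₀) := by
  obtain ⟨C, hC, H⟩ := P.exists_abs_jetIdeal_le hm k
  refine integrableOn_jetForm (Φ := P.jetDrive m) (C := C) ?_ (fun r hr x => ?_) hu
  · have hx := fun i => (hu.1.aestronglyMeasurable_jet i).aemeasurable
    have h0 := hx 0
    obtain ⟨e1, e2, e3⟩ := aemeasurable_equilibrium (P := P)
    unfold jetDrive
    fun_prop
  · refine (H r hr x).2.2.1.trans (mul_le_mul_of_nonneg_left ?_ hC.le)
    exact le_add_of_nonneg_left (jetDensity_nonneg (P.ρ_nonneg (Ioo_subset_Icc_self hr)) hr.1.le)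

end Integrals

end ZPinch

/-! ### Smooth displacements and their completion -/

theorem abs_jetDensity_le {m k : ℤ} {ρ r R C : ℝ} {x : Fin 6 → ℝ} (hr : 0 < r) (hrR : r ≤ R)
    (hρ : 0 ≤ ρ) (hρC : ρ ≤ C) (hx : ∀ i, |x i| ≤ C) (h0 : |x 0 / r| ≤ C) (h2 : |x 2 / r| ≤ C)
    (h1 : m ≠ 0 → |x 1 / r| ≤ C) :
    |jetDensity m k ρ r x| ≤
      (7 * (6 * ((1 + |(m : ℝ)| + |(k : ℝ)|) * C)) ^ 2 + C * (3 * C ^ 2)) * R := by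
  have hC : 0 ≤ C := hρ.trans hρC
  set T := (1 + |(m : ℝ)| + |(k : ℝ)|) * C with hT
  have hT0 : 0 ≤ T := by positivity
  have mulm : ∀ z : ℝ, |z| ≤ C → |m * z| ≤ T := by
    intro z hz
    rw [abs_mul, hT]
    have := mul_le_mul_of_nonneg_left hz (abs_nonneg (m : ℝ))
    have h3 : 0 ≤ |(k : ℝ)| * C := by positivity
    linarith
  have mulk : ∀ z : ℝ, |z| ≤ C → |k * z| ≤ T := by
    intro z hz
    rw [abs_mul, hT]
    have := mul_le_mul_of_nonneg_left hz (abs_nonneg (k : ℝ))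
    have h3 : 0 ≤ |(m : ℝ)| * C := by positivity
    linarith
  have one : ∀ z : ℝ, |z| ≤ C → |z| ≤ T := by
    intro z hz
    have h3 : 0 ≤ |(m : ℝ)| * C := by positivity
    have h4 : 0 ≤ |(k : ℝ)| * C := by positivity
    rw [hT]
    linarith
  have b0 := abs_le.mp (one _ h0)
  have b2 := abs_le.mp (one _ h2)
  have b3 := abs_le.mp (one _ (hx 3))
  have b4 := abs_le.mp (one _ (hx 4))
  have b5 := abs_le.mp (one _ (hx 5))
  have m0 := abs_le.mp (mulm _ h0)
  have m2 := abs_le.mp (mulm _ h2)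
  have k0 := abs_le.mp (mulk _ (hx 0))
  have k1 := abs_le.mp (mulk _ (hx 1))
  have k2 := abs_le.mp (mulk _ (hx 2))
  have m1 : -T ≤ m * (x 1 / r) ∧ m * (x 1 / r) ≤ T := by
    by_cases h : m = 0
    · rw [h, Int.cast_zero, zero_mul]; exact ⟨by linarith, hT0⟩
    · exact abs_le.mp (mulm _ (h1 h))
  have e0 : (m : ℝ) / r * x 0 = m * (x 0 / r) := by ring
  have e1 : (m : ℝ) / r * x 1 = m * (x 1 / r) := by ring
  have e2 : (m : ℝ) / r * x 2 = m * (x 2 / r) := by ring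
  have e3 : 2 * (m : ℝ) / r * x 2 = 2 * (m * (x 2 / r)) := by ring
  have e4 : 2 * x 0 / r = 2 * (x 0 / r) := by ring
  have e5 : 2 * k * x 1 = 2 * (k * x 1) := by ring
  rw [abs_of_nonneg (jetDensity_nonneg hρ hr.le)]
  unfold jetDensity
  rw [e0, e1, e2, e3, e4, e5]
  have sq : ∀ z : ℝ, -(6 * T) ≤ z → z ≤ 6 * T → z ^ 2 ≤ (6 * T) ^ 2 := fun z => sq_le_sq'
  have s1 := sq (-2 * x 3 + x 0 / r + m * (x 2 / r) - k * x 1) (by linarith) (by linarith)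
  have s2 := sq (x 3 - 2 * (x 0 / r) - 2 * (m * (x 2 / r)) - k * x 1) (by linarith) (by linarith)
  have s3 := sq (x 3 + x 0 / r + m * (x 2 / r) + 2 * (k * x 1)) (by linarith) (by linarith)
  have s4 := sq (-x 5 + x 2 / r + m * (x 0 / r)) (by linarith) (by linarith)
  have s5 := sq (x 4 + k * x 0) (by linarith) (by linarith)
  have s6 := sq (m * (x 1 / r) - k * x 2) (by linarith) (by linarith)
  have s7 := sq (x 3 + x 0 / r + m * (x 2 / r) - k * x 1) (by linarith) (by linarith)
  have s8 : ρ * (x 0 ^ 2 + x 1 ^ 2 + x 2 ^ 2) ≤ C * (3 * C ^ 2) := by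
    refine mul_le_mul hρC ?_ (by positivity) hC
    have q : ∀ i, x i ^ 2 ≤ C ^ 2 := fun i => sq_le_sq' (abs_le.mp (hx i)).1 (abs_le.mp (hx i)).2
    linarith [q 0, q 1, q 2]
  refine mul_le_mul (by linarith) hrR hr.le (by positivity)

/-- A function that is continuously differentiable on `[0, b]` is bounded there together with its
derivative, and with its quotient by `r` if it vanishes at `0`. -/
theorem ContDiffOn.exists_bounds {f : ℝ → ℝ} {b : ℝ} (hb : 0 < b)
    (hf : ContDiffOn ℝ ∞ f (Icc 0 b)) : ∃ C, ∀ r ∈ Ioo 0 b, |f r| ≤ C ∧ |deriv f r| ≤ C ∧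
      (f 0 = 0 → |f r / r| ≤ C) := by
  obtain ⟨K, hK⟩ := (hf.of_le (by exact_mod_cast le_top) : ContDiffOn ℝ 1 f (Icc 0 b)).exists_lipschitzOnWith
    (by decide) (convex_Icc _ _) isCompact_Icc
  have h0 : ∀ r ∈ Ioo 0 b, |f r - f 0| ≤ K * r := by
    intro r hr
    have := hK.dist_le_mul r (Ioo_subset_Icc_self hr) 0 ⟨le_rfl, hb.le⟩
    rwa [Real.dist_eq, Real.dist_eq, sub_zero, abs_of_pos hr.1] at this
  have hK0 : (0 : ℝ) ≤ K := K.2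
  refine ⟨|f 0| + K * b + K, fun r hr => ⟨?_, ?_, fun hf0 => ?_⟩⟩
  · have h1 := h0 r hr
    have h2 := abs_add_le (f 0) (f r - f 0)
    rw [add_sub_cancel] at h2
    have h3 := mul_le_mul_of_nonneg_left hr.2.le hK0
    linarith
  · have := norm_deriv_le_of_lipschitzOn (Icc_mem_nhds hr.1 hr.2) hK
    rw [Real.norm_eq_abs] at this
    have h3 : 0 ≤ K * b := by positivity
    linarith [abs_nonneg (f 0)]
  · have h1 := h0 r hr
    rw [hf0, sub_zero] at h1
    rw [abs_div, abs_of_pos hr.1, div_le_iff₀ hr.1, hf0, abs_zero, zero_add]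
    have : 0 ≤ K * b * r := by have := hr.1; positivity
    linarith

theorem ContDiffOn.locAC {f : ℝ → ℝ} {b : ℝ} (hf : ContDiffOn ℝ ∞ f (Icc 0 b)) : LocAC b f := by
  intro a ha
  refine ContDiffOn.absolutelyContinuousOnInterval ?_
  rw [uIcc_of_le ha.2.le]
  exact (hf.of_le (by exact_mod_cast le_top)).mono (Icc_subset_Icc ha.1.le le_rfl)

/-- The smooth displacements whose completion is `X` (for `m = 0`) or `Y` (for `m ≠ 0`). -/
noncomputable def smoothTests (r₀ : ℝ) (m : ℤ) : Submodule ℝ Displacement where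
  carrier := {v | v.IsSmooth r₀ ∧ v.ξ 0 = 0 ∧ (m ≠ 0 → v.η 0 = 0) ∧ v.ζ 0 = 0}
  add_mem' := by
    rintro u v ⟨⟨a1, a2, a3⟩, a4, a5, a6⟩ ⟨⟨b1, b2, b3⟩, b4, b5, b6⟩
    refine ⟨⟨a1.add b1, a2.add b2, a3.add b3⟩, ?_, fun h => ?_, ?_⟩
    · rw [Displacement.add_ξ, Pi.add_apply, a4, b4, add_zero]
    · rw [Displacement.add_η, Pi.add_apply, a5 h, b5 h, add_zero]
    · rw [Displacement.add_ζ, Pi.add_apply, a6, b6, add_zero]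
  zero_mem' := ⟨⟨contDiffOn_const, contDiffOn_const, contDiffOn_const⟩, rfl, fun _ => rfl, rfl⟩
  smul_mem' := by
    rintro c u ⟨⟨a1, a2, a3⟩, a4, a5, a6⟩
    refine ⟨⟨a1.const_smul c, a2.const_smul c, a3.const_smul c⟩, ?_, fun h => ?_, ?_⟩
    · rw [Displacement.smul_ξ, Pi.smul_apply, a4, smul_zero]
    · rw [Displacement.smul_η, Pi.smul_apply, a5 h, smul_zero]
    · rw [Displacement.smul_ζ, Pi.smul_apply, a6, smul_zero]

namespace ZPinch

variable {P : ZPinch} {m k : ℤ} {u v : Displacement}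

/-- The vanishing conditions at the axis are what bounds the terms with `1/r`. The quotient `η / r`
occurs only with the factor `m`, so `η(0) = 0` is required only for `m ≠ 0`. -/
theorem smoothTests_le_finiteNorm : smoothTests P.r₀ m ≤ P.finiteNorm m k := by
  rintro v ⟨⟨h1, h2, h3⟩, z1, z2, z3⟩
  have hAC : v.IsLocAC P.r₀ := fun a ha => ⟨h1.locAC a ha, h2.locAC a ha, h3.locAC a ha⟩
  obtain ⟨C1, H1⟩ := h1.exists_bounds P.r₀_pos
  obtain ⟨C2, H2⟩ := h2.exists_bounds P.r₀_pos
  obtain ⟨C3, H3⟩ := h3.exists_bounds P.r₀_pos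
  obtain ⟨C4, -, H4⟩ := P.exists_abs_le P.continuousOn_ρ
  set C := max (max C1 C2) (max C3 C4) with hC
  have c1 : C1 ≤ C := (le_max_left _ _).trans (le_max_left _ _)
  have c2 : C2 ≤ C := (le_max_right _ _).trans (le_max_left _ _)
  have c3 : C3 ≤ C := (le_max_left _ _).trans (le_max_right _ _)
  have c4 : C4 ≤ C := (le_max_right _ _).trans (le_max_right _ _)
  refine ⟨hAC, Integrable.of_bound (P.aestronglyMeasurable_dens hAC)
    ((7 * (6 * ((1 + |(m : ℝ)| + |(k : ℝ)|) * C)) ^ 2 + C * (3 * C ^ 2)) * P.r₀) ?_⟩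
  filter_upwards [ae_restrict_mem measurableSet_Ioo] with r hr
  obtain ⟨x1, y1, w1⟩ := H1 r hr
  obtain ⟨x2, y2, w2⟩ := H2 r hr
  obtain ⟨x3, y3, w3⟩ := H3 r hr
  have hr' := Ioo_subset_Icc_self hr
  refine abs_jetDensity_le hr.1 hr.2.le (P.ρ_nonneg hr')
    ((le_abs_self _).trans ((H4 r hr').trans c4)) (fun i => ?_) ((w1 z1).trans c1)
    ((w3 z3).trans c3) fun h => (w2 (z2 h)).trans c2
  fin_cases i
  · exact x1.trans c1
  · exact x2.trans c2
  · exact x3.trans c3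
  · exact y1.trans c1
  · exact y2.trans c2
  · exact y3.trans c3

theorem normSq_smul (c : ℝ) : P.normSq m k (c • u) = ENNReal.ofReal (c ^ 2) * P.normSq m k u := by
  rw [normSq_eq, normSq_eq, ← lintegral_const_mul' _ _ ENNReal.ofReal_ne_top]
  simp only [dens_smul, ENNReal.ofReal_mul (sq_nonneg c)]

variable (P) in
/-- The completion of the smooth displacements: `X k` for `m = 0` and `Y m k` for `m ≠ 0`. -/
noncomputable def admissible (m k : ℤ) : Submodule ℝ Displacement where
  carrier := {u | u.IsLocAC P.r₀ ∧ ∃ v : ℕ → Displacement, (∀ n, v n ∈ smoothTests P.r₀ m) ∧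
    Tendsto (fun n => P.normSq m k (u - v n)) atTop (𝓝 0)}
  add_mem' := by
    rintro u w ⟨hu, v, hv, hvt⟩ ⟨hw, v', hv', hvt'⟩
    refine ⟨hu.add hw, fun n => v n + v' n, fun n => Submodule.add_mem _ (hv n) (hv' n), ?_⟩
    have h1 := (ENNReal.Tendsto.const_mul hvt (Or.inr ENNReal.ofNat_ne_top) (a := 2)).add
      (ENNReal.Tendsto.const_mul hvt' (Or.inr ENNReal.ofNat_ne_top) (a := 2))
    rw [mul_zero, add_zero] at h1
    refine tendsto_of_tendsto_of_tendsto_of_le_of_le tendsto_const_nhds h1 (fun _ => zero_le)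
      fun n => ?_
    have h2 := normSq_add_le (m := m) (k := k)
      (hu.sub (smoothTests_le_finiteNorm (k := k) (hv n)).1)
      (hw.sub (smoothTests_le_finiteNorm (k := k) (hv' n)).1)
    have h3 : u - v n + (w - v' n) = u + w - (v n + v' n) := by abel
    rwa [h3] at h2
  zero_mem' := by
    refine ⟨Displacement.isLocAC_zero, fun _ => 0, fun n => Submodule.zero_mem _, ?_⟩
    have h1 : P.normSq m k (0 - 0) = 0 := by
      have := normSq_smul (P := P) (m := m) (k := k) (u := 0) 0
      rw [zero_smul, zero_pow two_ne_zero, ENNReal.ofReal_zero, zero_mul] at this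
      rw [sub_zero, this]
    simp only [h1]
    exact tendsto_const_nhds
  smul_mem' := by
    rintro c u ⟨hu, v, hv, hvt⟩
    refine ⟨hu.smul c, fun n => c • v n, fun n => Submodule.smul_mem _ c (hv n), ?_⟩
    have h1 := ENNReal.Tendsto.const_mul hvt (Or.inr ENNReal.ofReal_ne_top)
      (a := ENNReal.ofReal (c ^ 2))
    rw [mul_zero] at h1
    refine h1.congr fun n => ?_
    rw [← smul_sub, normSq_smul]

theorem mem_X_iff : u ∈ P.X k ↔ u ∈ P.admissible 0 k := by
  constructor
  · rintro ⟨h1, v, hv, hvt⟩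
    exact ⟨h1, v, fun n => ⟨(hv n).1, (hv n).2.1, fun h => absurd rfl h, (hv n).2.2⟩, hvt⟩
  · rintro ⟨h1, v, hv, hvt⟩
    exact ⟨h1, v, fun n => ⟨(hv n).1, (hv n).2.1, (hv n).2.2.2⟩, hvt⟩

theorem mem_Y_iff (hm : m ≠ 0) : u ∈ P.Y m k ↔ u ∈ P.admissible m k := by
  constructor
  · rintro ⟨h1, v, hv, hvt⟩
    exact ⟨h1, v, fun n => ⟨(hv n).1, (hv n).2.1, fun _ => (hv n).2.2.1, (hv n).2.2.2⟩, hvt⟩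
  · rintro ⟨h1, v, hv, hvt⟩
    exact ⟨h1, v, fun n => ⟨(hv n).1, (hv n).2.1, (hv n).2.2.1 hm, (hv n).2.2.2⟩, hvt⟩

theorem smoothTests_le_admissible : smoothTests P.r₀ m ≤ P.admissible m k := by
  intro v hv
  refine ⟨(smoothTests_le_finiteNorm (k := k) hv).1, fun _ => v, fun _ => hv, ?_⟩
  have h1 : P.normSq m k (v - v) = 0 := by
    have := normSq_smul (P := P) (m := m) (k := k) (u := v) 0
    rw [zero_smul, zero_pow two_ne_zero, ENNReal.ofReal_zero, zero_mul] at this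
    rw [sub_self, this]
  simp only [h1]
  exact tendsto_const_nhds

theorem admissible_le_finiteNorm : P.admissible m k ≤ P.finiteNorm m k := by
  rintro u ⟨hu, v, hv, hvt⟩
  obtain ⟨n, hn⟩ := (hvt.eventually (gt_mem_nhds zero_lt_one)).exists
  have hvn := smoothTests_le_finiteNorm (k := k) (hv n)
  have h1 := Submodule.add_mem _
    (mem_finiteNorm_of_normSq_ne_top (hu.sub hvn.1) (ne_top_of_lt hn)) hvn
  rwa [sub_add_cancel] at h1

/-- The closure is closed: each `w n` is replaced by a smooth displacement within `1 / (n + 1)`.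
This is how the axis conditions survive in limits of minimizing sequences. -/
theorem mem_admissible_of_tendsto {w : ℕ → Displacement} (hv : v ∈ P.finiteNorm m k)
    (hw : ∀ n, w n ∈ P.admissible m k)
    (h : Tendsto (fun n => P.nrm m k (v - w n)) atTop (𝓝 0)) : v ∈ P.admissible m k := by
  have h1 : ∀ n : ℕ, ∃ t ∈ smoothTests P.r₀ m,
      P.normSq m k (w n - t) ≤ ENNReal.ofReal (1 / (n + 1)) := by
    intro n
    obtain ⟨-, t, ht, htt⟩ := hw n
    have h2 : (0 : ENNReal) < ENNReal.ofReal (1 / (n + 1)) :=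
      ENNReal.ofReal_pos.mpr (by positivity)
    obtain ⟨j, hj⟩ := (htt.eventually (ge_mem_nhds h2)).exists
    exact ⟨t j, ht j, hj⟩
  choose t ht htn using h1
  refine ⟨hv.1, t, ht, ?_⟩
  have hw' := fun n => admissible_le_finiteNorm (hw n)
  have h2 : Tendsto (fun n => ENNReal.ofReal (2 * P.nrm m k (v - w n) + 2 * (1 / ((n : ℝ) + 1))))
      atTop (𝓝 0) := by
    have := (h.const_mul 2).add ((tendsto_one_div_add_atTop_nhds_zero_nat (𝕜 := ℝ)).const_mul 2)
    rw [mul_zero, add_zero] at this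
    simpa using ENNReal.tendsto_ofReal this
  refine tendsto_of_tendsto_of_tendsto_of_le_of_le tendsto_const_nhds h2 (fun _ => zero_le)
    fun n => ?_
  have hd := Submodule.sub_mem _ hv (hw' n)
  have h3 := normSq_add_le (m := m) (k := k) hd.1
    ((hw' n).1.sub (smoothTests_le_finiteNorm (k := k) (ht n)).1)
  rw [sub_add_sub_cancel] at h3
  refine h3.trans ?_
  have hN : 0 ≤ P.nrm m k (v - w n) := nrm_nonneg
  rw [ENNReal.ofReal_add (by positivity) (by positivity), ENNReal.ofReal_mul zero_le_two,
    ENNReal.ofReal_mul zero_le_two, ENNReal.ofReal_ofNat, normSq_eq_ofReal_nrm hd]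
  gcongr
  exact htn n

end ZPinch

/-! ### The vacuum fields -/

namespace ZPinch

variable (P : ZPinch)

/-- The vacuum part of `E` as a function of the value and the derivative of the field. -/
noncomputable def vacForm (m k : ℤ) (r a b : ℝ) : ℝ :=
  (a ^ 2 + 1 / (m ^ 2 + k ^ 2 * r ^ 2) * (a + r * b) ^ 2) * r

/-- The square of the norm of `H¹(r₀, r_w)`. -/
noncomputable def sob (Q : ℝ → ℝ) : ℝ := ∫ r in Ioo P.r₀ P.r_w, (Q r ^ 2 + deriv Q r ^ 2)

/-- The vacuum energy. -/
noncomputable def vac (m k : ℤ) (Q : ℝ → ℝ) : ℝ :=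
  ∫ r in Ioo P.r₀ P.r_w, vacForm m k r (Q r) (deriv Q r)

variable {P} {m k : ℤ} {Q R : ℝ → ℝ}

theorem ae_differentiableAt_of_AC (hQ : AbsolutelyContinuousOnInterval Q P.r₀ P.r_w) :
    ∀ᵐ r ∂volume.restrict (Ioo P.r₀ P.r_w), DifferentiableAt ℝ Q r := by
  filter_upwards [ae_restrict_of_ae hQ.ae_differentiableAt, ae_restrict_mem measurableSet_Ioo]
    with r h hr
  exact h (by rw [uIcc_of_le P.r₀_lt_r_w.le]; exact Ioo_subset_Icc_self hr)

theorem deriv_add_ae (hQ : AbsolutelyContinuousOnInterval Q P.r₀ P.r_w)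
    (hR : AbsolutelyContinuousOnInterval R P.r₀ P.r_w) :
    ∀ᵐ r ∂volume.restrict (Ioo P.r₀ P.r_w), deriv (Q + R) r = deriv Q r + deriv R r ∧
      deriv (Q - R) r = deriv Q r - deriv R r := by
  filter_upwards [ae_differentiableAt_of_AC hQ, ae_differentiableAt_of_AC hR] with r h1 h2
  exact ⟨deriv_add h1 h2, deriv_sub h1 h2⟩

variable (P) in
/-- The vacuum fields that vanish at the outer wall. -/
noncomputable def vacFields : Submodule ℝ (ℝ → ℝ) where
  carrier := {Q | Q ∈ P.H1Vac ∧ Q P.r_w = 0}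
  add_mem' := by
    rintro Q R ⟨⟨hQ, hQ2⟩, hQ0⟩ ⟨⟨hR, hR2⟩, hR0⟩
    refine ⟨⟨hQ.add hR, (hQ2.add hR2).ae_eq ?_⟩, by rw [Pi.add_apply, hQ0, hR0, add_zero]⟩
    filter_upwards [deriv_add_ae hQ hR] with r h
    exact h.1.symm
  zero_mem' := by
    refine ⟨⟨(LipschitzWith.const (0 : ℝ)).lipschitzOnWith.absolutelyContinuousOnInterval, ?_⟩, rfl⟩
    have : deriv (0 : ℝ → ℝ) = 0 := by funext r; exact deriv_const r 0
    rw [this]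
    exact MemLp.zero
  smul_mem' := by
    rintro c Q ⟨⟨hQ, hQ2⟩, hQ0⟩
    refine ⟨⟨hQ.const_smul c, ?_⟩, by rw [Pi.smul_apply, hQ0, smul_zero]⟩
    have : deriv (c • Q) = c • deriv Q := by funext r; exact deriv_const_smul_field c Q
    rw [this]
    exact hQ2.const_smul c

theorem integrableOn_sob (hQ : Q ∈ P.vacFields) :
    IntegrableOn (fun r => Q r ^ 2 + deriv Q r ^ 2) (Ioo P.r₀ P.r_w) := by
  have h1 : ContinuousOn Q (Icc P.r₀ P.r_w) := by
    have := hQ.1.1.continuousOn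
    rwa [uIcc_of_le P.r₀_lt_r_w.le] at this
  exact ((h1.pow 2).integrableOn_Icc.mono_set Ioo_subset_Icc_self).add hQ.1.2.integrable_sq

theorem mem_vacFields_of_integrableOn (hQ : AbsolutelyContinuousOnInterval Q P.r₀ P.r_w)
    (h0 : Q P.r_w = 0) (h : IntegrableOn (fun r => Q r ^ 2 + deriv Q r ^ 2) (Ioo P.r₀ P.r_w)) :
    Q ∈ P.vacFields := by
  refine ⟨⟨hQ, ?_⟩, h0⟩
  have hm := (measurable_deriv Q).aestronglyMeasurable (μ := volume.restrict (Ioo P.r₀ P.r_w))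
  rw [memLp_two_iff_integrable_sq hm]
  refine h.mono' (hm.pow 2) (Eventually.of_forall fun r => ?_)
  rw [Real.norm_eq_abs, abs_of_nonneg (sq_nonneg _)]
  exact le_add_of_nonneg_left (sq_nonneg _)

theorem aestronglyMeasurable_of_AC (hQ : AbsolutelyContinuousOnInterval Q P.r₀ P.r_w) :
    AEStronglyMeasurable Q (volume.restrict (Ioo P.r₀ P.r_w)) := by
  have h1 := hQ.continuousOn
  rw [uIcc_of_le P.r₀_lt_r_w.le] at h1
  exact (h1.mono Ioo_subset_Icc_self).aestronglyMeasurable measurableSet_Ioo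

theorem sob_nonneg : 0 ≤ P.sob Q :=
  MeasureTheory.integral_nonneg fun r => by
    change 0 ≤ Q r ^ 2 + deriv Q r ^ 2
    positivity

theorem vac_smul (c : ℝ) : P.vac m k (c • Q) = c ^ 2 * P.vac m k Q := by
  have h1 : deriv (c • Q) = c • deriv Q := by funext r; exact deriv_const_smul_field c Q
  rw [vac, vac, ← integral_const_mul, h1]
  simp only [Pi.smul_apply, smul_eq_mul, vacForm]
  congr 1
  funext r
  ring

variable (P) in
-- On `(r₀, r_w)` the radius is bounded away from zero, and `r * b` is recovered as the difference
-- of `a + r * b` and `a`; so the vacuum energy is equivalent to the `H¹` norm.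
theorem exists_vacForm_bounds (hm : m ≠ 0) (k : ℤ) : ∃ c > 0, ∃ C, ∀ r ∈ Ioo P.r₀ P.r_w, ∀ a b,
    c * (a ^ 2 + b ^ 2) ≤ vacForm m k r a b ∧ vacForm m k r a b ≤ C * (a ^ 2 + b ^ 2) := by
  have hr0 := P.r₀_pos
  have hm1 : (1 : ℝ) ≤ (m : ℝ) ^ 2 := by
    have : (1 : ℤ) ≤ m ^ 2 := by
      have : 0 < m ^ 2 := by positivity
      omega
    exact_mod_cast this
  have hrw : 0 < P.r_w := hr0.trans P.r₀_lt_r_w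
  set q₁ : ℝ := m ^ 2 + k ^ 2 * P.r_w ^ 2 with hq1
  have hq1pos : 0 < q₁ := by positivity
  set K := (1 + 2 / P.r₀ ^ 2) / P.r₀ + 2 * q₁ / P.r₀ ^ 3 with hK
  have hKpos : 0 < K := by positivity
  refine ⟨1 / K, by positivity, (3 + 2 * P.r_w ^ 2) * P.r_w, fun r hr a b => ?_⟩
  have hrp : 0 < r := hr0.trans hr.1
  set q : ℝ := m ^ 2 + k ^ 2 * r ^ 2 with hq
  have hqge : 1 ≤ q := by
    have : 0 ≤ (k : ℝ) ^ 2 * r ^ 2 := by positivity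
    linarith
  have hqpos : 0 < q := by linarith
  have hrr : r ^ 2 ≤ P.r_w ^ 2 := pow_le_pow_left₀ hrp.le hr.2.le 2
  have hqle : q ≤ q₁ := by
    have := mul_le_mul_of_nonneg_left hrr (sq_nonneg (k : ℝ))
    linarith
  have e : vacForm m k r a b = a ^ 2 * r + (a + r * b) ^ 2 / q * r := by
    rw [vacForm, ← hq]; ring
  have hr2 : P.r₀ ^ 2 ≤ r ^ 2 := pow_le_pow_left₀ hr0.le hr.1.le 2
  constructor
  · rw [one_div_mul_eq_div, div_le_iff₀ hKpos, e]
    have h1 : b ^ 2 ≤ 2 / P.r₀ ^ 2 * ((a + r * b) ^ 2 + a ^ 2) := by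
      rw [div_mul_eq_mul_div, le_div_iff₀ (by positivity)]
      have h2 : b ^ 2 * P.r₀ ^ 2 ≤ b ^ 2 * r ^ 2 := mul_le_mul_of_nonneg_left hr2 (sq_nonneg b)
      nlinarith only [h2, sq_nonneg (2 * a + r * b)]
    have h3 : a ^ 2 ≤ a ^ 2 * r / P.r₀ := by
      rw [le_div_iff₀ hr0]; exact mul_le_mul_of_nonneg_left hr.1.le (sq_nonneg a)
    have h4 : (a + r * b) ^ 2 ≤ q₁ * ((a + r * b) ^ 2 / q * r) / P.r₀ := by
      rw [le_div_iff₀ hr0]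
      have h5 : (a + r * b) ^ 2 ≤ q₁ * ((a + r * b) ^ 2 / q) := by
        rw [← mul_div_assoc, le_div_iff₀ hqpos, mul_comm]
        exact mul_le_mul_of_nonneg_right hqle (sq_nonneg _)
      calc (a + r * b) ^ 2 * P.r₀ ≤ q₁ * ((a + r * b) ^ 2 / q) * r :=
            mul_le_mul h5 hr.1.le hr0.le (by positivity)
        _ = _ := by ring
    set X := a ^ 2 * r with hX
    set Y := (a + r * b) ^ 2 / q * r with hY
    have hX0 : 0 ≤ X := by positivity
    have hY0 : 0 ≤ Y := by positivity
    have h6 : 2 / P.r₀ ^ 2 * ((a + r * b) ^ 2 + a ^ 2)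
        ≤ 2 / P.r₀ ^ 2 * (q₁ * Y / P.r₀ + X / P.r₀) :=
      mul_le_mul_of_nonneg_left (add_le_add h4 h3) (by positivity)
    have h7 : 2 / P.r₀ ^ 2 * (q₁ * Y / P.r₀ + X / P.r₀) + X / P.r₀
        = (1 + 2 / P.r₀ ^ 2) / P.r₀ * X + 2 * q₁ / P.r₀ ^ 3 * Y := by
      field_simp
      ring
    have h8 : 0 ≤ (1 + 2 / P.r₀ ^ 2) / P.r₀ * Y := by positivity
    have h9 : 0 ≤ 2 * q₁ / P.r₀ ^ 3 * X := by positivity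
    have h10 : (X + Y) * K = (1 + 2 / P.r₀ ^ 2) / P.r₀ * X + 2 * q₁ / P.r₀ ^ 3 * Y
      + (1 + 2 / P.r₀ ^ 2) / P.r₀ * Y + 2 * q₁ / P.r₀ ^ 3 * X := by rw [hK]; ring
    linarith
  · rw [e]
    have h1 : (a + r * b) ^ 2 / q ≤ (a + r * b) ^ 2 := div_le_self (sq_nonneg _) hqge
    have h2 : (a + r * b) ^ 2 ≤ 2 * a ^ 2 + 2 * P.r_w ^ 2 * b ^ 2 := by
      have := mul_le_mul_of_nonneg_right hrr (sq_nonneg b)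
      nlinarith only [this, sq_nonneg (a - r * b)]
    have h3 : a ^ 2 + (a + r * b) ^ 2 / q ≤ (3 + 2 * P.r_w ^ 2) * (a ^ 2 + b ^ 2) := by
      have h4 : 0 ≤ P.r_w ^ 2 * a ^ 2 := by positivity
      linarith [sq_nonneg b]
    calc a ^ 2 * r + (a + r * b) ^ 2 / q * r = (a ^ 2 + (a + r * b) ^ 2 / q) * r := by ring
      _ ≤ (3 + 2 * P.r_w ^ 2) * (a ^ 2 + b ^ 2) * P.r_w :=
        mul_le_mul h3 hr.2.le hrp.le (by positivity)
      _ = _ := by ring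

theorem integrableOn_vacForm (hm : m ≠ 0) (hQ : Q ∈ P.vacFields) :
    IntegrableOn (fun r => vacForm m k r (Q r) (deriv Q r)) (Ioo P.r₀ P.r_w) := by
  obtain ⟨c, hc, C, H⟩ := P.exists_vacForm_bounds hm k
  have h1 := (aestronglyMeasurable_of_AC hQ.1.1).aemeasurable
  have h2 := (measurable_deriv Q).aemeasurable (μ := volume.restrict (Ioo P.r₀ P.r_w))
  have h3 : AEMeasurable (fun r => vacForm m k r (Q r) (deriv Q r))
      (volume.restrict (Ioo P.r₀ P.r_w)) := by unfold vacForm; fun_prop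
  refine ((integrableOn_sob hQ).const_mul C).mono' h3.aestronglyMeasurable ?_
  filter_upwards [ae_restrict_mem measurableSet_Ioo] with r hr
  obtain ⟨h4, h5⟩ := H r hr (Q r) (deriv Q r)
  rw [Real.norm_eq_abs, abs_of_nonneg (le_trans (by positivity) h4)]
  exact h5

variable (P) in
theorem exists_vac_bounds (hm : m ≠ 0) (k : ℤ) : ∃ c > 0, ∃ C, ∀ Q ∈ P.vacFields,
    c * P.sob Q ≤ P.vac m k Q ∧ P.vac m k Q ≤ C * P.sob Q := by
  obtain ⟨c, hc, C, H⟩ := P.exists_vacForm_bounds hm k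
  refine ⟨c, hc, C, fun Q hQ => ?_⟩
  rw [sob, vac, ← integral_const_mul, ← integral_const_mul]
  exact ⟨setIntegral_mono_on ((integrableOn_sob hQ).const_mul c) (integrableOn_vacForm hm hQ)
      measurableSet_Ioo fun r hr => (H r hr _ _).1,
    setIntegral_mono_on (integrableOn_vacForm hm hQ) ((integrableOn_sob hQ).const_mul C)
      measurableSet_Ioo fun r hr => (H r hr _ _).2⟩

theorem vac_parallelogram (hm : m ≠ 0) (hQ : Q ∈ P.vacFields) (hR : R ∈ P.vacFields) :
    P.vac m k (Q + R) + P.vac m k (Q - R) = 2 * P.vac m k Q + 2 * P.vac m k R := by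
  rw [vac, vac, vac, vac, ← integral_add
    (integrableOn_vacForm hm (Submodule.add_mem _ hQ hR))
    (integrableOn_vacForm hm (Submodule.sub_mem _ hQ hR)), ← integral_const_mul,
    ← integral_const_mul, ← integral_add ((integrableOn_vacForm hm hQ).const_mul 2)
      ((integrableOn_vacForm hm hR).const_mul 2)]
  refine integral_congr_ae ?_
  filter_upwards [deriv_add_ae hQ.1.1 hR.1.1] with r ⟨h1, h2⟩
  rw [h1, h2]
  simp only [vacForm, Pi.add_apply, Pi.sub_apply]
  ring

/-- The field vanishes at the wall, so integration of the derivative from there bounds it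
everywhere, in particular at the interface. -/
theorem abs_le_of_sob_le {M : ℝ} (hM : 0 < M) (hQ : Q ∈ P.vacFields) (h : P.sob Q ≤ M ^ 2) :
    ∫ r in Ioo P.r₀ P.r_w, |deriv Q r| ≤ (1 + (P.r_w - P.r₀)) * M ∧
    ∀ x ∈ Icc P.r₀ P.r_w, |Q x| ≤ (1 + (P.r_w - P.r₀)) * M := by
  have hlt := P.r₀_lt_r_w
  have hS := integrableOn_sob hQ
  have hcst : IntegrableOn (fun _ : ℝ => M) (Ioo P.r₀ P.r_w) :=
    integrableOn_const measure_Ioo_lt_top.ne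
  have hle : ∀ r, |deriv Q r| ≤ 1 / M * (Q r ^ 2 + deriv Q r ^ 2) + M := by
    intro r
    have h1 := two_mul_abs_le (x := deriv Q r) (θ := 1 / M) (r := 1) (by positivity) one_pos
    rw [mul_one, mul_one, one_div_one_div] at h1
    have h2 : 0 ≤ 1 / M * Q r ^ 2 := by positivity
    linarith
  have hI : ∫ r in Ioo P.r₀ P.r_w, (1 / M * (Q r ^ 2 + deriv Q r ^ 2) + M)
      ≤ (1 + (P.r_w - P.r₀)) * M := by
    rw [integral_add (hS.const_mul _) hcst, integral_const_mul, setIntegral_const, smul_eq_mul,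
      measureReal_def, Real.volume_Ioo, ENNReal.toReal_ofReal (sub_nonneg.mpr hlt.le)]
    have h1 : 1 / M * ∫ r in Ioo P.r₀ P.r_w, (Q r ^ 2 + deriv Q r ^ 2) ≤ M := by
      rw [one_div_mul_eq_div, div_le_iff₀ hM]
      rw [sob] at h
      nlinarith
    linarith
  refine ⟨(integral_mono_of_nonneg (Eventually.of_forall fun _ => abs_nonneg _)
    ((hS.const_mul _).add hcst) (Eventually.of_forall hle)).trans hI, fun x hx => ?_⟩
  have hE : IntegrableOn (fun r => 1 / M * (Q r ^ 2 + deriv Q r ^ 2) + M) (Ioo P.r₀ P.r_w) :=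
    (hS.const_mul (1 / M)).add hcst
  have h1 := hQ.1.1.abs_sub_le hE (Eventually.of_forall hle) hx.1 hx.2 le_rfl
  rw [hQ.2, zero_sub, abs_neg] at h1
  refine h1.trans (le_trans ?_ hI)
  refine setIntegral_mono_set hE (Eventually.of_forall fun r => ?_)
    (Ioo_subset_Ioo hx.1 le_rfl).eventuallyLE
  change 0 ≤ 1 / M * (Q r ^ 2 + deriv Q r ^ 2) + M
  positivity

/-- The vacuum fields that vanish at the wall form a complete space. -/
theorem exists_sob_limit (Q : ℕ → ℝ → ℝ) (hQ : ∀ n, Q n ∈ P.vacFields)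
    (hc : Tendsto (fun q : ℕ × ℕ => P.sob (Q q.1 - Q q.2)) atTop (𝓝 0)) :
    ∃ R ∈ P.vacFields, ∃ φ : ℕ → ℕ, StrictMono φ ∧
      Tendsto (fun n => P.sob (R - Q (φ n))) atTop (𝓝 0) ∧
      Tendsto (fun n => Q (φ n) P.r₀) atTop (𝓝 (R P.r₀)) := by
  have hlt := P.r₀_lt_r_w
  obtain ⟨φ, hφ, hφN⟩ := extraction_forall_of_eventually'
    (P := fun n K => ∀ i j, K ≤ i → K ≤ j → P.sob (Q i - Q j) ≤ (1 / 4) ^ n) fun n => by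
      have h1 := hc.eventually (ge_mem_nhds (show (0 : ℝ) < (1 / 4) ^ n by positivity))
      obtain ⟨⟨a, b⟩, hab⟩ := eventually_atTop.mp h1
      refine ⟨max a b, fun K hK i j hi hj => ?_⟩
      exact hab (i, j) ⟨(le_max_left a b).trans (hK.trans hi), (le_max_right a b).trans (hK.trans hj)⟩
  set w := fun n => Q (φ n) with hw
  have hwm : ∀ n, w n ∈ P.vacFields := fun n => hQ _
  have hwd : ∀ i j, w i - w j ∈ P.vacFields := fun i j => Submodule.sub_mem _ (hwm i) (hwm j)
  have hwN : ∀ N i j, N ≤ i → N ≤ j → P.sob (w i - w j) ≤ ((1 / 2) ^ N) ^ 2 := by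
    intro N i j hi hj
    refine (hφN N (φ i) (φ j) (hφ.monotone hi) (hφ.monotone hj)).trans (le_of_eq ?_)
    rw [← pow_mul, mul_comm N 2, pow_mul]; norm_num
  have hpos : ∀ N : ℕ, (0 : ℝ) < (1 / 2) ^ N := fun N => by positivity
  have hpt : ∀ r, ∃ l, r ∈ Icc P.r₀ P.r_w → Tendsto (fun n => w n r) atTop (𝓝 l) := by
    intro r
    by_cases hr : r ∈ Icc P.r₀ P.r_w
    swap
    · exact ⟨0, fun h => absurd h hr⟩
    have : CauchySeq fun n => w n r := by
      refine cauchySeq_of_le_tendsto_0 (fun N => (1 + (P.r_w - P.r₀)) * (1 / 2) ^ N)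
        (fun i j N hi hj => ?_) ?_
      · rw [Real.dist_eq]
        exact (abs_le_of_sob_le (hpos N) (hwd i j) (hwN N i j hi hj)).2 r hr
      · have := (tendsto_pow_atTop_nhds_zero_of_lt_one (r := (1 / 2 : ℝ)) (by norm_num)
          (by norm_num)).const_mul (1 + (P.r_w - P.r₀))
        simpa using this
    obtain ⟨l, hl⟩ := cauchySeq_tendsto_of_complete this
    exact ⟨l, fun _ => hl⟩
  choose R hR using hpt
  obtain ⟨hRAC, hRd⟩ := AbsolutelyContinuousOnInterval.of_tendsto (K := 1 + (P.r_w - P.r₀)) hlt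
    (fun n => (hwm n).1.1) hR fun N i j hi hj => by
      refine le_trans (le_of_eq ?_)
        (abs_le_of_sob_le (hpos N) (hwd i j) (hwN N i j hi hj)).1
      refine integral_congr_ae ?_
      filter_upwards [deriv_add_ae (hwm i).1.1 (hwm j).1.1] with r h
      rw [h.2]
  have hRw : R P.r_w = 0 := by
    refine tendsto_nhds_unique (hR P.r_w ⟨hlt.le, le_rfl⟩) ?_
    refine tendsto_const_nhds.congr fun n => (hwm n).2.symm
  have hsm : ∀ {T : ℝ → ℝ}, AbsolutelyContinuousOnInterval T P.r₀ P.r_w →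
      AEMeasurable (fun r => T r ^ 2 + deriv T r ^ 2) (volume.restrict (Ioo P.r₀ P.r_w)) := by
    intro T hT
    have h1 := (aestronglyMeasurable_of_AC hT).aemeasurable
    have h2 := (measurable_deriv T).aemeasurable (μ := volume.restrict (Ioo P.r₀ P.r_w))
    fun_prop
  have hofReal : ∀ i j, ∫⁻ r in Ioo P.r₀ P.r_w,
      ENNReal.ofReal ((w i - w j) r ^ 2 + deriv (w i - w j) r ^ 2)
        = ENNReal.ofReal (P.sob (w i - w j)) := fun i j => by
    rw [sob, ofReal_integral_eq_lintegral_ofReal (integrableOn_sob (hwd i j))]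
    exact Eventually.of_forall fun r => by
      change 0 ≤ (w i - w j) r ^ 2 + deriv (w i - w j) r ^ 2
      positivity
  -- Fatou's lemma, as for the plasma displacements.
  have hnorm : ∀ n, ∫⁻ r in Ioo P.r₀ P.r_w,
      ENNReal.ofReal ((R - w n) r ^ 2 + deriv (R - w n) r ^ 2)
        ≤ ENNReal.ofReal (((1 / 2) ^ n) ^ 2) := by
    intro n
    have h1 : ∀ᵐ r ∂volume.restrict (Ioo P.r₀ P.r_w), ∀ i,
        deriv (w i - w n) r = deriv (w i) r - deriv (w n) r :=
      ae_all_iff.mpr fun i => (deriv_add_ae (hwm i).1.1 (hwm n).1.1).mono fun r h => h.2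
    have h2 : ∫⁻ r in Ioo P.r₀ P.r_w,
        ENNReal.ofReal ((R - w n) r ^ 2 + deriv (R - w n) r ^ 2) ≤ ∫⁻ r in Ioo P.r₀ P.r_w,
        liminf (fun i => ENNReal.ofReal ((w i - w n) r ^ 2 + deriv (w i - w n) r ^ 2)) atTop := by
      refine lintegral_mono_ae ?_
      filter_upwards [hRd, h1, deriv_add_ae hRAC (hwm n).1.1, ae_restrict_mem measurableSet_Ioo]
        with r e1 e2 e3 hr
      refine le_of_eq (Tendsto.liminf_eq ?_).symm
      refine ENNReal.tendsto_ofReal ?_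
      simp only [e2, e3.2, Pi.sub_apply]
      exact (((hR r (Ioo_subset_Icc_self hr)).sub_const _).pow 2).add ((e1.sub_const _).pow 2)
    refine h2.trans ((lintegral_liminf_le' fun i =>
      (hsm (hwd i n).1.1).ennreal_ofReal).trans ?_)
    refine liminf_le_of_frequently_le' (Eventually.frequently ?_)
    filter_upwards [eventually_ge_atTop n] with i hi
    rw [hofReal]
    exact ENNReal.ofReal_le_ofReal (hwN n i n hi le_rfl)
  have hvw : ∀ n, R - w n ∈ P.vacFields := by
    intro n
    have hAC := hRAC.sub (hwm n).1.1
    refine mem_vacFields_of_integrableOn hAC (by rw [Pi.sub_apply, hRw, (hwm n).2, sub_zero])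
      ⟨(hsm hAC).aestronglyMeasurable, ?_⟩
    rw [hasFiniteIntegral_iff_ofReal (Eventually.of_forall fun r => by
      change 0 ≤ (R - w n) r ^ 2 + deriv (R - w n) r ^ 2
      positivity)]
    exact lt_of_le_of_lt (hnorm n) ENNReal.ofReal_lt_top
  have hRm : R ∈ P.vacFields := by
    have := Submodule.add_mem _ (hvw 0) (hwm 0)
    rwa [sub_add_cancel] at this
  refine ⟨R, hRm, φ, hφ, ?_, hR P.r₀ ⟨le_rfl, hlt.le⟩⟩
  have hlim : Tendsto (fun n : ℕ => (((1 / 2 : ℝ)) ^ n) ^ 2) atTop (𝓝 0) := by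
    have := (tendsto_pow_atTop_nhds_zero_of_lt_one (r := (1 / 2 : ℝ)) (by norm_num)
      (by norm_num)).pow 2
    simpa using this
  refine squeeze_zero (fun _ => sob_nonneg) (fun n => ?_) hlim
  have := hnorm n
  rw [← ofReal_integral_eq_lintegral_ofReal (integrableOn_sob (hvw n))
    (Eventually.of_forall fun r => by
      change 0 ≤ (R - w n) r ^ 2 + deriv (R - w n) r ^ 2
      positivity)] at this
  exact (ENNReal.ofReal_le_ofReal_iff (by positivity)).mp this

end ZPinch

/-! ### The Gårding inequality and the existence of minimizers -/

/-- The defect is `(t * a - b) ^ 2 / t`. As `t → 0` the leading constant tends to 1, which is what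
keeps the constraint `J = 1` in the limit. -/
theorem add_sq_le_of_pos (a b : ℝ) {t : ℝ} (ht : 0 < t) :
    (a + b) ^ 2 ≤ (1 + t) * a ^ 2 + (1 + 1 / t) * b ^ 2 := by
  have h1 : (1 + t) * a ^ 2 + (1 + 1 / t) * b ^ 2 - (a + b) ^ 2 = (t * a - b) ^ 2 / t := by
    field_simp
    ring
  have h2 : 0 ≤ (t * a - b) ^ 2 / t := by positivity
  linarith

namespace ZPinch

variable {P : ZPinch} {m k : ℤ} {u v : Displacement}

theorem J_nonneg : 0 ≤ P.J u := by
  rw [J_eq]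
  exact mul_nonneg (by positivity)
    (setIntegral_nonneg measurableSet_Ioo fun r hr => P.kin_nonneg u hr)

theorem J_smul (c : ℝ) : P.J (c • u) = c ^ 2 * P.J u := by
  have := P.isJetForm_jetKin.integral_smul (b := P.r₀) (c := c) (u := u)
  rw [J_eq, J_eq]
  change 2 * Real.pi ^ 2 * (∫ r in Ioo 0 P.r₀, P.jetKin r ((c • u).jet r))
    = c ^ 2 * (2 * Real.pi ^ 2 * ∫ r in Ioo 0 P.r₀, P.jetKin r (u.jet r))
  rw [this]
  ring

theorem J_parallelogram (hu : u ∈ P.finiteNorm m k) (hv : v ∈ P.finiteNorm m k) :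
    P.J (u + v) + P.J (u - v) = 2 * P.J u + 2 * P.J v := by
  have := P.isJetForm_jetKin.integral_parallelogram hu.1 hv.1 (integrableOn_kin hu)
    (integrableOn_kin hv) (integrableOn_kin (Submodule.add_mem _ hu hv))
    (integrableOn_kin (Submodule.sub_mem _ hu hv))
  change (∫ r in Ioo 0 P.r₀, P.kin (u + v) r) + (∫ r in Ioo 0 P.r₀, P.kin (u - v) r)
    = 2 * (∫ r in Ioo 0 P.r₀, P.kin u r) + 2 * ∫ r in Ioo 0 P.r₀, P.kin v r at this
  rw [J_eq, J_eq, J_eq, J_eq]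
  linear_combination (2 * Real.pi ^ 2) * this

theorem J_add_le (hu : u ∈ P.finiteNorm m k) (hv : v ∈ P.finiteNorm m k) {t : ℝ} (ht : 0 < t) :
    P.J (u + v) ≤ (1 + t) * P.J u + (1 + 1 / t) * P.J v := by
  have h1 : ∫ r in Ioo 0 P.r₀, P.kin (u + v) r
      ≤ ∫ r in Ioo 0 P.r₀, ((1 + t) * P.kin u r + (1 + 1 / t) * P.kin v r) := by
    refine setIntegral_mono_on (integrableOn_kin (Submodule.add_mem _ hu hv))
      (((integrableOn_kin hu).const_mul _).add ((integrableOn_kin hv).const_mul _))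
      measurableSet_Ioo fun r hr => ?_
    have h2 : 0 ≤ P.ρ r * r := mul_nonneg (P.ρ_nonneg (Ioo_subset_Icc_self hr)) hr.1.le
    have h3 := add_sq_le_of_pos (u.ξ r) (v.ξ r) ht
    have h4 := add_sq_le_of_pos (u.η r) (v.η r) ht
    have h5 := add_sq_le_of_pos (u.ζ r) (v.ζ r) ht
    have h6 := mul_le_mul_of_nonneg_left (add_le_add (add_le_add h3 h4) h5) h2
    simp only [kin, Displacement.add_ξ, Displacement.add_η, Displacement.add_ζ, Pi.add_apply]
    linarith
  rw [integral_add ((integrableOn_kin hu).const_mul _) ((integrableOn_kin hv).const_mul _),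
    integral_const_mul, integral_const_mul] at h1
  have h2 := mul_le_mul_of_nonneg_left h1 (by positivity : 0 ≤ 2 * Real.pi ^ 2)
  rw [J_eq, J_eq, J_eq]
  linarith

theorem integral_kin_le_nrm (hu : u ∈ P.finiteNorm m k) :
    ∫ r in Ioo 0 P.r₀, P.kin u r ≤ P.nrm m k u :=
  setIntegral_mono_on (integrableOn_kin hu) hu.2 measurableSet_Ioo
    fun _ hr => P.kin_le_dens m k u hr

theorem J_pos_of_ne_zero (hu : u ∈ P.finiteNorm m k) {a b : ℝ} (hab : a < b)
    (hs : Ioo a b ⊆ Ioo 0 P.r₀) (h : ∀ r ∈ Ioo a b, u.ξ r ≠ 0) : 0 < P.J u := by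
  rw [J_eq]
  refine mul_pos (by positivity) ?_
  have h1 : 0 < ∫ r in Ioo a b, P.kin u r := by
    have h2 := intervalIntegral.intervalIntegral_pos_of_pos_on (f := P.kin u) (a := a) (b := b)
      ((intervalIntegrable_iff_integrableOn_Ioo_of_le hab.le).mpr
        ((integrableOn_kin hu).mono_set hs)) (fun r hr => ?_) hab
    · rwa [intervalIntegral.integral_of_le hab.le, integral_Ioc_eq_integral_Ioo] at h2
    · have hr' := hs hr
      have h3 := P.ρ_pos ⟨hr'.1.le, hr'.2⟩
      have h4 := hr'.1
      have h5 : 0 < u.ξ r ^ 2 := by have := h r hr; positivity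
      unfold kin
      positivity
  refine h1.trans_le (setIntegral_mono_set (integrableOn_kin hu) ?_ hs.eventuallyLE)
  filter_upwards [ae_restrict_mem measurableSet_Ioo] with r hr using P.kin_nonneg u hr

variable (P) in
theorem exists_smoothTest_J_pos (m k : ℤ) :
    ∃ u ∈ smoothTests P.r₀ m, u.ξ P.r₀ = 0 ∧ 0 < P.J u := by
  set u : Displacement := ⟨fun r => r * (P.r₀ - r), 0, 0⟩ with hu
  have hum : u ∈ smoothTests P.r₀ m := by
    refine ⟨⟨?_, contDiffOn_const, contDiffOn_const⟩, zero_mul _, fun _ => rfl, rfl⟩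
    exact (contDiff_id.mul (contDiff_const.sub contDiff_id)).contDiffOn
  refine ⟨u, hum, by simp [hu], J_pos_of_ne_zero (m := m) (k := k)
    (smoothTests_le_finiteNorm hum) P.r₀_pos Subset.rfl fun r hr => ?_⟩
  exact mul_ne_zero hr.1.ne' (sub_pos.mpr hr.2).ne'

variable (P) in
/-- A quadratic functional of the jet whose negative part involves only the values of the
displacement satisfies a Gårding inequality. -/
theorem exists_garding {Φ : ℝ → (Fin 6 → ℝ) → ℝ} {c C : ℝ} (m k : ℤ) (hc : 0 < c) (hC : 0 < C)
    (hint : ∀ u ∈ P.finiteNorm m k, IntegrableOn (fun r => Φ r (u.jet r)) (Ioo 0 P.r₀))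
    (hup : ∀ r ∈ Ioo 0 P.r₀, ∀ x : Fin 6 → ℝ,
      Φ r x ≤ C * (jetDensity m k (P.ρ r) r x + (x 0 ^ 2 + x 1 ^ 2 + x 2 ^ 2)))
    (hlow : ∀ r ∈ Ioo 0 P.r₀, ∀ x : Fin 6 → ℝ,
      c * (jetDensity m k (P.ρ r) r x - P.jetKin r x) - C * (x 0 ^ 2 + x 1 ^ 2 + x 2 ^ 2)
        ≤ Φ r x) :
    ∃ C₁ C₂, ∀ u ∈ P.finiteNorm m k, ∫ r in Ioo 0 P.r₀, Φ r (u.jet r) ≤ C₁ * P.nrm m k u ∧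
      c / 2 * P.nrm m k u ≤
        (∫ r in Ioo 0 P.r₀, Φ r (u.jet r)) + C₂ * ∫ r in Ioo 0 P.r₀, P.kin u r := by
  obtain ⟨A, hA, HA⟩ := P.exists_integral_sq_comp_le m k
  -- With this small parameter the indefinite terms consume exactly half of the coercivity constant
  -- `c`.
  obtain ⟨B, hB, HB⟩ := P.exists_integral_sq_le_add m k (show 0 < c / (2 * C) by positivity)
  refine ⟨C * (1 + A), c + C * B, fun u hu => ⟨?_, ?_⟩⟩
  · have h1 := setIntegral_mono_on (hint u hu)
      ((hu.2.add (integrableOn_sq_comp hu)).const_mul C) measurableSet_Ioo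
      fun r hr => hup r hr (u.jet r)
    rw [integral_const_mul, Pi.add_def, integral_add hu.2 (integrableOn_sq_comp hu)] at h1
    have h2 := mul_le_mul_of_nonneg_left (HA u hu) hC.le
    rw [nrm] at h2 ⊢
    linarith
  · have h1 := setIntegral_mono_on
      (((hu.2.sub (integrableOn_kin hu)).const_mul c).sub ((integrableOn_sq_comp hu).const_mul C))
      (hint u hu) measurableSet_Ioo fun r hr => hlow r hr (u.jet r)
    rw [Pi.sub_def, integral_sub ((hu.2.sub (integrableOn_kin hu)).const_mul c)
      ((integrableOn_sq_comp hu).const_mul C), integral_const_mul, integral_const_mul, Pi.sub_def,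
      integral_sub hu.2 (integrableOn_kin hu)] at h1
    have h2 := mul_le_mul_of_nonneg_left (HB u hu) hC.le
    have h3 : C * (c / (2 * C) * P.nrm m k u) = c / 2 * P.nrm m k u := by field_simp
    rw [mul_add, h3] at h2
    have h4 : P.nrm m k u = ∫ r in Ioo 0 P.r₀, P.dens m k u r := rfl
    rw [← h4] at h1
    linarith

theorem E₀_eq {ε δ s : ℝ} (hu : u.IsLocAC P.r₀) : P.E₀ k ε δ s u
    = 2 * Real.pi ^ 2 * (∫ r in Ioo 0 P.r₀, P.jetIdeal₀ k r (u.jet r))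
      + 2 * Real.pi ^ 2 * ∫ r in Ioo 0 P.r₀, jetVisc 0 k (s * ε) (s * δ) r (u.jet r) * r := by
  have h1 : ∫ r in Ioo 0 P.r₀,
      (2 * P.p' r * u.ξ r ^ 2 / r
        + P.Bθ r ^ 2 * (k * u.η r - (deriv (fun x => x * u.ξ x) r - 2 * u.ξ r) / r) ^ 2
        + P.γ * P.p r * (deriv (fun x => x * u.ξ x) r / r - k * u.η r) ^ 2) * r
      = ∫ r in Ioo 0 P.r₀, P.jetIdeal₀ k r (u.jet r) := by
    refine integral_congr_ae ?_
    filter_upwards [hu.ξ.ae_differentiableAt] with r hr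
    rw [Displacement.deriv_mul_ξ hr]
    rfl
  rw [← h1]
  rfl

theorem E_eq {ε δ s : ℝ} {Q : ℝ → ℝ} (hu : u.IsLocAC P.r₀)
    (hQ : AbsolutelyContinuousOnInterval Q P.r₀ P.r_w) : P.E m k ε δ s (u, Q)
    = 2 * Real.pi ^ 2 * (∫ r in Ioo 0 P.r₀, P.jetIdeal m k r (u.jet r))
      + 2 * Real.pi ^ 2 * (∫ r in Ioo 0 P.r₀, jetVisc m k (s * ε) (s * δ) r (u.jet r) * r)
      + 2 * Real.pi ^ 2 * (∫ r in Ioo 0 P.r₀, P.jetBend m k r (u.jet r))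
      + 2 * Real.pi ^ 2 * (∫ r in Ioo 0 P.r₀, P.jetDrive m r (u.jet r))
      + 2 * Real.pi ^ 2 * P.vac m k Q := by
  have h1 : ∫ r in Ioo 0 P.r₀,
      ((m ^ 2 + k ^ 2 * r ^ 2) * (P.Bθ r / r * u.η r
          + (-k * P.Bθ r * deriv (fun x => x * u.ξ x) r + 2 * k * P.Bθ r * u.ξ r)
            / (m ^ 2 + k ^ 2 * r ^ 2)) ^ 2
        + P.γ * P.p r
          * (deriv (fun x => x * u.ξ x) r / r - k * u.η r + m * u.ζ r / r) ^ 2) * r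
      = ∫ r in Ioo 0 P.r₀, P.jetIdeal m k r (u.jet r) := by
    refine integral_congr_ae ?_
    filter_upwards [hu.ξ.ae_differentiableAt] with r hr
    rw [Displacement.deriv_mul_ξ hr]
    rfl
  have h2 : ∫ r in Ioo P.r₀ P.r_w,
      (Q r ^ 2 + 1 / (m ^ 2 + k ^ 2 * r ^ 2) * (deriv (fun x => x * Q x) r) ^ 2) * r
      = P.vac m k Q := by
    refine integral_congr_ae ?_
    filter_upwards [ae_differentiableAt_of_AC hQ] with r hr
    have := (hasDerivAt_id r).mul hr.hasDerivAt
    rw [one_mul] at this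
    have h3 : deriv (fun x => x * Q x) r = Q r + r * deriv Q r := this.deriv
    rw [h3]
    rfl
  rw [← h1, ← h2]
  rfl

theorem E₀_smul {ε δ s : ℝ} (hu : u.IsLocAC P.r₀) (c : ℝ) :
    P.E₀ k ε δ s (c • u) = c ^ 2 * P.E₀ k ε δ s u := by
  rw [E₀_eq hu, E₀_eq (hu.smul c), (P.isJetForm_jetIdeal₀ k).integral_smul,
    (isJetForm_jetVisc 0 k (s * ε) (s * δ)).integral_smul]
  ring

variable (P) in
theorem exists_isMin_E₀ (k : ℤ) {ε δ s : ℝ} (hε : 0 < ε) (hδ : 0 < δ) (hs : 0 < s) :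
    ∃ u ∈ P.admissible 0 k, P.J u = 1 ∧ ∀ v ∈ P.admissible 0 k, P.J v = 1 →
      P.E₀ k ε δ s u ≤ P.E₀ k ε δ s v := by
  have hε' : 0 < s * ε := mul_pos hs hε
  have hδ' : 0 < s * δ := mul_pos hs hδ
  set c := min (2 / 9 * (s * ε)) (s * δ) with hc
  have hcpos : 0 < c := lt_min (by positivity) hδ'
  obtain ⟨A, hA, HA⟩ := P.exists_abs_jetIdeal₀_le k
  have hle := admissible_le_finiteNorm (P := P) (m := 0) (k := k)
  set Φ : ℝ → (Fin 6 → ℝ) → ℝ := fun r x =>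
    P.jetIdeal₀ k r x + jetVisc 0 k (s * ε) (s * δ) r x * r with hΦdef
  have hI := fun u (hu : u ∈ P.finiteNorm 0 k) => integrableOn_jetIdeal₀ hu
  have hV := fun u (hu : u ∈ P.finiteNorm 0 k) => integrableOn_jetVisc hε'.le hδ'.le hu
  have hint : ∀ u ∈ P.finiteNorm 0 k, IntegrableOn (fun r => Φ r (u.jet r)) (Ioo 0 P.r₀) :=
    fun u hu => (hI u hu).add (hV u hu)
  have hΦ : IsJetForm Φ := (P.isJetForm_jetIdeal₀ k).add (isJetForm_jetVisc 0 k (s * ε) (s * δ))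
  have hE : ∀ u ∈ P.finiteNorm 0 k, P.E₀ k ε δ s u
      = 2 * Real.pi ^ 2 * ∫ r in Ioo 0 P.r₀, Φ r (u.jet r) := by
    intro u hu
    rw [E₀_eq hu.1, hΦdef, integral_add (hI u hu) (hV u hu)]
    ring
  obtain ⟨C₁, C₂, HG⟩ := P.exists_garding (Φ := Φ) (c := c) (C := A + (s * ε + s * δ)) 0 k hcpos
    (by positivity) hint (fun r hr x => by
      have hρ := P.ρ_nonneg (Ioo_subset_Icc_self hr)
      have h1 := (le_abs_self _).trans (HA r hr x).1
      have h2 := (jetVisc_mul_le (m := 0) (k := k) (x := x) hε'.le hδ'.le hρ hr.1.le).2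
      have h3 : 0 ≤ (s * ε + s * δ) * (x 0 ^ 2 + x 1 ^ 2 + x 2 ^ 2) := by positivity
      simp only [hΦdef]
      linarith) (fun r hr x => by
      have h1 := (HA r hr x).2
      have h2 := le_jetVisc_mul (m := 0) (k := k) (ρ := P.ρ r) (δ := s * δ) (x := x) hε'.le hr.1.le
      have h3 : 0 ≤ (s * ε + s * δ) * (x 0 ^ 2 + x 1 ^ 2 + x 2 ^ 2) := by positivity
      simp only [hΦdef, jetKin]
      linarith)
  have hπ : 0 < 2 * Real.pi ^ 2 := by positivity
  refine exists_isMin_of_garding (P.admissible 0 k) (P.nrm 0 k) (P.E₀ k ε δ s) P.J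
    (c := 2 * Real.pi ^ 2 * (c / 2)) (C := C₂) (C₁ := 2 * Real.pi ^ 2 * C₁)
    (C₂ := 2 * Real.pi ^ 2) (by positivity) (fun _ _ => nrm_nonneg) (fun _ _ => J_nonneg)
    (fun u hu t => E₀_smul (hle hu).1 t) (fun u _ t => J_smul t) ?_
    (fun u hu v hv => J_parallelogram (hle hu) (hle hv))
    (fun u hu v hv t ht => J_add_le (hle hu) (hle hv) ht) ?_ ?_ ?_ ?_ ?_ ?_
  · intro u hu v hv
    have hu' := hle hu
    have hv' := hle hv
    have ha := Submodule.add_mem _ hu' hv'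
    have hd := Submodule.sub_mem _ hu' hv'
    rw [hE _ ha, hE _ hd, hE _ hu', hE _ hv']
    have := hΦ.integral_parallelogram hu'.1 hv'.1 (hint _ hu') (hint _ hv') (hint _ ha) (hint _ hd)
    linear_combination (2 * Real.pi ^ 2) * this
  · intro u hu
    rw [hE u (hle hu)]
    have := mul_le_mul_of_nonneg_left (HG u (hle hu)).1 hπ.le
    linarith
  · intro u hu
    rw [J_eq]
    exact mul_le_mul_of_nonneg_left (integral_kin_le_nrm (hle hu)) hπ.le
  · intro u hu
    rw [hE u (hle hu), J_eq]
    have := mul_le_mul_of_nonneg_left (HG u (hle hu)).2 hπ.le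
    linarith
  · rintro u hu ⟨B, hB⟩
    exact exists_subseq_J_cauchy u (fun n => hle (hu n)) hB
  · intro u hu hc
    obtain ⟨v, hv, φ, hφ, hlim, -⟩ := exists_nrm_limit u (fun n => hle (hu n)) hc
    exact ⟨v, mem_admissible_of_tendsto hv (fun n => hu (φ n)) hlim, φ, hφ, hlim⟩
  · obtain ⟨u, hu, -, hJ⟩ := P.exists_smoothTest_J_pos 0 k
    exact ⟨u, smoothTests_le_admissible hu, hJ⟩

variable (P) in
theorem exists_isLeast_E₀ (k : ℤ) {ε δ s : ℝ} (hε : 0 < ε) (hδ : 0 < δ) (hs : 0 < s) :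
    ∃ u ∈ P.A₁ k, IsLeast (P.E₀ k ε δ s '' P.A₁ k) (P.E₀ k ε δ s u) := by
  obtain ⟨u, hu, hJ, hmin⟩ := P.exists_isMin_E₀ k hε hδ hs
  have huA : u ∈ P.A₁ k := ⟨mem_X_iff.mpr hu, hJ⟩
  refine ⟨u, huA, mem_image_of_mem _ huA, ?_⟩
  rintro _ ⟨v, ⟨hv, hvJ⟩, rfl⟩
  exact hmin v (mem_X_iff.mp hv) hvJ

variable (P) in
/-- The pairs of a displacement and a vacuum field that satisfy the interface condition. -/
noncomputable def coupled (m k : ℤ) : Submodule ℝ (Displacement × (ℝ → ℝ)) where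
  carrier := {w | w.1 ∈ P.admissible m k ∧ w.2 ∈ P.vacFields ∧
    m * P.BθVac P.r₀ * w.1.ξ P.r₀ = P.r₀ * w.2 P.r₀}
  add_mem' := by
    rintro w z ⟨h1, h2, h3⟩ ⟨h4, h5, h6⟩
    refine ⟨Submodule.add_mem _ h1 h4, Submodule.add_mem _ h2 h5, ?_⟩
    rw [Prod.fst_add, Prod.snd_add, Displacement.add_ξ, Pi.add_apply, Pi.add_apply]
    linear_combination h3 + h6
  zero_mem' := by
    refine ⟨Submodule.zero_mem _, Submodule.zero_mem _, ?_⟩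
    rw [Prod.fst_zero, Prod.snd_zero, Displacement.zero_ξ, Pi.zero_apply, mul_zero, mul_zero]
  smul_mem' := by
    rintro c w ⟨h1, h2, h3⟩
    refine ⟨Submodule.smul_mem _ c h1, Submodule.smul_mem _ c h2, ?_⟩
    rw [Prod.smul_fst, Prod.smul_snd, Displacement.smul_ξ, Pi.smul_apply, Pi.smul_apply,
      smul_eq_mul, smul_eq_mul]
    linear_combination c * h3

theorem mem_A₂_iff (hm : m ≠ 0) {w : Displacement × (ℝ → ℝ)} :
    w ∈ P.A₂ m k ↔ w ∈ P.coupled m k ∧ P.J w.1 = 1 := by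
  constructor
  · rintro ⟨h1, h2, h3, h4, h5⟩
    exact ⟨⟨(mem_Y_iff hm).mp h1, ⟨h2, h5⟩, h4⟩, h3⟩
  · rintro ⟨⟨h1, ⟨h2, h5⟩, h4⟩, h3⟩
    exact ⟨(mem_Y_iff hm).mpr h1, h2, h3, h4, h5⟩

theorem E_smul {ε δ s : ℝ} {w : Displacement × (ℝ → ℝ)} (hw : w ∈ P.coupled m k) (c : ℝ) :
    P.E m k ε δ s (c • w) = c ^ 2 * P.E m k ε δ s w := by
  obtain ⟨u, Q⟩ := w
  have hu : u.IsLocAC P.r₀ := (admissible_le_finiteNorm hw.1).1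
  have hQ : AbsolutelyContinuousOnInterval Q P.r₀ P.r_w := hw.2.1.1.1
  have hcQ : AbsolutelyContinuousOnInterval (c • Q) P.r₀ P.r_w := hQ.const_smul c
  rw [Prod.smul_mk, E_eq hu hQ, E_eq (hu.smul c) hcQ,
    (P.isJetForm_jetIdeal m k).integral_smul,
    (isJetForm_jetVisc m k (s * ε) (s * δ)).integral_smul,
    (P.isJetForm_jetBend m k).integral_smul, (P.isJetForm_jetDrive m).integral_smul, vac_smul]
  ring

/-- The interface condition is closed because convergence in either norm implies convergence of the
value at `r₀` along a subsequence. The vacuum subsequence is extracted first and refined for the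
plasma. -/
theorem exists_coupled_limit (w : ℕ → Displacement × (ℝ → ℝ)) (hw : ∀ n, w n ∈ P.coupled m k)
    (hcau : Tendsto (fun q : ℕ × ℕ => P.nrm m k (w q.1 - w q.2).1 + P.sob (w q.1 - w q.2).2)
      atTop (𝓝 0)) :
    ∃ z ∈ P.coupled m k, ∃ φ : ℕ → ℕ, StrictMono φ ∧
      Tendsto (fun n => P.nrm m k (z - w (φ n)).1 + P.sob (z - w (φ n)).2) atTop (𝓝 0) := by
  have hle := admissible_le_finiteNorm (P := P) (m := m) (k := k)
  have h1 : Tendsto (fun q : ℕ × ℕ => P.sob ((w q.1).2 - (w q.2).2)) atTop (𝓝 0) :=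
    squeeze_zero (fun q => sob_nonneg)
      (fun q => by rw [← Prod.snd_sub]; exact le_add_of_nonneg_left nrm_nonneg) hcau
  obtain ⟨R, hR, φ, hφ, hRlim, hRpt⟩ := exists_sob_limit (fun n => (w n).2)
    (fun n => (hw n).2.1) h1
  have h2 : Tendsto (fun q : ℕ × ℕ => P.nrm m k ((w q.1).1 - (w q.2).1)) atTop (𝓝 0) :=
    squeeze_zero (fun q => nrm_nonneg)
      (fun q => by rw [← Prod.fst_sub]; exact le_add_of_nonneg_right sob_nonneg) hcau
  have hφφ : Tendsto (fun q : ℕ × ℕ => (φ q.1, φ q.2)) atTop atTop := by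
    rw [← prod_atTop_atTop_eq]
    exact hφ.tendsto_atTop.prodMap hφ.tendsto_atTop
  set y : ℕ → Displacement := fun n => (w (φ n)).1 with hy
  have hya : ∀ n, y n ∈ P.admissible m k := fun n => (hw (φ n)).1
  have hyc : Tendsto (fun q : ℕ × ℕ => P.nrm m k (y q.1 - y q.2)) atTop (𝓝 0) := by
    have h := h2.comp hφφ
    rw [Function.comp_def] at h
    rw [hy]
    exact h
  clear_value y
  obtain ⟨v, hv, ψ, hψ, hvlim, hvpt⟩ := exists_nrm_limit y (fun n => hle (hya n)) hyc
  have hva : v ∈ P.admissible m k :=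
    mem_admissible_of_tendsto hv (fun n => hya (ψ n)) hvlim
  have h3 : Tendsto (fun n => m * P.BθVac P.r₀ * (w (φ (ψ n))).1.ξ P.r₀) atTop
      (𝓝 (m * P.BθVac P.r₀ * v.ξ P.r₀)) := by
    have h := (hvpt P.r₀ ⟨P.r₀_pos, le_rfl⟩).const_mul (m * P.BθVac P.r₀)
    rwa [hy] at h
  have h4 : Tendsto (fun n => P.r₀ * (w (φ (ψ n))).2 P.r₀) atTop (𝓝 (P.r₀ * R P.r₀)) :=
    (hRpt.comp hψ.tendsto_atTop).const_mul _
  have h5 : (fun n => m * P.BθVac P.r₀ * (w (φ (ψ n))).1.ξ P.r₀)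
      = fun n => P.r₀ * (w (φ (ψ n))).2 P.r₀ := funext fun n => (hw (φ (ψ n))).2.2
  rw [h5] at h3
  refine ⟨(v, R), ⟨hva, hR, tendsto_nhds_unique h3 h4⟩, φ ∘ ψ, hφ.comp hψ, ?_⟩
  have h6 := hRlim.comp hψ.tendsto_atTop
  have h7 := hvlim.add h6
  rw [add_zero] at h7
  refine h7.congr fun n => ?_
  rw [Prod.fst_sub, Prod.snd_sub, hy]
  rfl

variable (P) in
theorem exists_isMin_E (hm : m ≠ 0) (k : ℤ) {ε δ s : ℝ} (hε : 0 < ε) (hδ : 0 < δ) (hs : 0 < s) :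
    ∃ w ∈ P.coupled m k, P.J w.1 = 1 ∧ ∀ z ∈ P.coupled m k, P.J z.1 = 1 →
      P.E m k ε δ s w ≤ P.E m k ε δ s z := by
  have hε' : 0 < s * ε := mul_pos hs hε
  have hδ' : 0 < s * δ := mul_pos hs hδ
  set c := min (2 / 9 * (s * ε)) (s * δ) with hc
  have hcpos : 0 < c := lt_min (by positivity) hδ'
  obtain ⟨A, hA, HA⟩ := P.exists_abs_jetIdeal_le hm k
  have hle := admissible_le_finiteNorm (P := P) (m := m) (k := k)
  set Φ : ℝ → (Fin 6 → ℝ) → ℝ := fun r x =>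
    P.jetIdeal m k r x + jetVisc m k (s * ε) (s * δ) r x * r
      + (P.jetBend m k r x + P.jetDrive m r x) with hΦdef
  have hI := fun u (hu : u ∈ P.finiteNorm m k) => integrableOn_jetIdeal hm hu
  have hV := fun u (hu : u ∈ P.finiteNorm m k) => integrableOn_jetVisc hε'.le hδ'.le hu
  have hB := fun u (hu : u ∈ P.finiteNorm m k) => integrableOn_jetBend hm hu
  have hD := fun u (hu : u ∈ P.finiteNorm m k) => integrableOn_jetDrive hm hu
  have hint : ∀ u ∈ P.finiteNorm m k, IntegrableOn (fun r => Φ r (u.jet r)) (Ioo 0 P.r₀) :=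
    fun u hu => ((hI u hu).add (hV u hu)).add ((hB u hu).add (hD u hu))
  have hΦ : IsJetForm Φ :=
    ((P.isJetForm_jetIdeal m k).add (isJetForm_jetVisc m k (s * ε) (s * δ))).add
      ((P.isJetForm_jetBend m k).add (P.isJetForm_jetDrive m))
  have hE : ∀ u ∈ P.finiteNorm m k, ∀ Q ∈ P.vacFields, P.E m k ε δ s (u, Q)
      = 2 * Real.pi ^ 2 * (∫ r in Ioo 0 P.r₀, Φ r (u.jet r)) + 2 * Real.pi ^ 2 * P.vac m k Q := by
    intro u hu Q hQ
    have h1 : ∫ r in Ioo 0 P.r₀, Φ r (u.jet r)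
        = (∫ r in Ioo 0 P.r₀, P.jetIdeal m k r (u.jet r))
          + (∫ r in Ioo 0 P.r₀, jetVisc m k (s * ε) (s * δ) r (u.jet r) * r)
          + ((∫ r in Ioo 0 P.r₀, P.jetBend m k r (u.jet r))
          + ∫ r in Ioo 0 P.r₀, P.jetDrive m r (u.jet r)) := by
      have hIV : IntegrableOn (fun r => P.jetIdeal m k r (u.jet r)
          + jetVisc m k (s * ε) (s * δ) r (u.jet r) * r) (Ioo 0 P.r₀) := (hI u hu).add (hV u hu)
      have hBD : IntegrableOn (fun r => P.jetBend m k r (u.jet r) + P.jetDrive m r (u.jet r))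
          (Ioo 0 P.r₀) := (hB u hu).add (hD u hu)
      rw [← integral_add (hI u hu) (hV u hu), ← integral_add (hB u hu) (hD u hu),
        ← integral_add hIV hBD]
    rw [E_eq hu.1 hQ.1.1, h1]
    ring
  obtain ⟨C₁, C₂, HG⟩ := P.exists_garding (Φ := Φ) (c := c) (C := 3 * A + (s * ε + s * δ)) m k hcpos
    (by positivity) hint (fun r hr x => by
      have hρ := P.ρ_nonneg (Ioo_subset_Icc_self hr)
      obtain ⟨h1, h2, h3, -, -⟩ := HA r hr x
      have h4 := (jetVisc_mul_le (m := m) (k := k) (x := x) hε'.le hδ'.le hρ hr.1.le).2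
      have h5 : 0 ≤ (s * ε + s * δ) * (x 0 ^ 2 + x 1 ^ 2 + x 2 ^ 2) := by positivity
      have h6 : 0 ≤ A * jetDensity m k (P.ρ r) r x :=
        mul_nonneg hA.le (jetDensity_nonneg hρ hr.1.le)
      simp only [hΦdef]
      linarith [le_abs_self (P.jetIdeal m k r x), le_abs_self (P.jetBend m k r x),
        le_abs_self (P.jetDrive m r x)]) (fun r hr x => by
      obtain ⟨-, -, h3, h1, h2⟩ := HA r hr x
      have h4 := le_jetVisc_mul (m := m) (k := k) (ρ := P.ρ r) (δ := s * δ) (x := x) hε'.le hr.1.le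
      have h5 : 0 ≤ (s * ε + s * δ) * (x 0 ^ 2 + x 1 ^ 2 + x 2 ^ 2) := by positivity
      have h6 : 0 ≤ A * (x 0 ^ 2 + x 1 ^ 2 + x 2 ^ 2) := by positivity
      simp only [hΦdef, jetKin]
      linarith [neg_abs_le (P.jetDrive m r x)])
  obtain ⟨c', hc', C', HV⟩ := P.exists_vac_bounds hm k
  have hπ : 0 < 2 * Real.pi ^ 2 := by positivity
  set N : Displacement × (ℝ → ℝ) → ℝ := fun w => P.nrm m k w.1 + P.sob w.2 with hN
  refine exists_isMin_of_garding (P.coupled m k) N (P.E m k ε δ s) (fun w => P.J w.1)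
    (c := 2 * Real.pi ^ 2 * min (c / 2) c') (C := C₂)
    (C₁ := 2 * Real.pi ^ 2 * max C₁ C')
    (C₂ := 2 * Real.pi ^ 2) (mul_pos hπ (lt_min (by positivity) hc'))
    (fun _ _ => add_nonneg nrm_nonneg sob_nonneg) (fun _ _ => J_nonneg)
    (fun w hw t => E_smul hw t) (fun w _ t => J_smul t) ?_
    (fun w hw z hz => J_parallelogram (hle hw.1) (hle hz.1))
    (fun w hw z hz t ht => J_add_le (hle hw.1) (hle hz.1) ht) ?_ ?_ ?_ ?_ ?_ ?_
  · rintro ⟨u, Q⟩ ⟨hu, hQ, -⟩ ⟨v, R⟩ ⟨hv, hR, -⟩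
    have hu' := hle hu
    have hv' := hle hv
    have ha := Submodule.add_mem _ hu' hv'
    have hd := Submodule.sub_mem _ hu' hv'
    rw [Prod.mk_add_mk, Prod.mk_sub_mk, hE _ ha _ (Submodule.add_mem _ hQ hR),
      hE _ hd _ (Submodule.sub_mem _ hQ hR), hE _ hu' _ hQ, hE _ hv' _ hR]
    have h1 := hΦ.integral_parallelogram hu'.1 hv'.1 (hint _ hu') (hint _ hv') (hint _ ha)
      (hint _ hd)
    have h2 := vac_parallelogram (k := k) hm hQ hR
    linear_combination (2 * Real.pi ^ 2) * h1 + (2 * Real.pi ^ 2) * h2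
  · rintro ⟨u, Q⟩ ⟨hu, hQ, -⟩
    rw [hE u (hle hu) Q hQ]
    simp only [hN]
    have h1 := (HG u (hle hu)).1
    have h2 := (HV Q hQ).2
    have h3 := mul_le_mul_of_nonneg_right (le_max_left C₁ C') (nrm_nonneg (P := P) (m := m) (k := k) (u := u))
    have h4 := mul_le_mul_of_nonneg_right (le_max_right C₁ C') (sob_nonneg (P := P) (Q := Q))
    have h5 : (∫ r in Ioo 0 P.r₀, Φ r (u.jet r)) + P.vac m k Q
        ≤ max C₁ C' * (P.nrm m k u + P.sob Q) := by linarith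
    have h6 := mul_le_mul_of_nonneg_left h5 hπ.le
    linarith
  · rintro ⟨u, Q⟩ ⟨hu, hQ, -⟩
    simp only [hN]
    rw [J_eq]
    refine mul_le_mul_of_nonneg_left ?_ hπ.le
    exact (integral_kin_le_nrm (hle hu)).trans (le_add_of_nonneg_right sob_nonneg)
  · rintro ⟨u, Q⟩ ⟨hu, hQ, -⟩
    rw [hE u (hle hu) Q hQ]
    simp only [hN]
    rw [J_eq]
    have h1 := (HG u (hle hu)).2
    have h2 := (HV Q hQ).1
    have h3 := mul_le_mul_of_nonneg_right (min_le_left (c / 2) c') (nrm_nonneg (P := P) (m := m) (k := k) (u := u))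
    have h4 := mul_le_mul_of_nonneg_right (min_le_right (c / 2) c') (sob_nonneg (P := P) (Q := Q))
    have h5 : min (c / 2) c' * (P.nrm m k u + P.sob Q) ≤ (∫ r in Ioo 0 P.r₀, Φ r (u.jet r))
        + C₂ * (∫ r in Ioo 0 P.r₀, P.kin u r) + P.vac m k Q := by linarith
    have h6 := mul_le_mul_of_nonneg_left h5 hπ.le
    linarith
  -- Compactness concerns the displacement alone, since `J` does not see the vacuum field.
  · rintro w hw ⟨B, hB⟩
    exact exists_subseq_J_cauchy (fun n => (w n).1) (fun n => hle (hw n).1)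
      fun n => (le_add_of_nonneg_right sob_nonneg).trans (hB n)
  · exact fun w hw hcau => exists_coupled_limit w hw hcau
  -- A displacement with `ξ(r₀) = 0` is compatible with the zero vacuum field.
  · obtain ⟨u, hu, hu0, hJ⟩ := P.exists_smoothTest_J_pos m k
    refine ⟨(u, 0), ⟨smoothTests_le_admissible hu, Submodule.zero_mem _, ?_⟩, hJ⟩
    simp [hu0]

variable (P) in
theorem exists_isLeast_E (hm : m ≠ 0) (k : ℤ) {ε δ s : ℝ} (hε : 0 < ε) (hδ : 0 < δ) (hs : 0 < s) :
    ∃ w ∈ P.A₂ m k, IsLeast (P.E m k ε δ s '' P.A₂ m k) (P.E m k ε δ s w) := by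
  obtain ⟨w, hw, hJ, hmin⟩ := P.exists_isMin_E hm k hε hδ hs
  have hwA : w ∈ P.A₂ m k := (mem_A₂_iff hm).mpr ⟨hw, hJ⟩
  refine ⟨w, hwA, mem_image_of_mem _ hwA, ?_⟩
  rintro _ ⟨z, hz, rfl⟩
  obtain ⟨h1, h2⟩ := (mem_A₂_iff hm).mp hz
  exact hmin z h1 h2

end ZPinch

/-! ### Test displacements with negative energy -/

theorem exists_contDiff_bump {a b : ℝ} (hab : a < b) :
    ∃ f : ℝ → ℝ, ContDiff ℝ ∞ f ∧ (∀ r ∈ Ioo a b, f r ≠ 0) ∧ (∀ r ∉ Ioo a b, f r = 0) ∧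
      ∀ r ∉ Ioo a b, deriv f r = 0 := by
  let f : ContDiffBump ((a + b) / 2) := ⟨(b - a) / 4, (b - a) / 2, by linarith, by linarith⟩
  have hs : Function.support f = Ioo a b := by
    rw [f.support_eq, Real.ball_eq_Ioo]
    change Ioo ((a + b) / 2 - (b - a) / 2) ((a + b) / 2 + (b - a) / 2) = Ioo a b
    congr 1 <;> ring
  have h0 : ∀ r ∉ Ioo a b, f r = 0 := fun r hr => by
    rwa [← hs, Function.notMem_support] at hr
  refine ⟨f, f.contDiff, fun r hr => ?_, h0, fun r hr => ?_⟩
  · rwa [← hs, Function.mem_support] at hr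
  -- The bump is nonnegative, so each of its zeros is a minimum, including the endpoints of the
  -- support.
  · refine IsLocalMin.deriv_eq_zero (Eventually.of_forall fun x => ?_)
    rw [h0 r hr]
    exact f.nonneg

theorem setIntegral_neg_of_neg_on {g : ℝ → ℝ} {a b : ℝ} {s : Set ℝ} (hs : MeasurableSet s)
    (hg : IntegrableOn g s) (hab : a < b) (hsub : Ioo a b ⊆ s) (hneg : ∀ r ∈ Ioo a b, g r < 0)
    (hle : ∀ r ∈ s, g r ≤ 0) : ∫ r in s, g r < 0 := by
  have h1 : 0 < ∫ r in Ioo a b, -g r := by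
    have h2 := intervalIntegral.intervalIntegral_pos_of_pos_on (f := fun r => -g r)
      ((intervalIntegrable_iff_integrableOn_Ioo_of_le hab.le).mpr (hg.mono_set hsub).neg)
      (fun r hr => neg_pos.mpr (hneg r hr)) hab
    rwa [intervalIntegral.integral_of_le hab.le, integral_Ioc_eq_integral_Ioo] at h2
  have h3 : ∫ r in Ioo a b, -g r ≤ ∫ r in s, -g r := by
    refine setIntegral_mono_set hg.neg ?_ hsub.eventuallyLE
    filter_upwards [ae_restrict_mem hs] with r hr using neg_nonneg.mpr (hle r hr)
  rw [integral_neg (μ := volume.restrict s)] at h3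
  linarith

theorem exists_pos_forall_add_mul_neg {a : ℝ} (ha : a < 0) (d : ℝ) :
    ∃ s₀ > 0, ∀ s : ℝ, 0 < s → s ≤ s₀ → a + s * d < 0 := by
  refine ⟨-a / (2 * (|d| + 1)), div_pos (by linarith) (by positivity), fun s hs hs₀ => ?_⟩
  rw [le_div_iff₀ (by positivity)] at hs₀
  have h1 := mul_le_mul_of_nonneg_left (le_abs_self d) hs.le
  nlinarith [abs_nonneg d]

theorem jetVisc_smul_visc (m k : ℤ) (ε δ s r : ℝ) (x : Fin 6 → ℝ) :
    jetVisc m k (s * ε) (s * δ) r x = s * jetVisc m k ε δ r x := by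
  unfold jetVisc
  ring

theorem integral_jetVisc_smul_visc (m k : ℤ) (ε δ s b : ℝ) (u : Displacement) :
    ∫ r in Ioo 0 b, jetVisc m k (s * ε) (s * δ) r (u.jet r) * r
      = s * ∫ r in Ioo 0 b, jetVisc m k ε δ r (u.jet r) * r := by
  rw [← integral_const_mul]
  simp only [jetVisc_smul_visc, mul_assoc]

namespace ZPinch

variable {P : ZPinch} {m k : ℤ} {u : Displacement}

theorem exists_normalizing_factor (hJ : 0 < P.J u) : ∃ t : ℝ, 0 < t ^ 2 ∧ P.J (t • u) = 1 := by
  refine ⟨(Real.sqrt (P.J u))⁻¹, ?_, ?_⟩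
  · have := Real.sqrt_pos.mpr hJ
    positivity
  · rw [J_smul, inv_pow, Real.sq_sqrt hJ.le, inv_mul_cancel₀ hJ.ne']

/-- By homogeneity one displacement of negative energy suffices. The attained minimum is needed
because it bounds the set of values from below, without which `sInf` says nothing. -/
theorem lam₀_neg {ε δ s : ℝ} (hε : 0 < ε) (hδ : 0 < δ) (hs : 0 < s)
    (hu : u ∈ P.admissible 0 k) (hJ : 0 < P.J u) (hE : P.E₀ k ε δ s u < 0) :
    P.lam₀ k ε δ s < 0 := by
  obtain ⟨t, ht, htJ⟩ := exists_normalizing_factor hJ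
  obtain ⟨v, -, hv⟩ := P.exists_isLeast_E₀ k hε hδ hs
  refine (csInf_le ⟨_, hv.2⟩ (mem_image_of_mem _
    (⟨mem_X_iff.mpr (Submodule.smul_mem _ t hu), htJ⟩ : t • u ∈ P.A₁ k))).trans_lt ?_
  rw [E₀_smul (admissible_le_finiteNorm hu).1]
  exact mul_neg_of_pos_of_neg ht hE

theorem lam_neg {ε δ s : ℝ} (hm : m ≠ 0) (hε : 0 < ε) (hδ : 0 < δ) (hs : 0 < s)
    {w : Displacement × (ℝ → ℝ)} (hw : w ∈ P.coupled m k) (hJ : 0 < P.J w.1)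
    (hE : P.E m k ε δ s w < 0) : P.lam m k ε δ s < 0 := by
  obtain ⟨t, ht, htJ⟩ := exists_normalizing_factor hJ
  obtain ⟨v, -, hv⟩ := P.exists_isLeast_E hm k hε hδ hs
  refine (csInf_le ⟨_, hv.2⟩ (mem_image_of_mem _
    ((mem_A₂_iff hm).mpr ⟨Submodule.smul_mem _ t hw, htJ⟩))).trans_lt ?_
  rw [E_smul hw]
  exact mul_neg_of_pos_of_neg ht hE

variable (P) in
/-- Close to the plasma boundary the pressure gradient dominates the compression term. -/
theorem exists_interchange_unstable_Ioo :
    ∃ a ∈ Ioo 0 P.r₀, ∀ r ∈ Ioo a P.r₀, 2 * P.p' r + 4 * P.γ * P.p r / r < 0 := by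
  have hr₀ := P.r₀_pos
  have hγ : 0 < P.γ := zero_lt_one.trans P.one_lt_γ
  obtain ⟨e, he, hp'⟩ := P.p'_nonpos
  -- The threshold is such that `p / p'` above it gives `4γp < (r₀ / 2)(-p')`; with `r > r₀ / 2`
  -- this yields `4γp / r < -p'`.
  have hlt : -(P.r₀ / (8 * P.γ)) < 0 := neg_neg_of_pos (by positivity)
  have h1 := P.p'_ne_zero.and (P.p_div_p'.eventually (lt_mem_nhds hlt))
  obtain ⟨l, hl, hsub⟩ := mem_nhdsLT_iff_exists_Ioo_subset.mp h1
  refine ⟨max (max l (P.r₀ - e)) (P.r₀ / 2), ⟨lt_max_of_lt_right (by positivity),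
    max_lt (max_lt hl (by linarith)) (by linarith)⟩, fun r hr => ?_⟩
  obtain ⟨⟨h2, h3⟩, h4⟩ := (And.imp_left max_lt_iff.mp (max_lt_iff.mp hr.1))
  have hr' : r ∈ Icc 0 P.r₀ := ⟨by linarith, hr.2.le⟩
  obtain ⟨h5, h6⟩ := hsub ⟨h2, hr.2⟩
  have h7 : P.p' r < 0 := lt_of_le_of_ne (hp' r hr' h3) h5
  change -(P.r₀ / (8 * P.γ)) < P.p r / P.p' r at h6
  have h8 : P.p r < -(P.r₀ / (8 * P.γ)) * P.p' r := (lt_div_iff_of_neg h7).mp h6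
  have h9 : 4 * P.γ * P.p r < P.r₀ / 2 * -P.p' r := by
    have := mul_lt_mul_of_pos_left h8 (show 0 < 4 * P.γ by positivity)
    have h10 : 4 * P.γ * (-(P.r₀ / (8 * P.γ)) * P.p' r) = P.r₀ / 2 * -P.p' r := by
      field_simp
      ring
    linarith
  have h11 : 4 * P.γ * P.p r / r < -P.p' r := by
    rw [div_lt_iff₀ (by linarith)]
    nlinarith
  linarith

variable (P) in
theorem exists_smoothTest_integral_jetIdeal₀_neg (hk : k ≠ 0) :
    ∃ u ∈ smoothTests P.r₀ 0, 0 < P.J u ∧ ∫ r in Ioo 0 P.r₀, P.jetIdeal₀ k r (u.jet r) < 0 := by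
  have hk' : (k : ℝ) ≠ 0 := Int.cast_ne_zero.mpr hk
  obtain ⟨a, ha, hneg⟩ := P.exists_interchange_unstable_Ioo
  obtain ⟨f, hf, hf1, hf0, -⟩ := exists_contDiff_bump ha.2
  have hf' := contDiff_infty_iff_deriv.mp hf
  have hsub : Ioo a P.r₀ ⊆ Ioo 0 P.r₀ := Ioo_subset_Ioo_left ha.1.le
  -- The choice `kη = ξ' - ξ/r` annihilates the magnetic square and reduces the divergence to
  -- `2ξ/r`. Writing `ξ = r f` makes `η = r f' / k` smooth.
  set u : Displacement := ⟨fun r => r * f r, fun r => r * deriv f r / k, 0⟩ with hu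
  have hus : u ∈ smoothTests P.r₀ 0 :=
    ⟨⟨(contDiff_id.mul hf).contDiffOn, ((contDiff_id.mul hf'.2).div_const _).contDiffOn,
      contDiffOn_const⟩, zero_mul _, fun h => absurd rfl h, rfl⟩
  have huN := smoothTests_le_finiteNorm (k := k) hus
  have hval : ∀ r ∈ Ioo 0 P.r₀, P.jetIdeal₀ k r (u.jet r)
      = (2 * P.p' r + 4 * P.γ * P.p r / r) * (r * f r) ^ 2 := by
    intro r hr
    have hr' := hr.1.ne'
    have hd : deriv (fun x => x * f x) r = f r + r * deriv f r := by
      have := (hasDerivAt_id r).mul (hf'.1 r).hasDerivAt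
      rw [one_mul] at this
      exact this.deriv
    change (2 * P.p' r * (r * f r) ^ 2 / r
      + P.Bθ r ^ 2 * (k * (r * deriv f r / k)
        - (r * f r + r * deriv (fun x => x * f x) r - 2 * (r * f r)) / r) ^ 2
      + P.γ * P.p r * ((r * f r + r * deriv (fun x => x * f x) r) / r
        - k * (r * deriv f r / k)) ^ 2) * r = _
    rw [hd]
    field_simp
    ring
  refine ⟨u, hus, J_pos_of_ne_zero huN ha.2 hsub fun r hr =>
    mul_ne_zero (hsub hr).1.ne' (hf1 r hr), ?_⟩
  refine setIntegral_neg_of_neg_on measurableSet_Ioo (integrableOn_jetIdeal₀ huN) ha.2 hsub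
    (fun r hr => ?_) fun r hr => ?_
  · rw [hval r (hsub hr)]
    have h1 := mul_ne_zero (hsub hr).1.ne' (hf1 r hr)
    exact mul_neg_of_neg_of_pos (hneg r hr) (by positivity)
  · rw [hval r hr]
    by_cases h : r ∈ Ioo a P.r₀
    · exact mul_nonpos_of_nonpos_of_nonneg (hneg r h).le (sq_nonneg _)
    · rw [hf0 r h, mul_zero, zero_pow two_ne_zero, mul_zero]

variable (P) in
theorem exists_forall_lam₀_neg (hk : k ≠ 0) {ε δ : ℝ} (hε : 0 < ε) (hδ : 0 < δ) :
    ∃ s₀ > 0, ∀ s : ℝ, 0 < s → s ≤ s₀ → P.lam₀ k ε δ s < 0 := by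
  obtain ⟨u, hu, hJ, hneg⟩ := P.exists_smoothTest_integral_jetIdeal₀_neg hk
  obtain ⟨s₀, hs₀, H⟩ := exists_pos_forall_add_mul_neg hneg
    (∫ r in Ioo 0 P.r₀, jetVisc 0 k ε δ r (u.jet r) * r)
  refine ⟨s₀, hs₀, fun s hs hle => lam₀_neg hε hδ hs (smoothTests_le_admissible hu) hJ ?_⟩
  rw [E₀_eq (smoothTests_le_finiteNorm (k := k) hu).1, integral_jetVisc_smul_visc, ← mul_add]
  exact mul_neg_of_pos_of_neg (by positivity) (H s hs hle)

/-- The displacement with radial component `f` for which `jetIdeal m k` vanishes. -/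
noncomputable def minimizingDisplacement (m k : ℤ) (f : ℝ → ℝ) : Displacement where
  ξ := f
  η := fun r => r * k * (r * deriv f r - f r) / (m ^ 2 + k ^ 2 * r ^ 2)
  ζ := fun r => (r * (k * (r * k * (r * deriv f r - f r) / (m ^ 2 + k ^ 2 * r ^ 2)))
    - (f r + r * deriv f r)) / m

theorem minimizingDisplacement_mem_smoothTests (hm : m ≠ 0) {f : ℝ → ℝ} (hf : ContDiff ℝ ∞ f)
    (hf0 : f 0 = 0) (b : ℝ) : minimizingDisplacement m k f ∈ smoothTests b m := by
  have hf' := (contDiff_infty_iff_deriv.mp hf).2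
  have hm' : (0 : ℝ) < (m : ℝ) ^ 2 := by
    have : (m : ℝ) ≠ 0 := Int.cast_ne_zero.mpr hm
    positivity
  have hη : ContDiff ℝ ∞
      fun r : ℝ => r * k * (r * deriv f r - f r) / ((m : ℝ) ^ 2 + k ^ 2 * r ^ 2) := by
    refine ContDiff.div (by fun_prop) (by fun_prop) fun r => ?_
    positivity
  refine ⟨⟨hf.contDiffOn, hη.contDiffOn, ContDiff.contDiffOn ?_⟩, hf0, fun _ => ?_, ?_⟩
  · exact ((contDiff_id.mul (contDiff_const.mul hη)).sub
      (hf.add (contDiff_id.mul hf'))).div_const _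
  · simp [minimizingDisplacement]
  · simp [minimizingDisplacement, hf0]

theorem jetIdeal_minimizingDisplacement (hm : m ≠ 0) (f : ℝ → ℝ) {r : ℝ} (hr : r ≠ 0) :
    P.jetIdeal m k r ((minimizingDisplacement m k f).jet r) = 0 := by
  have hm' : (m : ℝ) ≠ 0 := Int.cast_ne_zero.mpr hm
  have hden : (m : ℝ) ^ 2 + k ^ 2 * r ^ 2 ≠ 0 := by positivity
  set η := r * k * (r * deriv f r - f r) / ((m : ℝ) ^ 2 + k ^ 2 * r ^ 2) with hη
  -- `η` annihilates the magnetic square, and `ζ`, available because `m ≠ 0`, makes the divergence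
  -- vanish.
  have h1 : P.Bθ r / r * η + (-k * P.Bθ r * (f r + r * deriv f r) + 2 * k * P.Bθ r * f r)
      / ((m : ℝ) ^ 2 + k ^ 2 * r ^ 2) = 0 := by
    rw [hη]
    field_simp
    ring
  have h2 : (f r + r * deriv f r) / r - k * η
      + m * ((r * (k * η) - (f r + r * deriv f r)) / m) / r = 0 := by
    field_simp
    ring
  change (((m : ℝ) ^ 2 + k ^ 2 * r ^ 2) * (P.Bθ r / r * η
      + (-k * P.Bθ r * (f r + r * deriv f r) + 2 * k * P.Bθ r * f r)
        / ((m : ℝ) ^ 2 + k ^ 2 * r ^ 2)) ^ 2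
    + P.γ * P.p r * ((f r + r * deriv f r) / r - k * η
      + m * ((r * (k * η) - (f r + r * deriv f r)) / m) / r) ^ 2) * r = 0
  rw [h1, h2]
  ring

theorem jetDrive_minimizingDisplacement (f : ℝ → ℝ) (r : ℝ) :
    P.jetDrive m r ((minimizingDisplacement m k f).jet r)
      = (2 * P.p' r + (m : ℝ) ^ 2 * P.Bθ r ^ 2 / r) * f r ^ 2 := rfl

theorem jetBend_minimizingDisplacement (l : ℤ) (f : ℝ → ℝ) (r : ℝ) :
    P.jetBend m l r ((minimizingDisplacement m k f).jet r)
      = (m : ℝ) ^ 2 * P.Bθ r ^ 2 / (r * (m ^ 2 + l ^ 2 * r ^ 2)) * (f r - r * deriv f r) ^ 2 := rfl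

/-- The field line bending term of a fixed radial profile decays like `k⁻²`. -/
theorem sq_mul_jetBend_le (hm : m ≠ 0) {c r : ℝ} (hc : 0 < c) (hr : c ≤ r) (x : Fin 6 → ℝ) :
    (k : ℝ) ^ 2 * (c ^ 2 / (m ^ 2 + c ^ 2)) * P.jetBend m k r x ≤ P.jetBend m 1 r x := by
  have hm' : (0 : ℝ) < (m : ℝ) ^ 2 := by
    have : (m : ℝ) ≠ 0 := Int.cast_ne_zero.mpr hm
    positivity
  have hr0 : 0 < r := hc.trans_le hr
  have h1 : (k : ℝ) ^ 2 * (c ^ 2 / (m ^ 2 + c ^ 2)) / (r * (m ^ 2 + k ^ 2 * r ^ 2))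
      ≤ 1 / (r * (m ^ 2 + (1 : ℤ) ^ 2 * r ^ 2)) := by
    have h3 : c ^ 2 ≤ r ^ 2 := by gcongr
    have h4 : c ^ 2 / ((m : ℝ) ^ 2 + c ^ 2) ≤ r ^ 2 / (m ^ 2 + r ^ 2) := by
      rw [div_le_div_iff₀ (by positivity) (by positivity)]
      nlinarith
    have h5 : (k : ℝ) ^ 2 * (r ^ 2 / (m ^ 2 + r ^ 2)) ≤ (m ^ 2 + k ^ 2 * r ^ 2) / (m ^ 2 + r ^ 2) := by
      rw [← mul_div_assoc]
      gcongr
      linarith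
    have h6 : (k : ℝ) ^ 2 * (c ^ 2 / (m ^ 2 + c ^ 2)) ≤ (m ^ 2 + k ^ 2 * r ^ 2) / (m ^ 2 + r ^ 2) :=
      (mul_le_mul_of_nonneg_left h4 (sq_nonneg _)).trans h5
    rw [div_le_div_iff₀ (by positivity) (by push_cast; positivity)]
    rw [le_div_iff₀ (by positivity)] at h6
    push_cast
    nlinarith [mul_le_mul_of_nonneg_left h6 hr0.le]
  have h2 := mul_le_mul_of_nonneg_right h1
    (by positivity : 0 ≤ (m : ℝ) ^ 2 * P.Bθ r ^ 2 * (x 0 - r * x 3) ^ 2)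
  unfold jetBend
  calc _ = (k : ℝ) ^ 2 * (c ^ 2 / (m ^ 2 + c ^ 2)) / (r * (m ^ 2 + k ^ 2 * r ^ 2))
        * (m ^ 2 * P.Bθ r ^ 2 * (x 0 - r * x 3) ^ 2) := by ring
    _ ≤ _ := h2
    _ = _ := by ring

variable (P) in
theorem exists_forall_smoothTest_neg (hm : m ≠ 0)
    (h : ∃ r ∈ Ioo 0 P.r₀, 2 * P.p' r + (m : ℝ) ^ 2 * P.Bθ r ^ 2 / r < 0) :
    ∃ K : ℤ, ∀ k : ℤ, K ≤ |k| → ∃ u ∈ smoothTests P.r₀ m, u.ξ P.r₀ = 0 ∧ 0 < P.J u ∧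
      (∫ r in Ioo 0 P.r₀, P.jetIdeal m k r (u.jet r)) + (∫ r in Ioo 0 P.r₀, P.jetBend m k r (u.jet r))
        + (∫ r in Ioo 0 P.r₀, P.jetDrive m r (u.jet r)) < 0 := by
  obtain ⟨r', hr', hneg⟩ := h
  set q : ℝ → ℝ := fun r => 2 * P.p' r + (m : ℝ) ^ 2 * P.Bθ r ^ 2 / r with hq
  have hcont : ContinuousAt q r' := by
    have h1 : ContinuousAt P.p' r' := P.continuousOn_p'.continuousAt (Icc_mem_nhds hr'.1 hr'.2)
    have h2 : ContinuousAt P.Bθ r' := P.continuousOn_Bθ.continuousAt (Ioc_mem_nhds hr'.1 hr'.2)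
    exact (h1.const_mul 2).add (((h2.pow 2).const_mul _).div continuousAt_id hr'.1.ne')
  obtain ⟨a, b, hab', hsub⟩ := mem_nhds_iff_exists_Ioo_subset.mp
    ((hcont.eventually (gt_mem_nhds hneg)).and
      (Ioo_mem_nhds (show r' / 2 < r' by linarith [hr'.1]) hr'.2))
  have hab : a < b := hab'.1.trans hab'.2
  have hr'pos := hr'.1
  have hsub' : Ioo a b ⊆ Ioo 0 P.r₀ := fun r hr => ⟨by linarith [(hsub hr).2.1], (hsub hr).2.2⟩
  obtain ⟨f, hf, hf1, hf0, hf0'⟩ := exists_contDiff_bump hab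
  have hus := fun k : ℤ => minimizingDisplacement_mem_smoothTests (k := k) hm hf
    (hf0 0 fun h0 => by linarith [(hsub h0).2.1]) P.r₀
  have huN := fun k l : ℤ => smoothTests_le_finiteNorm (k := l) (hus k)
  set D := ∫ r in Ioo 0 P.r₀, P.jetDrive m r ((minimizingDisplacement m 1 f).jet r) with hD
  set I := ∫ r in Ioo 0 P.r₀, P.jetBend m 1 r ((minimizingDisplacement m 1 f).jet r) with hI
  have hDneg : D < 0 := by
    refine setIntegral_neg_of_neg_on measurableSet_Ioo (integrableOn_jetDrive hm (huN 1 1)) hab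
      hsub' (fun r hr => ?_) fun r hr => ?_
    · rw [jetDrive_minimizingDisplacement]
      have h1 := hf1 r hr
      exact mul_neg_of_neg_of_pos (hsub hr).1 (by positivity)
    · rw [jetDrive_minimizingDisplacement]
      by_cases h : r ∈ Ioo a b
      · exact mul_nonpos_of_nonpos_of_nonneg (hsub h).1.le (sq_nonneg _)
      · rw [hf0 r h, zero_pow two_ne_zero, mul_zero]
  have hm' : (0 : ℝ) < (m : ℝ) ^ 2 := by
    have : (m : ℝ) ≠ 0 := Int.cast_ne_zero.mpr hm
    positivity
  -- This is the constant of `sq_mul_jetBend_le` for `c = r' / 2`: the bump is supported to the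
  -- right of `r' / 2`.
  set θ := (r' / 2) ^ 2 / ((m : ℝ) ^ 2 + (r' / 2) ^ 2) with hθ
  have hθpos : 0 < θ := by positivity
  -- The bending integral is at most `I / (k² θ)`, while the driving integral `D` does not depend on
  -- `k`; their sum is negative once `I < k² θ (-D)`. The lower bound 1 gives `|k| ≤ k²`, so a bound
  -- linear in `|k|` suffices. The profile `f` is fixed before `k`, which makes `K` uniform.
  refine ⟨max (⌈I / (θ * -D)⌉ + 1) 1, fun k hk => ⟨minimizingDisplacement m k f, hus k,
    hf0 _ fun h0 => lt_irrefl _ (hsub' h0).2,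
    J_pos_of_ne_zero (huN k k) hab hsub' hf1, ?_⟩⟩
  have hI0 : ∫ r in Ioo 0 P.r₀, P.jetIdeal m k r ((minimizingDisplacement m k f).jet r) = 0 :=
    setIntegral_eq_zero_of_forall_eq_zero fun r hr =>
      jetIdeal_minimizingDisplacement hm f hr.1.ne'
  have hbend : (k : ℝ) ^ 2 * θ
      * ∫ r in Ioo 0 P.r₀, P.jetBend m k r ((minimizingDisplacement m k f).jet r) ≤ I := by
    rw [hI, ← integral_const_mul]
    refine setIntegral_mono_on ((integrableOn_jetBend hm (huN k k)).const_mul _)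
      (integrableOn_jetBend hm (huN 1 1)) measurableSet_Ioo fun r hr => ?_
    by_cases h : r ∈ Ioo a b
    · have h1 := sq_mul_jetBend_le (P := P) (k := k) hm (half_pos hr'pos) (hsub h).2.1.le
        ((minimizingDisplacement m 1 f).jet r)
      -- The bending form sees only `f`, so the index of the displacement can be exchanged freely.
      rwa [jetBend_minimizingDisplacement, ← jetBend_minimizingDisplacement (k := k)] at h1
    · simp only [jetBend_minimizingDisplacement, hf0 r h, hf0' r h]
      simp
  have hk1 : (1 : ℝ) ≤ |(k : ℝ)| := by exact_mod_cast (le_max_right _ _).trans hk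
  have hk2 : I / (θ * -D) < |(k : ℝ)| := by
    have h1 : (⌈I / (θ * -D)⌉ : ℝ) + 1 ≤ |(k : ℝ)| := by
      exact_mod_cast (le_max_left _ _).trans hk
    linarith [Int.le_ceil (I / (θ * -D))]
  rw [div_lt_iff₀ (mul_pos hθpos (neg_pos.mpr hDneg))] at hk2
  have hk3 : |(k : ℝ)| ≤ (k : ℝ) ^ 2 := by
    rw [← sq_abs]
    nlinarith
  have hk4 : I < (k : ℝ) ^ 2 * θ * -D := by
    have := mul_le_mul_of_nonneg_right hk3 (mul_pos hθpos (neg_pos.mpr hDneg)).le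
    linarith
  have hk5 := lt_of_mul_lt_mul_left (hbend.trans_lt hk4) (by positivity)
  have hDk : ∫ r in Ioo 0 P.r₀, P.jetDrive m r ((minimizingDisplacement m k f).jet r) = D := by
    simp only [hD, jetDrive_minimizingDisplacement]
  rw [hI0, hDk]
  linarith

variable (P) in
theorem exists_forall_lam_neg (hm : m ≠ 0)
    (h : ∃ r ∈ Ioo 0 P.r₀, 2 * P.p' r + (m : ℝ) ^ 2 * P.Bθ r ^ 2 / r < 0) :
    ∃ K : ℤ, ∀ k : ℤ, K ≤ |k| → ∀ ε δ : ℝ, 0 < ε → 0 < δ →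
      ∃ s₀ > 0, ∀ s : ℝ, 0 < s → s ≤ s₀ → P.lam m k ε δ s < 0 := by
  obtain ⟨K, hK⟩ := P.exists_forall_smoothTest_neg hm h
  refine ⟨K, fun k hk ε δ hε hδ => ?_⟩
  obtain ⟨u, hu, hu0, hJ, hneg⟩ := hK k hk
  obtain ⟨s₀, hs₀, H⟩ := exists_pos_forall_add_mul_neg hneg
    (∫ r in Ioo 0 P.r₀, jetVisc m k ε δ r (u.jet r) * r)
  refine ⟨s₀, hs₀, fun s hs hle => ?_⟩
  have h0 : (0 : ℝ → ℝ) ∈ P.vacFields := Submodule.zero_mem _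
  have hw : (u, (0 : ℝ → ℝ)) ∈ P.coupled m k :=
    ⟨smoothTests_le_admissible hu, h0, by simp [hu0]⟩
  refine lam_neg hm hε hδ hs hw hJ ?_
  have hvac : P.vac m k 0 = 0 := by
    have := vac_smul (P := P) (m := m) (k := k) (c := 0) (Q := 0)
    simpa using this
  rw [E_eq (smoothTests_le_finiteNorm (k := k) hu).1 h0.1.1, integral_jetVisc_smul_visc, hvac]
  have := mul_neg_of_pos_of_neg (show 0 < 2 * Real.pi ^ 2 by positivity) (H s hs hle)
  linarith

end ZPinch

theorem proposition3p4 (P : ZPinch) :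
    -- `m = 0`: the infimum over `A₁` is attained
    (∀ (k : ℤ) (ε δ s : ℝ), 0 < ε → 0 < δ → 0 < s →
      ∃ u ∈ P.A₁ k, IsLeast (P.E₀ k ε δ s '' P.A₁ k) (P.E₀ k ε δ s u)) ∧
    -- `m = 0`: the infimum is negative for small `s`
    (∀ k : ℤ, k ≠ 0 → ∀ ε δ : ℝ, 0 < ε → 0 < δ →
      ∃ s₀ > 0, ∀ s : ℝ, 0 < s → s ≤ s₀ → P.lam₀ k ε δ s < 0) ∧
    -- `m ≠ 0`: the infimum over `A₂` is attained
    (∀ m k : ℤ, m ≠ 0 → ∀ ε δ s : ℝ, 0 < ε → 0 < δ → 0 < s →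
      ∃ w ∈ P.A₂ m k, IsLeast (P.E m k ε δ s '' P.A₂ m k) (P.E m k ε δ s w)) ∧
    -- `m ≠ 0`: the infimum is negative for large `|k|` and small `s`
    (∀ m : ℤ, m ≠ 0 →
      (∃ r ∈ Ioo 0 P.r₀, 2 * P.p' r + (m : ℝ) ^ 2 * P.Bθ r ^ 2 / r < 0) →
      ∃ K : ℤ, ∀ k : ℤ, K ≤ |k| → ∀ ε δ : ℝ, 0 < ε → 0 < δ →
        ∃ s₀ > 0, ∀ s : ℝ, 0 < s → s ≤ s₀ → P.lam m k ε δ s < 0) :=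
  ⟨fun k _ _ _ hε hδ hs => P.exists_isLeast_E₀ k hε hδ hs,
    fun _ hk _ _ hε hδ => P.exists_forall_lam₀_neg hk hε hδ,
    fun _ k hm _ _ _ hε hδ hs => P.exists_isLeast_E hm k hε hδ hs,
    fun _ hm h => P.exists_forall_lam_neg hm h⟩
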